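/- Let $N\ge k\ge 1$ be integers. Let $\Gamma_N=(\gamma_N^2(i,j))_{1\le i,j\le N}$ be a symmetric matrix with nonnegative real entries, where $\gamma_N(i,j)\ge 0$, and let $\gamma_{\max}=\max_{i,j}\gamma_N(i,j)$. Let $X_N=\big(\gamma_N(i,j)\,x_{i,j}/\sqrt N\big)_{i,j}$, where $(x_{i,j})$ is a Hermitian array of random variables such that the entries $x_{i,j}$ with $i\ge j$ are independent, the $x_{i,i}$ are real standard Gaussian, and the $x_{i,j}$ with $i\neq j$ are centered complex Gaussian of variance one (independent real and imaginary parts, each of law $\mathcal N(0,1/2)$). Let $Y_N$ be a deterministic $N\times N$ Hermitian matrix, $U$ an $N\times k$ complex matrix with orthonormal columns, and $\Theta_k$ a $k\times k$ real diagonal matrix with nonzero diagonal entries. Let $\|\cdot\|$ denote the operator norm associated with the Euclidean norm. For $\lambda\in\mathbb C$ with $\operatorname{Im}\lambda>0$ put $$\beta_k(\lambda)=I_k-U^*(\lambda I_N-X_N-Y_N)^{-1}U\Theta_k .$$ Let $\mathrm D_N(\mathbb C)^{+}$ (resp. $\mathrm D_N(\mathbb C)^-$) be the set of diagonal $N\times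 N$ complex matrices whose diagonal entries all have positive (resp. negative) imaginary part, let $\Delta(A)$ be the diagonal matrix with the same diagonal as $A$, and let $\mathcal R_N(\Lambda)=\operatorname{diag}_{i}\big(\sum_{j=1}^N\frac{\gamma_N^2(i,j)}{N}\Lambda(j,j)\big)$. There is a unique function $G^\square:\mathrm D_N(\mathbb C)^+\to\mathrm D_N(\mathbb C)^-$, analytic in each diagonal variable, such that $$G^\square(\Lambda)=\Delta\Big[\big(\Lambda-\mathcal R_N(G^\square(\Lambda))-Y_N\big)^{-1}\Big]\qquad\text{for all }\Lambda\in\mathrm D_N(\mathbb C)^+ .$$ Define $\Omega^\square(\Lambda)=\Lambda-\mathcal R_N(G^\square(\Lambda))$ and, for $\operatorname{Im}\lambda>0$, $$\tilde\beta_k^\square(\lambda)=I_k-U^*\big(\Omega^\square(\lambda I_N)-Y_N\big)^{-1}U\Theta_k .$$ Let $0<\delta<1$, $d>0$, and let $\lambda\in\mathbb C$ satisfy $\operatorname{Im}\lambda>0$ and $\operatorname{Im}\lambda\ge\gamma_{\max}\big(\tfrac{2}{N(1-\delta)}\big)^{1/5}$. Set $$\bar\varepsilon_N(d)=\sqrt2\,k\,\gamma_{\max}\frac{\sqrt{d\log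 N}}{(\operatorname{Im}\lambda)^2}N^{-1/2}+\frac{2\gamma_{\max}^3}{N(\operatorname{Im}\lambda)^4}+\Big(1+\frac{\gamma_{\max}^2}{\delta(\operatorname{Im}\lambda)^2}\Big)\frac{2\gamma_{\max}^5}{N(\operatorname{Im}\lambda)^6}.$$ Then $$\mathbb P\Big(\|\beta_k(\lambda)-\tilde\beta_k^\square(\lambda)\|>\|\Theta_k\|\,\bar\varepsilon_N(d)\Big)\le 4k^2N^{-d},$$ and, if $\gamma_{\max}>0$, also $$\mathbb P\Big(\|\beta_k(\lambda)-\tilde\beta_k^\square(\lambda)\|\ge\|\Theta_k\|\,\bar\varepsilon_N(d)\Big)\le 4k^2N^{-d}.$$ -/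

import Mathlib

open MeasureTheory ProbabilityTheory
open scoped Matrix Matrix.Norms.L2Operator

noncomputable section

/-- The entries `x i j` (before the division by `√N`) of a standard `N × N` GUE matrix: a Hermitian
array of complex random variables on `(Ω, P)` whose entries on and below the diagonal are
independent, whose diagonal entries are real standard Gaussian, and whose off-diagonal entries are
centered complex Gaussian of variance one, that is, with independent real and imaginary parts of
law `N(0, 1/2)`. -/
structure IsGUEEntries {Ω : Type*} [MeasurableSpace Ω] (P : Measure Ω) {N : ℕ}
    (x : Fin N → Fin N → Ω → ℂ) : Prop where
  measurable : ∀ i j, Measurable (x i j)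
  hermitian : ∀ i j ω, x j i ω = star (x i j ω)
  indep : iIndepFun (fun (p : {p : Fin N × Fin N // p.2 ≤ p.1}) => x p.1.1 p.1.2) P
  law_diag : ∀ i, P.map (fun ω => (x i i ω).re) = gaussianReal 0 1
  law_re : ∀ i j, j < i → P.map (fun ω => (x i j ω).re) = gaussianReal 0 (1 / 2)
  law_im : ∀ i j, j < i → P.map (fun ω => (x i j ω).im) = gaussianReal 0 (1 / 2)
  indep_re_im : ∀ i j, j < i → IndepFun (fun ω => (x i j ω).re) (fun ω => (x i j ω).im) P

/-- The realization `X_N = (γ(i,j) x(i,j) / √N)` of the GUE matrix with variance profile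
`Γ = (γ²(i,j))`, for given values `x` of the entries. -/
def profileMatrix {N : ℕ} (Γ : Matrix (Fin N) (Fin N) ℝ) (x : Fin N → Fin N → ℂ) :
    Matrix (Fin N) (Fin N) ℂ :=
  Matrix.of fun i j => ((√(Γ i j) : ℝ) : ℂ) * (x i j / ((√(N : ℝ) : ℝ) : ℂ))

/-- `γ_max`, the square root of the largest entry of the variance profile `Γ = (γ²(i,j))`. -/
def gammaMax {N : ℕ} (Γ : Matrix (Fin N) (Fin N) ℝ) : ℝ :=
  √(⨆ p : Fin N × Fin N, Γ p.1 p.2)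

/-- Diagonal matrices whose diagonal entries have positive imaginary part. -/
def DPlus (N : ℕ) : Set (Matrix (Fin N) (Fin N) ℂ) :=
  {Λ | Λ.IsDiag ∧ ∀ i, 0 < (Λ i i).im}

/-- Diagonal matrices whose diagonal entries have negative imaginary part. -/
def DMinus (N : ℕ) : Set (Matrix (Fin N) (Fin N) ℂ) :=
  {Λ | Λ.IsDiag ∧ ∀ i, (Λ i i).im < 0}

/-- `Δ(A)`, the diagonal matrix with the same diagonal as `A`. -/
def diagPart {N : ℕ} (A : Matrix (Fin N) (Fin N) ℂ) : Matrix (Fin N) (Fin N) ℂ :=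
  Matrix.diagonal A.diag

/-- The map `R_N(Λ) = diag_i (∑_j γ²(i,j) / N * Λ(j,j))`. -/
def mapR {N : ℕ} (Γ : Matrix (Fin N) (Fin N) ℝ) (Λ : Matrix (Fin N) (Fin N) ℂ) :
    Matrix (Fin N) (Fin N) ℂ :=
  Matrix.diagonal fun i => ∑ j, ((Γ i j / N : ℝ) : ℂ) * Λ j j

/-- `G` maps `D_N(ℂ)⁺` to `D_N(ℂ)⁻`, its entries are analytic in each diagonal variable, and it
solves the fixed point equation `G(Λ) = Δ[(Λ - R_N(G(Λ)) - Y)⁻¹]` on `D_N(ℂ)⁺`. Values of `G`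
outside `D_N(ℂ)⁺` are irrelevant. -/
structure IsDetEquiv {N : ℕ} (Γ : Matrix (Fin N) (Fin N) ℝ) (Y : Matrix (Fin N) (Fin N) ℂ)
    (G : Matrix (Fin N) (Fin N) ℂ → Matrix (Fin N) (Fin N) ℂ) : Prop where
  mapsTo : Set.MapsTo G (DPlus N) (DMinus N)
  analytic : ∀ z : Fin N → ℂ, (∀ i, 0 < (z i).im) → ∀ i k l,
    AnalyticAt ℂ (fun w => G (Matrix.diagonal (Function.update z i w)) k l) (z i)
  fixedPoint : ∀ Λ ∈ DPlus N, G Λ = diagPart (Λ - mapR Γ (G Λ) - Y)⁻¹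

/-- The deterministic equivalent `G_{H_N}^□` of the operator-valued Stieltjes transform of
`H_N = X_N + Y`: the solution (unique on `D_N(ℂ)⁺`) of the fixed point problem `IsDetEquiv`. -/
def detEquiv {N : ℕ} (Γ : Matrix (Fin N) (Fin N) ℝ) (Y : Matrix (Fin N) (Fin N) ℂ) :
    Matrix (Fin N) (Fin N) ℂ → Matrix (Fin N) (Fin N) ℂ :=
  Classical.epsilon (IsDetEquiv Γ Y)

/-- `Ω_{H_N}^□(Λ) = Λ - R_N(G_{H_N}^□(Λ))`. -/
def omegaSq {N : ℕ} (Γ : Matrix (Fin N) (Fin N) ℝ) (Y Λ : Matrix (Fin N) (Fin N) ℂ) :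
    Matrix (Fin N) (Fin N) ℂ :=
  Λ - mapR Γ (detEquiv Γ Y Λ)

/-- `β_k(z) = I_k - U* (z I_N - X - Y)⁻¹ U Θ`. -/
def betaMat {N k : ℕ} (X Y : Matrix (Fin N) (Fin N) ℂ) (U : Matrix (Fin N) (Fin k) ℂ)
    (Θ : Matrix (Fin k) (Fin k) ℂ) (z : ℂ) : Matrix (Fin k) (Fin k) ℂ :=
  1 - Uᴴ * (z • (1 : Matrix (Fin N) (Fin N) ℂ) - X - Y)⁻¹ * U * Θ

/-- `β̃_k^□(z) = I_k - U* (Ω_{H_N}^□(z I_N) - Y)⁻¹ U Θ`. -/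
def betaTilde {N k : ℕ} (Γ : Matrix (Fin N) (Fin N) ℝ) (Y : Matrix (Fin N) (Fin N) ℂ)
    (U : Matrix (Fin N) (Fin k) ℂ) (Θ : Matrix (Fin k) (Fin k) ℂ) (z : ℂ) :
    Matrix (Fin k) (Fin k) ℂ :=
  1 - Uᴴ * (omegaSq Γ Y (z • (1 : Matrix (Fin N) (Fin N) ℂ)) - Y)⁻¹ * U * Θ

/-- The error term `ε̄_N(d)`, with `g = γ_max` and `η = Im z`. -/
def epsBar (N k : ℕ) (g δ d η : ℝ) : ℝ :=
  √2 * k * g * (√(d * Real.log N) / η ^ 2) * (N : ℝ) ^ (-(1 / 2) : ℝ)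
    + 2 * g ^ 3 / (N * η ^ 4)
    + (1 + g ^ 2 / (δ * η ^ 2)) * (2 * g ^ 5 / (N * η ^ 6))

end

/-!
Write `X` for the Gaussian matrix, `R = (z - X - Y)⁻¹`, and `Q = (Ω(z) - Y)⁻¹` for its deterministic
equivalent. Since `β - β̃ = -U* (R - Q) U Θ`, it is enough to bound the fluctuation
`U* (R - E R) U`, which is random, and the bias `E R - Q`, which is not.

*The deterministic equivalent.* With diagonal matrices written as vectors, `G(D)` is a fixed point
in the lower half-plane of `g ↦ diag ((D - S g - Y)⁻¹)`, `S = Γ / N`. Everything about it comes from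
one estimate: by the Ward identities and the Cauchy–Schwarz inequality, the map from `E` to the
diagonal of `(E - Y)⁻¹` does not expand the relative distance `|E - E'| / √(Im E Im E')`
(`norm_inv_diag_sub_inv_diag_le`), while adding `D`, whose imaginary part is positive, to the
self-energy contracts it strictly (`norm_dysonMap_sub_dysonMap_le`). This gives existence through
geometric convergence of the iterates (`exists_isDysonSolution`), analyticity because the
convergence is locally uniform (`analyticAt_of_isDysonSolution`), and, by looking at a coordinate
where the relative distance of two fixed points is largest, uniqueness and a Lipschitz bound in `D`
(`IsDysonSolution.norm_sub_le`, `IsDysonSolution.norm_sub_le_div`).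

*The bias.* Gaussian integration by parts shows that `E R` solves the equation satisfied by `Q` up
to the covariance of `R` with its self-energy (`dyson_mul_meanResolvent_apply`), which the Poincaré
inequality bounds by `O(1/N)` (`norm_meanResolvent_sub_le`). Thus `diag (E R)` is an approximate
fixed point. Its image under the fixed point map is an exact fixed point for a nearby spectral
parameter, which the condition on `Im z` keeps in the half-plane, and the Lipschitz bound applies
(`norm_inv_sub_inv_le_of_approx_isDysonSolution`, `norm_meanResolvent_sub_detEquiv_le`).

*The fluctuation.* An entry of `U* R U` is a function of the underlying standard Gaussian vector
whose gradient has Hilbert–Schmidt norm at most `L = γ_max / (√N (Im z)²)`. For complex functions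
`F`, `G` with gradient bounds `L`, `b` one has `Re Cov(F, G) ≤ L E[b]` (`gaussian_covariance_le`),
by rotating one Gaussian vector into an independent copy and integrating by parts. Applied to `F` and
`F |F|²ⁿ` this bounds the even moments of `F - E F`, hence `E cosh (r |F - E F|) ≤ exp (r² L² / 2)`
and the tail `2 exp (-t² / 2L²)` (`measureReal_le_norm_sub_integral`). Working with complex `F`
throughout avoids the loss of a constant that treating real and imaginary parts separately would
cause. With `t = L √(2 d log N)` each of the `k²` entries exceeds `t` with probability at most
`2 N⁻ᵈ`, and the operator norm of a `k × k` matrix is at most `k` times its largest entry.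

The entries of a GUE matrix are related to a standard Gaussian vector by an invertible linear map,
so that the array `x` may be replaced by such a vector (`map_gueCoords`).
-/

/-! ### Gaussian integration by parts -/

lemma hasDerivAt_gaussianPDFReal_zero_one (x : ℝ) :
    HasDerivAt (gaussianPDFReal 0 1) (-x * gaussianPDFReal 0 1 x) x := by
  have h : HasDerivAt (fun y : ℝ => -(y - 0) ^ 2 / (2 * ((1 : NNReal) : ℝ))) (-x) x := by
    have := (((hasDerivAt_id x).sub_const 0).pow 2).neg.div_const (2 * ((1 : NNReal) : ℝ))
    exact this.congr_deriv (by simp; ring)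
  have := h.exp.const_mul ((√(2 * Real.pi * ((1 : NNReal) : ℝ)))⁻¹)
  exact this.congr_deriv (by simp only [gaussianPDFReal]; ring)

lemma integrable_id_mul_gaussianPDFReal_zero_one :
    Integrable (fun x => x * gaussianPDFReal 0 1 x) := by
  have := (integrable_mul_exp_neg_mul_sq (b := 1 / 2) (by norm_num)).const_mul
    ((√(2 * Real.pi * ((1 : NNReal) : ℝ)))⁻¹)
  refine this.congr (Filter.Eventually.of_forall fun x => ?_)
  simp only [gaussianPDFReal, NNReal.coe_one]
  rw [show -(x - 0) ^ 2 / (2 * 1) = -(1 / 2) * x ^ 2 by ring]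
  ring

/-- Gaussian integration by parts on the line. -/
lemma integral_id_mul_gaussianReal {f f' : ℝ → ℂ} (hf : ∀ x, HasDerivAt f (f' x) x) {C : ℝ}
    (hC : ∀ x, ‖f x‖ ≤ C) (hC' : ∀ x, ‖f' x‖ ≤ C) :
    ∫ x, (x : ℂ) * f x ∂(gaussianReal 0 1) = ∫ x, f' x ∂(gaussianReal 0 1) := by
  have hfm : AEStronglyMeasurable f volume :=
    (continuous_iff_continuousAt.2 fun x => (hf x).continuousAt).aestronglyMeasurable
  have hf'm : AEStronglyMeasurable f' volume := by
    rw [show f' = deriv f from funext fun x => (hf x).deriv.symm]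
    exact (stronglyMeasurable_deriv f).aestronglyMeasurable
  have key := integral_mul_deriv_eq_deriv_mul_of_integrable (u := f) (u' := f')
    (v := fun x => (gaussianPDFReal 0 1 x : ℂ))
    (v' := fun x => ((-x * gaussianPDFReal 0 1 x : ℝ) : ℂ))
    (fun x _ => hf x) (fun x _ => (hasDerivAt_gaussianPDFReal_zero_one x).ofReal_comp)
    (by
      refine Integrable.bdd_mul (c := C) ?_ hfm (Filter.Eventually.of_forall hC)
      refine Integrable.ofReal ?_
      exact integrable_id_mul_gaussianPDFReal_zero_one.neg.congr
        (Filter.Eventually.of_forall fun x => (neg_mul _ _).symm))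
    (Integrable.bdd_mul (c := C) (integrable_gaussianPDFReal 0 1).ofReal hf'm
      (Filter.Eventually.of_forall hC'))
    (Integrable.bdd_mul (c := C) (integrable_gaussianPDFReal 0 1).ofReal hfm
      (Filter.Eventually.of_forall hC))
  rw [integral_gaussianReal_eq_integral_smul one_ne_zero,
    integral_gaussianReal_eq_integral_smul one_ne_zero]
  have h1 : ∀ x : ℝ, gaussianPDFReal 0 1 x • ((x : ℂ) * f x)
      = -(f x * ((-x * gaussianPDFReal 0 1 x : ℝ) : ℂ)) := by
    intro x; rw [Complex.real_smul]; push_cast; ring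
  simp_rw [h1, integral_neg, key, neg_neg, Complex.real_smul]
  exact integral_congr_ae (Filter.Eventually.of_forall fun x => mul_comm _ _)

section GaussianSpace

variable {ι : Type*} [Fintype ι] [DecidableEq ι]

/-- Resampling one coordinate of a standard Gaussian vector independently does not change its law.
This reduces integration by parts in a coordinate to the one-dimensional case by Fubini, without
splitting the index set. -/
lemma stdGaussian_eq_map_replace_coord (p : ι) :
    ((gaussianReal 0 1).prod (stdGaussian (EuclideanSpace ℝ ι))).map
      (fun z : ℝ × EuclideanSpace ℝ ι =>
        z.2 + (z.1 - z.2 p) • EuclideanSpace.single p (1 : ℝ)) =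
    stdGaussian (EuclideanSpace ℝ ι) := by
  have hmeas : Measurable (fun z : ℝ × EuclideanSpace ℝ ι =>
      z.2 + (z.1 - z.2 p) • EuclideanSpace.single p (1 : ℝ)) := by fun_prop
  have : IsFiniteMeasure (((gaussianReal 0 1).prod (stdGaussian (EuclideanSpace ℝ ι))).map
      (fun z : ℝ × EuclideanSpace ℝ ι =>
        z.2 + (z.1 - z.2 p) • EuclideanSpace.single p (1 : ℝ))) := by infer_instance
  refine Measure.ext_of_charFun ?_
  ext t
  have h2 := charFun_stdGaussian (E := EuclideanSpace ℝ ι)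
    (t - t p • EuclideanSpace.single p (1 : ℝ))
  have h3 := charFun_gaussianReal (μ := 0) (v := 1) (t p)
  rw [charFun_stdGaussian, charFun_apply, integral_map hmeas.aemeasurable (by fun_prop)]
  rw [charFun_apply] at h2
  rw [charFun_apply_real] at h3
  have : ∀ z : ℝ × EuclideanSpace ℝ ι,
      Complex.exp (inner ℝ (z.2 + (z.1 - z.2 p) • EuclideanSpace.single p (1 : ℝ)) t * Complex.I)
      = Complex.exp (t p * z.1 * Complex.I) *
        Complex.exp (inner ℝ z.2 (t - t p • EuclideanSpace.single p (1 : ℝ)) * Complex.I) := by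
    intro z
    rw [← Complex.exp_add]
    congr 1
    simp [inner_add_left, inner_sub_right, inner_smul_left, inner_smul_right,
      EuclideanSpace.inner_single_left, EuclideanSpace.inner_single_right]
    ring
  simp_rw [this]
  rw [integral_prod_mul (fun y : ℝ => Complex.exp (t p * y * Complex.I))
    (fun x : EuclideanSpace ℝ ι => Complex.exp
      (inner ℝ x (t - t p • EuclideanSpace.single p (1 : ℝ)) * Complex.I)),
    h2, h3, ← Complex.exp_add]
  congr 1
  have : ‖t - t p • EuclideanSpace.single p (1 : ℝ)‖ ^ 2 = ‖t‖ ^ 2 - t p ^ 2 := by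
    rw [@norm_sub_sq_real]
    simp [inner_smul_right, norm_smul, EuclideanSpace.inner_single_right]
    ring
  rw [← Complex.ofReal_pow ‖t - _‖, this]
  push_cast
  ring

omit [DecidableEq ι] in
lemma integrable_norm_stdGaussian :
    Integrable (fun x : EuclideanSpace ℝ ι => ‖x‖) (stdGaussian (EuclideanSpace ℝ ι)) :=
  (IsGaussian.integrable_id (μ := stdGaussian (EuclideanSpace ℝ ι))).norm

/-- Gaussian integration by parts in one coordinate of a standard Gaussian vector. -/
lemma integral_coord_mul_stdGaussian {f f' : EuclideanSpace ℝ ι → ℂ} (p : ι)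
    (hf : ∀ x, HasDerivAt (fun s : ℝ => f (x + s • EuclideanSpace.single p (1 : ℝ))) (f' x) 0)
    (hfc : Continuous f) (hfc' : Continuous f') {C : ℝ}
    (hC : ∀ x, ‖f x‖ ≤ C) (hC' : ∀ x, ‖f' x‖ ≤ C) :
    ∫ x, (x p : ℂ) * f x ∂(stdGaussian (EuclideanSpace ℝ ι))
      = ∫ x, f' x ∂(stdGaussian (EuclideanSpace ℝ ι)) := by
  set μ := stdGaussian (EuclideanSpace ℝ ι) with hμ
  set T : ℝ × EuclideanSpace ℝ ι → EuclideanSpace ℝ ι := fun z =>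
        z.2 + (z.1 - z.2 p) • EuclideanSpace.single p (1 : ℝ) with hT
  have hTc : Continuous T := by fun_prop
  have hmap : ((gaussianReal 0 1).prod μ).map T = μ := stdGaussian_eq_map_replace_coord p
  have hint : Integrable (fun x : EuclideanSpace ℝ ι => (x p : ℂ) * f x) μ := by
    refine Integrable.mul_bdd (c := C) ?_ hfc.aestronglyMeasurable (Filter.Eventually.of_forall hC)
    refine Integrable.mono' integrable_norm_stdGaussian (by fun_prop)
      (Filter.Eventually.of_forall fun x => ?_)
    simpa using PiLp.norm_apply_le x p
  have hint' : Integrable f' μ :=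
    (integrable_const C).mono' hfc'.aestronglyMeasurable (Filter.Eventually.of_forall hC')
  rw [← hmap] at hint hint' ⊢
  rw [integral_map hTc.aemeasurable (by fun_prop), integral_map hTc.aemeasurable (by fun_prop)]
  rw [integrable_map_measure (by fun_prop) hTc.aemeasurable] at hint hint'
  simp only [Function.comp_def] at hint hint'
  rw [integral_prod_symm _ hint, integral_prod_symm _ hint']
  refine integral_congr_ae (Filter.Eventually.of_forall fun x => ?_)
  have := integral_id_mul_gaussianReal (f := fun y => f (T (y, x))) (f' := fun y => f' (T (y, x)))
    (C := C) (fun y => ?_) (fun y => hC _) (fun y => hC' _)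
  · refine Eq.trans ?_ this
    refine integral_congr_ae (Filter.Eventually.of_forall fun y => ?_)
    simp [hT]
  · have h := hf (T (y, x))
    have h2 := HasDerivAt.comp_sub_const
      (f := fun s : ℝ => f (T (y, x) + s • EuclideanSpace.single p (1 : ℝ))) y y (by simpa using h)
    refine h2.congr_of_eventuallyEq (Filter.Eventually.of_forall fun s => ?_)
    simp only [hT]
    congr 1
    module

end GaussianSpace

/-! ### Functions with bounded gradient -/

section GaussianCovariance

variable {ι : Type*} [Fintype ι]

/-- Bounded continuously differentiable complex functions on `ℝ^ι` with bounded derivative. -/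
structure BoundedC1 (F : EuclideanSpace ℝ ι → ℂ) : Prop where
  contDiff : ContDiff ℝ 1 F
  bound : ∃ C : ℝ, ∀ x, ‖F x‖ ≤ C ∧ ‖fderiv ℝ F x‖ ≤ C

namespace BoundedC1

variable {F G : EuclideanSpace ℝ ι → ℂ}

lemma continuous (hF : BoundedC1 F) : Continuous F := hF.contDiff.continuous

lemma differentiable (hF : BoundedC1 F) : Differentiable ℝ F :=
  hF.contDiff.differentiable one_ne_zero

lemma continuous_fderiv (hF : BoundedC1 F) : Continuous (fderiv ℝ F) :=
  hF.contDiff.continuous_fderiv one_ne_zero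

lemma exists_nonneg_bound (hF : BoundedC1 F) :
    ∃ C : ℝ, 0 ≤ C ∧ ∀ x, ‖F x‖ ≤ C ∧ ‖fderiv ℝ F x‖ ≤ C := by
  obtain ⟨C, hC⟩ := hF.bound
  exact ⟨C, (norm_nonneg _).trans (hC 0).1, hC⟩

lemma integrable (hF : BoundedC1 F) (μ : Measure (EuclideanSpace ℝ ι)) [IsFiniteMeasure μ] :
    Integrable F μ := by
  obtain ⟨C, hC⟩ := hF.bound
  exact (integrable_const C).mono' hF.continuous.aestronglyMeasurable
    (Filter.Eventually.of_forall fun x => (hC x).1)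

lemma const (c : ℂ) : BoundedC1 (fun _ : EuclideanSpace ℝ ι => c) where
  contDiff := contDiff_const
  bound := ⟨‖c‖, fun x => by simp⟩

lemma add (hF : BoundedC1 F) (hG : BoundedC1 G) : BoundedC1 (fun x => F x + G x) where
  contDiff := hF.contDiff.add hG.contDiff
  bound := by
    obtain ⟨C, hC⟩ := hF.bound
    obtain ⟨D, hD⟩ := hG.bound
    refine ⟨C + D, fun x => ⟨(norm_add_le _ _).trans (add_le_add (hC x).1 (hD x).1), ?_⟩⟩
    rw [fderiv_fun_add (hF.differentiable x) (hG.differentiable x)]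
    exact (norm_add_le _ _).trans (add_le_add (hC x).2 (hD x).2)

lemma mul (hF : BoundedC1 F) (hG : BoundedC1 G) : BoundedC1 (fun x => F x * G x) where
  contDiff := hF.contDiff.mul hG.contDiff
  bound := by
    obtain ⟨C, hC0, hC⟩ := hF.exists_nonneg_bound
    obtain ⟨D, hD0, hD⟩ := hG.exists_nonneg_bound
    refine ⟨C * D + D * C, fun x => ⟨?_, ?_⟩⟩
    · rw [norm_mul]
      have := mul_le_mul (hC x).1 (hD x).1 (norm_nonneg _) hC0
      nlinarith [mul_nonneg hC0 hD0]
    · rw [fderiv_fun_mul (hF.differentiable x) (hG.differentiable x)]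
      refine (norm_add_le _ _).trans (add_le_add ?_ ?_)
      · rw [norm_smul]
        exact mul_le_mul (hC x).1 (hD x).2 (norm_nonneg _) hC0
      · rw [norm_smul]
        exact mul_le_mul (hD x).1 (hC x).2 (norm_nonneg _) hD0

lemma star (hF : BoundedC1 F) : BoundedC1 (fun x => Star.star (F x)) where
  contDiff := Complex.conjCLE.contDiff.comp hF.contDiff
  bound := by
    obtain ⟨C, hC⟩ := hF.bound
    refine ⟨C, fun x => ⟨by simpa using (hC x).1, ?_⟩⟩
    rw [fderiv_star]
    refine (ContinuousLinearMap.opNorm_le_bound _ (norm_nonneg _) fun y => ?_).trans (hC x).2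
    simpa using (fderiv ℝ F x).le_opNorm y

lemma sub_const (hF : BoundedC1 F) (c : ℂ) : BoundedC1 (fun x => F x - c) := by
  simpa [sub_eq_add_neg] using hF.add (const (-c))

lemma pow (hF : BoundedC1 F) (n : ℕ) : BoundedC1 (fun x => F x ^ n) := by
  induction n with
  | zero => simpa using const 1
  | succ n ih => simpa [pow_succ] using ih.mul hF

end BoundedC1

variable [DecidableEq ι]

/-- The partial derivative of a function on `ℝ^ι` in the coordinate `p`. -/
noncomputable def partialDeriv (p : ι) (F : EuclideanSpace ℝ ι → ℂ) (x : EuclideanSpace ℝ ι) : ℂ :=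
  fderiv ℝ F x (EuclideanSpace.single p (1 : ℝ))

/-- The squared Hilbert–Schmidt norm `∑ₚ |∂ₚF|²` of the derivative of a complex function on
`ℝ^ι`. -/
noncomputable def gradNormSq (F : EuclideanSpace ℝ ι → ℂ) (x : EuclideanSpace ℝ ι) : ℝ :=
  ∑ p, ‖partialDeriv p F x‖ ^ 2

lemma fderiv_apply_eq_sum (F : EuclideanSpace ℝ ι → ℂ) (x w : EuclideanSpace ℝ ι) :
    fderiv ℝ F x w = ∑ p, (w p : ℂ) * partialDeriv p F x := by
  conv_lhs => rw [← (EuclideanSpace.basisFun ι ℝ).sum_repr w]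
  simp [map_sum, partialDeriv]

lemma norm_partialDeriv_le (F : EuclideanSpace ℝ ι → ℂ) (x : EuclideanSpace ℝ ι) (p : ι) :
    ‖partialDeriv p F x‖ ≤ ‖fderiv ℝ F x‖ := by
  simpa [partialDeriv] using (fderiv ℝ F x).le_opNorm (EuclideanSpace.single p (1 : ℝ))

lemma BoundedC1.continuous_partialDeriv {F : EuclideanSpace ℝ ι → ℂ} (hF : BoundedC1 F) (p : ι) :
    Continuous (partialDeriv p F) :=
  hF.continuous_fderiv.clm_apply continuous_const

omit [DecidableEq ι] in
lemma re_sum_star_mul_le {a b : ι → ℂ} {A B : ℝ} (hA : 0 ≤ A) (hB : 0 ≤ B)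
    (ha : ∑ p, ‖a p‖ ^ 2 ≤ A ^ 2) (hb : ∑ p, ‖b p‖ ^ 2 ≤ B ^ 2) :
    (∑ p, star (a p) * b p).re ≤ A * B := by
  have h1 : (∑ p, star (a p) * b p).re ≤ ∑ p, ‖a p‖ * ‖b p‖ := by
    refine (Complex.re_le_norm _).trans ((norm_sum_le _ _).trans_eq ?_)
    simp
  refine h1.trans ?_
  refine le_of_sq_le_sq ?_ (mul_nonneg hA hB)
  calc _ ≤ (∑ p, ‖a p‖ ^ 2) * ∑ p, ‖b p‖ ^ 2 := Finset.sum_mul_sq_le_sq_mul_sq _ _ _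
    _ ≤ A ^ 2 * B ^ 2 := mul_le_mul ha hb (Finset.sum_nonneg fun _ _ => by positivity)
        (by positivity)
    _ = _ := by ring

/-- Gaussian integration by parts in `w` turns the directional derivative of `G` along `w` into a
scalar product of gradients; `F (c z - s w)` is the factor that depends on `w`. -/
lemma integral_star_mul_fderiv_stdGaussian {F G : EuclideanSpace ℝ ι → ℂ} (hF : BoundedC1 F)
    (c s : ℝ) (z : EuclideanSpace ℝ ι) :
    ∫ w, star (F (c • z - s • w)) * fderiv ℝ G z w ∂(stdGaussian (EuclideanSpace ℝ ι))
      = -s * ∫ w, ∑ p, star (partialDeriv p F (c • z - s • w)) * partialDeriv p G z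
          ∂(stdGaussian (EuclideanSpace ℝ ι)) := by
  obtain ⟨C, hC0, hC⟩ := hF.exists_nonneg_bound
  have hFc := hF.continuous
  have hcoord : ∀ p, ∫ w, (w p : ℂ) * star (F (c • z - s • w)) ∂(stdGaussian (EuclideanSpace ℝ ι))
      = ∫ w, -s * star (partialDeriv p F (c • z - s • w)) ∂(stdGaussian (EuclideanSpace ℝ ι)) := by
    intro p
    have hpc := hF.continuous_partialDeriv p
    refine integral_coord_mul_stdGaussian p (C := max C (|s| * C)) (fun w => ?_) (by fun_prop)
      (by fun_prop) (fun w => ?_) (fun w => ?_)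
    · have h1 : HasDerivAt (fun r : ℝ => c • z - s • (w + r • EuclideanSpace.single p (1 : ℝ)))
          (-(s • EuclideanSpace.single p (1 : ℝ))) 0 := by
        have := ((((hasDerivAt_id (0 : ℝ)).smul_const (EuclideanSpace.single p (1 : ℝ))).const_add
          w).const_smul s).const_sub (c • z)
        simpa using this
      have h2 := ((hF.differentiable (c • z - s • w)).hasFDerivAt).comp_hasDerivAt_of_eq (0 : ℝ) h1
        (by simp)
      refine h2.star.congr_deriv ?_
      simp [partialDeriv]
    · simpa using Or.inl (hC _).1
    · rw [norm_mul, norm_star]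
      refine le_max_of_le_right ?_
      simpa using mul_le_mul_of_nonneg_left ((norm_partialDeriv_le F _ p).trans (hC _).2)
        (abs_nonneg s)
  have hint : ∀ p, Integrable (fun w : EuclideanSpace ℝ ι => (w p : ℂ) * star (F (c • z - s • w)))
      (stdGaussian (EuclideanSpace ℝ ι)) := by
    intro p
    refine Integrable.mul_bdd (c := C) ?_ (by fun_prop)
      (Filter.Eventually.of_forall fun x => by simpa using (hC _).1)
    refine Integrable.mono' integrable_norm_stdGaussian (by fun_prop)
      (Filter.Eventually.of_forall fun x => ?_)
    simpa using PiLp.norm_apply_le x p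
  have hint' : ∀ p, Integrable (fun w : EuclideanSpace ℝ ι =>
      star (partialDeriv p F (c • z - s • w))) (stdGaussian (EuclideanSpace ℝ ι)) := by
    intro p
    have hpc := hF.continuous_partialDeriv p
    refine (integrable_const C).mono' (by fun_prop) (Filter.Eventually.of_forall fun w => ?_)
    simpa using (norm_partialDeriv_le F _ p).trans (hC _).2
  rw [integral_finsetSum _ fun p _ => (hint' p).mul_const _, Finset.mul_sum]
  have : ∀ w, star (F (c • z - s • w)) * fderiv ℝ G z w
      = ∑ p, ((w p : ℂ) * star (F (c • z - s • w))) * partialDeriv p G z := by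
    intro w
    rw [fderiv_apply_eq_sum, Finset.mul_sum]
    exact Finset.sum_congr rfl fun p _ => by ring
  simp_rw [this]
  rw [integral_finsetSum _ fun p _ => (hint p).mul_const _]
  refine Finset.sum_congr rfl fun p _ => ?_
  rw [integral_mul_const, hcoord, integral_const_mul, integral_mul_const]
  ring

end GaussianCovariance

/-! ### The Gaussian covariance inequality -/

section GaussianConcentration

variable {ι : Type*} [Fintype ι] [DecidableEq ι]

omit [DecidableEq ι] in
lemma map_rotation_stdGaussian (t : ℝ) :
    ((stdGaussian (EuclideanSpace ℝ ι)).prod (stdGaussian (EuclideanSpace ℝ ι))).map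
      (ContinuousLinearMap.rotation t) =
    (stdGaussian (EuclideanSpace ℝ ι)).prod (stdGaussian (EuclideanSpace ℝ ι)) :=
  IsGaussian.map_rotation_eq_self_of_forall_strongDual_eq_zero
    integral_strongDual_stdGaussian t

omit [DecidableEq ι] in
/-- Differentiation under the integral sign along the path `t ↦ E[F̄(X) G(cos t X + sin t Y)]`. -/
lemma hasDerivAt_integral_star_mul_rotation {F G : EuclideanSpace ℝ ι → ℂ} (hF : BoundedC1 F)
    (hG : BoundedC1 G) (t : ℝ) :
    Integrable (fun z : EuclideanSpace ℝ ι × EuclideanSpace ℝ ι => star (F z.1) *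
        fderiv ℝ G (Real.cos t • z.1 + Real.sin t • z.2) (-Real.sin t • z.1 + Real.cos t • z.2))
      ((stdGaussian (EuclideanSpace ℝ ι)).prod (stdGaussian (EuclideanSpace ℝ ι))) ∧
    HasDerivAt (fun t : ℝ => ∫ z : EuclideanSpace ℝ ι × EuclideanSpace ℝ ι,
        star (F z.1) * G (Real.cos t • z.1 + Real.sin t • z.2)
          ∂((stdGaussian (EuclideanSpace ℝ ι)).prod (stdGaussian (EuclideanSpace ℝ ι))))
      (∫ z : EuclideanSpace ℝ ι × EuclideanSpace ℝ ι, star (F z.1) *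
        fderiv ℝ G (Real.cos t • z.1 + Real.sin t • z.2) (-Real.sin t • z.1 + Real.cos t • z.2)
          ∂((stdGaussian (EuclideanSpace ℝ ι)).prod (stdGaussian (EuclideanSpace ℝ ι)))) t := by
  obtain ⟨C, hC0, hC⟩ := hF.exists_nonneg_bound
  obtain ⟨D, hD0, hD⟩ := hG.exists_nonneg_bound
  have hFc := hF.continuous
  have hGc := hG.continuous
  have hGc' := hG.continuous_fderiv
  refine hasDerivAt_integral_of_dominated_loc_of_deriv_le (s := Set.univ) (Filter.univ_mem)
    (bound := fun z : EuclideanSpace ℝ ι × EuclideanSpace ℝ ι => C * D * (‖z.1‖ + ‖z.2‖))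
    (F := fun (t : ℝ) (z : EuclideanSpace ℝ ι × EuclideanSpace ℝ ι) =>
      star (F z.1) * G (Real.cos t • z.1 + Real.sin t • z.2))
    (F' := fun (t : ℝ) (z : EuclideanSpace ℝ ι × EuclideanSpace ℝ ι) => star (F z.1) *
      fderiv ℝ G (Real.cos t • z.1 + Real.sin t • z.2) (-Real.sin t • z.1 + Real.cos t • z.2))
    (Filter.Eventually.of_forall fun t => ?_) ?_ ?_ ?_ ?_ ?_
  · exact Continuous.aestronglyMeasurable (by fun_prop)
  · refine (integrable_const (C * D)).mono' (Continuous.aestronglyMeasurable (by fun_prop))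
      (Filter.Eventually.of_forall fun z => ?_)
    rw [norm_mul, norm_star]
    exact mul_le_mul (hC _).1 (hD _).1 (norm_nonneg _) hC0
  · refine Continuous.aestronglyMeasurable ?_
    exact (hFc.comp continuous_fst).star.mul ((hGc'.comp (by fun_prop)).clm_apply (by fun_prop))
  · refine Filter.Eventually.of_forall fun z t _ => ?_
    rw [norm_mul, norm_star, mul_assoc]
    refine mul_le_mul (hC _).1 ?_ (norm_nonneg _) hC0
    refine ((fderiv ℝ G _).le_opNorm _).trans (mul_le_mul (hD _).2 ?_ (norm_nonneg _) hD0)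
    refine (norm_add_le _ _).trans ?_
    rw [norm_smul, norm_smul, norm_neg]
    exact add_le_add (mul_le_of_le_one_left (norm_nonneg _) (Real.abs_sin_le_one t))
      (mul_le_of_le_one_left (norm_nonneg _) (Real.abs_cos_le_one t))
  · exact ((integrable_norm_stdGaussian.comp_fst _).add
      (integrable_norm_stdGaussian.comp_snd _)).const_mul _
  · refine Filter.Eventually.of_forall fun z t _ => ?_
    have h1 : HasDerivAt (fun t : ℝ => Real.cos t • z.1 + Real.sin t • z.2)
        (-Real.sin t • z.1 + Real.cos t • z.2) t :=
      ((Real.hasDerivAt_cos t).smul_const z.1).add ((Real.hasDerivAt_sin t).smul_const z.2)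
    exact (((hG.differentiable _).hasFDerivAt).comp_hasDerivAt t h1).const_mul _

/-- The Gaussian covariance inequality
`Re (E[F̄ G] - E[F̄] E[G]) ≤ L E[b]` for `|∇F| ≤ L` and `|∇G| ≤ b`. The two expectations on the left
are joined by `t ↦ E[F̄(X) G(cos t X + sin t Y)]`, `0 ≤ t ≤ π/2`; rotation invariance and
integration by parts bound the derivative of this path by `L E[b] sin t`. -/
theorem gaussian_covariance_le {F G : EuclideanSpace ℝ ι → ℂ} (hF : BoundedC1 F)
    (hG : BoundedC1 G) {L : ℝ} (hL0 : 0 ≤ L) (hL : ∀ x, gradNormSq F x ≤ L ^ 2)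
    {b : EuclideanSpace ℝ ι → ℝ} (hb0 : ∀ x, 0 ≤ b x) (hb : ∀ x, gradNormSq G x ≤ b x ^ 2)
    (hbint : Integrable b (stdGaussian (EuclideanSpace ℝ ι))) :
    (∫ x, star (F x) * G x ∂(stdGaussian (EuclideanSpace ℝ ι))).re ≤
      ((∫ x, star (F x) ∂(stdGaussian (EuclideanSpace ℝ ι))) *
        ∫ x, G x ∂(stdGaussian (EuclideanSpace ℝ ι))).re
      + L * ∫ x, b x ∂(stdGaussian (EuclideanSpace ℝ ι)) := by
  set μ := stdGaussian (EuclideanSpace ℝ ι) with hμ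
  set h : ℝ → ℂ := fun t => ∫ z : EuclideanSpace ℝ ι × EuclideanSpace ℝ ι,
        star (F z.1) * G (Real.cos t • z.1 + Real.sin t • z.2) ∂(μ.prod μ) with hh
  set h' : ℝ → ℂ := fun t => ∫ z : EuclideanSpace ℝ ι × EuclideanSpace ℝ ι, star (F z.1) *
        fderiv ℝ G (Real.cos t • z.1 + Real.sin t • z.2) (-Real.sin t • z.1 + Real.cos t • z.2)
          ∂(μ.prod μ) with hh'
  have hder : ∀ t, HasDerivAt h (h' t) t := fun t =>
    (hasDerivAt_integral_star_mul_rotation hF hG t).2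
  have hFc := hF.continuous
  have hGc := hG.continuous
  obtain ⟨C, hC0, hC⟩ := hF.exists_nonneg_bound
  obtain ⟨D, hD0, hD⟩ := hG.exists_nonneg_bound
  have hderiv : ∀ t, h' t = ∫ z, -Real.sin t * ∫ w, ∑ p, star (partialDeriv p F
      (Real.cos t • z - Real.sin t • w)) * partialDeriv p G z ∂μ ∂μ := by
    intro t
    have hint := (hasDerivAt_integral_star_mul_rotation hF hG t).1
    have hmeas := hint.aestronglyMeasurable
    simp only [hh', ← hμ] at hint hmeas ⊢
    -- in the rotated coordinates `G` is evaluated at `z` and differentiated along `w`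
    rw [← map_rotation_stdGaussian (-t)] at hint hmeas ⊢
    rw [integral_map (by fun_prop) hmeas]
    rw [integrable_map_measure hmeas (by fun_prop)] at hint
    have hpt : ∀ z : EuclideanSpace ℝ ι × EuclideanSpace ℝ ι,
        Real.cos t • (ContinuousLinearMap.rotation (-t) z).1
          + Real.sin t • (ContinuousLinearMap.rotation (-t) z).2 = z.1 ∧
        -Real.sin t • (ContinuousLinearMap.rotation (-t) z).1
          + Real.cos t • (ContinuousLinearMap.rotation (-t) z).2 = z.2 := by
      intro z
      have hcs := Real.sin_sq_add_cos_sq t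
      rw [ContinuousLinearMap.rotation_apply, Real.cos_neg, Real.sin_neg]
      constructor
      · calc _ = (Real.sin t ^ 2 + Real.cos t ^ 2) • z.1 := by module
          _ = z.1 := by rw [hcs, one_smul]
      · calc _ = (Real.sin t ^ 2 + Real.cos t ^ 2) • z.2 := by module
          _ = z.2 := by rw [hcs, one_smul]
    simp only [Function.comp_def] at hint
    simp only [hpt] at hint ⊢
    rw [integral_prod _ hint]
    refine integral_congr_ae (Filter.Eventually.of_forall fun z => ?_)
    refine Eq.trans ?_ (integral_star_mul_fderiv_stdGaussian (G := G) hF (Real.cos t)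
      (Real.sin t) z)
    refine integral_congr_ae (Filter.Eventually.of_forall fun w => ?_)
    simp only [ContinuousLinearMap.rotation_apply, Real.cos_neg, Real.sin_neg]
    congr 4
    module
  have hsumc : ∀ t : ℝ, Continuous fun q : EuclideanSpace ℝ ι × EuclideanSpace ℝ ι =>
      ∑ p, star (partialDeriv p F (Real.cos t • q.1 - Real.sin t • q.2)) *
        partialDeriv p G q.1 := by
    intro t
    refine continuous_finsetSum _ fun p _ => ?_
    have h1 := hF.continuous_partialDeriv p
    have h2 := hG.continuous_partialDeriv p
    fun_prop
  have hsumb : ∀ (t : ℝ) z w, ‖∑ p, star (partialDeriv p F (Real.cos t • z - Real.sin t • w)) *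
      partialDeriv p G z‖ ≤ Fintype.card ι * (C * D) := by
    intro t z w
    refine (norm_sum_le _ _).trans ?_
    rw [← nsmul_eq_mul]
    refine Finset.sum_le_card_nsmul _ _ _ fun p _ => ?_
    rw [norm_mul, norm_star]
    exact mul_le_mul ((norm_partialDeriv_le F _ p).trans (hC _).2)
      ((norm_partialDeriv_le G _ p).trans (hD _).2) (norm_nonneg _) hC0
  have hbound : ∀ t, 0 ≤ Real.sin t → -(Real.sin t * (L * ∫ x, b x ∂μ)) ≤ (h' t).re := by
    intro t ht
    have hcpt : ∀ z, Integrable (fun w => ∑ p, star (partialDeriv p F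
        (Real.cos t • z - Real.sin t • w)) * partialDeriv p G z) μ := fun z =>
      (integrable_const (Fintype.card ι * (C * D) : ℝ)).mono'
        (((hsumc t).comp (Continuous.prodMk_right z)).aestronglyMeasurable)
        (Filter.Eventually.of_forall fun w => hsumb t z w)
    have hJint : Integrable (fun z => ∫ w, ∑ p, star (partialDeriv p F
        (Real.cos t • z - Real.sin t • w)) * partialDeriv p G z ∂μ) μ := by
      have : Integrable (fun q : EuclideanSpace ℝ ι × EuclideanSpace ℝ ι =>
        ∑ p, star (partialDeriv p F (Real.cos t • q.1 - Real.sin t • q.2)) * partialDeriv p G q.1)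
          (μ.prod μ) :=
        (integrable_const (Fintype.card ι * (C * D) : ℝ)).mono' (hsumc t).aestronglyMeasurable
          (Filter.Eventually.of_forall fun q => hsumb t q.1 q.2)
      exact this.integral_prod_left
    have hJ : ∀ z, (∫ w, ∑ p, star (partialDeriv p F
        (Real.cos t • z - Real.sin t • w)) * partialDeriv p G z ∂μ).re ≤ L * b z := by
      intro z
      rw [← RCLike.re_eq_complex_re, ← integral_re (hcpt z)]
      refine (integral_mono (hcpt z).re (integrable_const (L * b z)) fun w => ?_).trans_eq
        (by simp)
      exact re_sum_star_mul_le hL0 (hb0 z) (hL _) (hb _)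
    rw [hderiv, integral_const_mul]
    have h1 : (∫ z, ∫ w, ∑ p, star (partialDeriv p F
        (Real.cos t • z - Real.sin t • w)) * partialDeriv p G z ∂μ ∂μ).re ≤ L * ∫ x, b x ∂μ := by
      rw [← RCLike.re_eq_complex_re, ← integral_re hJint, ← integral_const_mul]
      exact integral_mono hJint.re (hbint.const_mul L) fun z => hJ z
    rw [← Complex.ofReal_neg, Complex.re_ofReal_mul]
    nlinarith [mul_le_mul_of_nonneg_left h1 ht]
  -- the lower bound on the derivative integrates to `L E[b]` over the quarter turn
  have hmono : MonotoneOn (fun t => (h t).re - (L * ∫ x, b x ∂μ) * Real.cos t)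
      (Set.Icc 0 (Real.pi / 2)) := by
    have hd : ∀ t, HasDerivAt (fun t => (h t).re - (L * ∫ x, b x ∂μ) * Real.cos t)
        ((h' t).re - (L * ∫ x, b x ∂μ) * (-Real.sin t)) t := fun t =>
      (Complex.reCLM.hasFDerivAt.comp_hasDerivAt t (hder t)).sub
        ((Real.hasDerivAt_cos t).const_mul _)
    refine monotoneOn_of_deriv_nonneg (convex_Icc _ _)
      (fun t _ => (hd t).continuousAt.continuousWithinAt)
      (fun t _ => (hd t).differentiableAt.differentiableWithinAt) fun t ht => ?_
    rw [interior_Icc] at ht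
    rw [(hd t).deriv]
    have := hbound t (Real.sin_nonneg_of_nonneg_of_le_pi ht.1.le
      (by linarith [ht.2, Real.pi_pos]))
    linarith
  have hfin := hmono (Set.left_mem_Icc.2 (by positivity)) (Set.right_mem_Icc.2 (by positivity))
    (by positivity)
  have h0 : h 0 = ∫ x, star (F x) * G x ∂μ := by
    simp only [hh, Real.cos_zero, Real.sin_zero, one_smul, zero_smul, add_zero]
    simpa using integral_fun_fst (μ := μ) (ν := μ) (fun x => star (F x) * G x)
  have h1 : h (Real.pi / 2) = (∫ x, star (F x) ∂μ) * ∫ x, G x ∂μ := by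
    simp only [hh, Real.cos_pi_div_two, Real.sin_pi_div_two, one_smul, zero_smul, zero_add]
    exact integral_prod_mul (fun x => star (F x)) G
  rw [← h0, ← h1]
  simp only [Real.cos_zero, Real.cos_pi_div_two] at hfin
  linarith

end GaussianConcentration

/-! ### Moments and concentration -/

section GaussianTail

variable {ι : Type*} [Fintype ι] [DecidableEq ι]

lemma partialDeriv_mul {F G : EuclideanSpace ℝ ι → ℂ} (hF : BoundedC1 F) (hG : BoundedC1 G)
    (p : ι) (x : EuclideanSpace ℝ ι) :
    partialDeriv p (fun x => F x * G x) x
      = F x * partialDeriv p G x + G x * partialDeriv p F x := by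
  simp [partialDeriv, fderiv_fun_mul (hF.differentiable x) (hG.differentiable x)]

lemma partialDeriv_star (F : EuclideanSpace ℝ ι → ℂ) (p : ι) (x : EuclideanSpace ℝ ι) :
    partialDeriv p (fun x => star (F x)) x = star (partialDeriv p F x) := by
  rw [partialDeriv, fderiv_star]
  simp [partialDeriv]

/-- `|∂ (F |F|²ⁿ)| ≤ (2n + 1) |F|²ⁿ |∂F|`, where `|F|²` is written as the polynomial `F̄ F`, which
is differentiable where `|F|` may fail to be. -/
lemma norm_partialDeriv_mul_normSq_pow_le {F : EuclideanSpace ℝ ι → ℂ} (hF : BoundedC1 F) (n : ℕ)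
    (p : ι) (x : EuclideanSpace ℝ ι) :
    ‖partialDeriv p (fun x => F x * (star (F x) * F x) ^ n) x‖
      ≤ (2 * n + 1) * ‖F x‖ ^ (2 * n) * ‖partialDeriv p F x‖ := by
  induction n with
  | zero => simp
  | succ n ih =>
    have h : (fun x => F x * (star (F x) * F x) ^ (n + 1))
        = fun x => (F x * (star (F x) * F x) ^ n) * (star (F x) * F x) := by
      funext x; ring
    rw [h, partialDeriv_mul (hF.mul ((hF.star.mul hF).pow n)) (hF.star.mul hF),
      partialDeriv_mul hF.star hF, partialDeriv_star]
    set v := partialDeriv p F x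
    set a := F x
    set w := partialDeriv p (fun x => F x * (star (F x) * F x) ^ n) x
    have h1 : ‖a * (star a * a) ^ n * (star a * v + a * star v)‖
        ≤ ‖a‖ ^ (2 * n + 1) * (2 * (‖a‖ * ‖v‖)) := by
      have h2 : ‖star a * v + a * star v‖ ≤ 2 * (‖a‖ * ‖v‖) := by
        refine (norm_add_le _ _).trans_eq ?_
        simp only [norm_mul, norm_star]; ring
      rw [norm_mul]
      refine mul_le_mul (le_of_eq ?_) h2 (norm_nonneg _) (by positivity)
      simp only [norm_mul, norm_star, norm_pow]; ring
    have h2 : ‖star a * a * w‖ ≤ ‖a‖ ^ 2 * ((2 * n + 1) * ‖a‖ ^ (2 * n) * ‖v‖) := by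
      rw [norm_mul]
      refine mul_le_mul (le_of_eq ?_) ih (norm_nonneg _) (by positivity)
      simp only [norm_mul, norm_star]; ring
    refine (norm_add_le _ _).trans ((add_le_add h1 h2).trans_eq ?_)
    push_cast
    ring

omit [DecidableEq ι] in
lemma integrable_norm_pow {F : EuclideanSpace ℝ ι → ℂ} (hF : BoundedC1 F) (n : ℕ) :
    Integrable (fun x => ‖F x‖ ^ n) (stdGaussian (EuclideanSpace ℝ ι)) := by
  have := (hF.pow n).integrable (stdGaussian (EuclideanSpace ℝ ι))
  simpa using this.norm

/-- Recursion for the even absolute moments of a centered function with `|∇F| ≤ L`: apply the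
covariance inequality to `F` and `F |F|²ⁿ`. -/
lemma integral_norm_pow_succ_le {F : EuclideanSpace ℝ ι → ℂ} (hF : BoundedC1 F)
    (h0 : ∫ x, F x ∂(stdGaussian (EuclideanSpace ℝ ι)) = 0) {L : ℝ} (hL0 : 0 ≤ L)
    (hL : ∀ x, gradNormSq F x ≤ L ^ 2) (n : ℕ) :
    ∫ x, ‖F x‖ ^ (2 * (n + 1)) ∂(stdGaussian (EuclideanSpace ℝ ι))
      ≤ (2 * n + 1) * L ^ 2 * ∫ x, ‖F x‖ ^ (2 * n) ∂(stdGaussian (EuclideanSpace ℝ ι)) := by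
  have key := gaussian_covariance_le hF (hF.mul ((hF.star.mul hF).pow n)) hL0 hL
    (b := fun x => (2 * n + 1) * L * ‖F x‖ ^ (2 * n)) (fun x => by positivity) (fun x => ?_)
    ((integrable_norm_pow hF (2 * n)).const_mul _)
  · have hs : ∫ x, star (F x) ∂(stdGaussian (EuclideanSpace ℝ ι)) = 0 := by
      have := integral_conj (μ := stdGaussian (EuclideanSpace ℝ ι)) (f := F)
      rw [h0, map_zero] at this
      exact this
    have hpt : ∀ x, star (F x) * (F x * (star (F x) * F x) ^ n)
        = ((‖F x‖ ^ (2 * (n + 1)) : ℝ) : ℂ) := by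
      intro x
      have : star (F x) * F x = ((‖F x‖ ^ 2 : ℝ) : ℂ) := by
        push_cast
        exact Complex.conj_mul' (F x)
      rw [← mul_assoc, this]
      push_cast
      ring
    simp_rw [hpt] at key
    rw [integral_complex_ofReal, Complex.ofReal_re, hs, zero_mul, Complex.zero_re, zero_add,
      integral_const_mul] at key
    linarith
  · have h1 : ∀ p, ‖partialDeriv p (fun x => F x * (star (F x) * F x) ^ n) x‖ ^ 2
        ≤ ((2 * n + 1) * ‖F x‖ ^ (2 * n)) ^ 2 * ‖partialDeriv p F x‖ ^ 2 := by
      intro p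
      rw [← mul_pow]
      exact pow_le_pow_left₀ (norm_nonneg _) (norm_partialDeriv_mul_normSq_pow_le hF n p x) 2
    refine (Finset.sum_le_sum fun p _ => h1 p).trans ?_
    rw [← Finset.mul_sum]
    refine (mul_le_mul_of_nonneg_left (hL x) (by positivity)).trans_eq ?_
    ring

/-- The Gaussian Poincaré inequality for complex functions. -/
theorem integral_norm_sub_integral_sq_le {F : EuclideanSpace ℝ ι → ℂ} (hF : BoundedC1 F)
    {L : ℝ} (hL0 : 0 ≤ L) (hL : ∀ x, gradNormSq F x ≤ L ^ 2) :
    ∫ x, ‖F x - ∫ y, F y ∂(stdGaussian (EuclideanSpace ℝ ι))‖ ^ 2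
      ∂(stdGaussian (EuclideanSpace ℝ ι)) ≤ L ^ 2 := by
  have h0 : ∫ x, (F x - ∫ y, F y ∂(stdGaussian (EuclideanSpace ℝ ι)))
      ∂(stdGaussian (EuclideanSpace ℝ ι)) = 0 := by
    rw [integral_sub (hF.integrable _) (integrable_const _)]; simp
  have := integral_norm_pow_succ_le (hF.sub_const _) h0 hL0
    (fun x => by simpa [gradNormSq, partialDeriv, fderiv_sub_const] using hL x) 0
  simpa using this

/-- The even moments of `|F|` are at most those of a real Gaussian variable of variance `L²`. -/
lemma integral_norm_pow_le {F : EuclideanSpace ℝ ι → ℂ} (hF : BoundedC1 F)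
    (h0 : ∫ x, F x ∂(stdGaussian (EuclideanSpace ℝ ι)) = 0) {L : ℝ} (hL0 : 0 ≤ L)
    (hL : ∀ x, gradNormSq F x ≤ L ^ 2) (n : ℕ) :
    (∫ x, ‖F x‖ ^ (2 * n) ∂(stdGaussian (EuclideanSpace ℝ ι))) / (2 * n).factorial
      ≤ (L ^ 2 / 2) ^ n / n.factorial := by
  induction n with
  | zero => simp
  | succ n ih =>
    have h1 := integral_norm_pow_succ_le hF h0 hL0 hL n
    have h2 : ((2 * (n + 1)).factorial : ℝ) = (2 * n + 2) * (2 * n + 1) * (2 * n).factorial := by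
      rw [show 2 * (n + 1) = 2 * n + 1 + 1 by ring, Nat.factorial_succ, Nat.factorial_succ]
      push_cast; ring
    have h3 : ((n + 1).factorial : ℝ) = (n + 1) * n.factorial := by
      rw [Nat.factorial_succ]; push_cast; ring
    have hpos : (0 : ℝ) < (2 * n).factorial := by exact_mod_cast Nat.factorial_pos _
    have hpos' : (0 : ℝ) < n.factorial := by exact_mod_cast Nat.factorial_pos _
    rw [h2, h3]
    calc _ ≤ ((2 * n + 1) * L ^ 2 * ∫ x, ‖F x‖ ^ (2 * n) ∂(stdGaussian (EuclideanSpace ℝ ι))) /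
          ((2 * n + 2) * (2 * n + 1) * (2 * n).factorial) := by gcongr
      _ = L ^ 2 / (2 * n + 2) * ((∫ x, ‖F x‖ ^ (2 * n) ∂(stdGaussian (EuclideanSpace ℝ ι))) /
          (2 * n).factorial) := by field_simp
      _ ≤ L ^ 2 / (2 * n + 2) * ((L ^ 2 / 2) ^ n / n.factorial) := by gcongr
      _ = _ := by field_simp; ring

/-- The sub-Gaussian bound on the Laplace transform in the form that makes sense for complex `F`:
the power series of `cosh` involves the even moments of `|F|` only. -/
lemma integral_cosh_norm_le {F : EuclideanSpace ℝ ι → ℂ} (hF : BoundedC1 F)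
    (h0 : ∫ x, F x ∂(stdGaussian (EuclideanSpace ℝ ι)) = 0) {L : ℝ} (hL0 : 0 ≤ L)
    (hL : ∀ x, gradNormSq F x ≤ L ^ 2) (r : ℝ) :
    ∫ x, Real.cosh (r * ‖F x‖) ∂(stdGaussian (EuclideanSpace ℝ ι))
      ≤ Real.exp (r ^ 2 * L ^ 2 / 2) := by
  set μ := stdGaussian (EuclideanSpace ℝ ι)
  have hterm : ∀ n : ℕ, ∫ x, (r * ‖F x‖) ^ (2 * n) / (2 * n).factorial ∂μ
      ≤ (r ^ 2 * L ^ 2 / 2) ^ n / n.factorial := by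
    intro n
    have h1 := mul_le_mul_of_nonneg_left (integral_norm_pow_le hF h0 hL0 hL n)
      (pow_nonneg (sq_nonneg r) n)
    calc ∫ x, (r * ‖F x‖) ^ (2 * n) / (2 * n).factorial ∂μ
        = (r ^ 2) ^ n * ((∫ x, ‖F x‖ ^ (2 * n) ∂μ) / (2 * n).factorial) := by
          rw [← integral_div, ← integral_const_mul]
          congr 1
          funext x
          rw [mul_pow, pow_mul r]
          ring
      _ ≤ _ := h1
      _ = _ := by rw [mul_div_assoc (r ^ 2), mul_pow]; ring
  have hint : ∀ n : ℕ, Integrable (fun x => (r * ‖F x‖) ^ (2 * n) / (2 * n).factorial) μ := by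
    intro n
    simp_rw [mul_pow]
    exact ((integrable_norm_pow hF (2 * n)).const_mul _).div_const _
  have hnn : ∀ (n : ℕ) x, 0 ≤ (r * ‖F x‖) ^ (2 * n) / (2 * n).factorial := by
    intro n x
    rw [pow_mul]
    positivity
  have hexp : HasSum (fun n : ℕ => (r ^ 2 * L ^ 2 / 2) ^ n / n.factorial)
      (Real.exp (r ^ 2 * L ^ 2 / 2)) := by
    rw [Real.exp_eq_exp_ℝ]
    exact NormedSpace.expSeries_div_hasSum_exp _
  have hnorm : ∀ n : ℕ, ∫ x, ‖(r * ‖F x‖) ^ (2 * n) / (2 * n).factorial‖ ∂μ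
      = ∫ x, (r * ‖F x‖) ^ (2 * n) / (2 * n).factorial ∂μ := fun n =>
    integral_congr_ae (Filter.Eventually.of_forall fun x => Real.norm_of_nonneg (hnn n x))
  have hsum := hasSum_integral_of_summable_integral_norm hint (by
    simp_rw [hnorm]
    exact Summable.of_nonneg_of_le (fun n => integral_nonneg (hnn n)) hterm hexp.summable)
  have hcosh : ∀ x, ∑' n : ℕ, (r * ‖F x‖) ^ (2 * n) / (2 * n).factorial = Real.cosh (r * ‖F x‖) :=
    fun x => (Real.hasSum_cosh _).tsum_eq
  simp_rw [hcosh] at hsum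
  exact hasSum_le hterm hsum hexp

/-- Gaussian concentration for complex functions: if `|∇F| ≤ L` (in Hilbert–Schmidt norm) then
`|F - E F|` has the same tail `2 exp (-t² / 2L²)` as in the real case. -/
theorem measureReal_le_norm_sub_integral {F : EuclideanSpace ℝ ι → ℂ} (hF : BoundedC1 F)
    {L : ℝ} (hL0 : 0 < L) (hL : ∀ x, gradNormSq F x ≤ L ^ 2) {t : ℝ} (ht : 0 ≤ t) :
    (stdGaussian (EuclideanSpace ℝ ι)).real
      {x | t ≤ ‖F x - ∫ y, F y ∂(stdGaussian (EuclideanSpace ℝ ι))‖}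
      ≤ 2 * Real.exp (-(t ^ 2 / (2 * L ^ 2))) := by
  set μ := stdGaussian (EuclideanSpace ℝ ι)
  have hM : BoundedC1 fun x => F x - ∫ y, F y ∂μ := hF.sub_const _
  have h0 : ∫ x, (F x - ∫ y, F y ∂μ) ∂μ = 0 := by
    rw [integral_sub (hF.integrable _) (integrable_const _)]; simp
  have hgrad : ∀ x, gradNormSq (fun x => F x - ∫ y, F y ∂μ) x ≤ L ^ 2 :=
    fun x => by simpa [gradNormSq, partialDeriv, fderiv_sub_const] using hL x
  -- the parameter that minimizes `r² L² / 2 - r t`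
  set r := t / L ^ 2 with hr
  have hr0 : 0 ≤ r := by positivity
  have hcosh := integral_cosh_norm_le hM h0 hL0.le hgrad r
  have hint : Integrable (fun x => Real.cosh (r * ‖F x - ∫ y, F y ∂μ‖)) μ := by
    obtain ⟨C, hC0, hC⟩ := hM.exists_nonneg_bound
    have hc := hM.continuous
    refine (integrable_const (Real.cosh (r * C))).mono'
      (Real.continuous_cosh.comp (by fun_prop)).aestronglyMeasurable
      (Filter.Eventually.of_forall fun x => ?_)
    rw [Real.norm_of_nonneg (Real.cosh_pos _).le, Real.cosh_le_cosh,
      abs_of_nonneg (by positivity), abs_of_nonneg (by positivity)]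
    exact mul_le_mul_of_nonneg_left (hC x).1 hr0
  have hmarkov := mul_meas_ge_le_integral_of_nonneg
    (Filter.Eventually.of_forall fun x => (Real.cosh_pos _).le) hint (Real.cosh (r * t))
  have hsub : μ.real {x | t ≤ ‖F x - ∫ y, F y ∂μ‖}
      ≤ μ.real {x | Real.cosh (r * t) ≤ Real.cosh (r * ‖F x - ∫ y, F y ∂μ‖)} := by
    refine measureReal_mono fun x hx => ?_
    simp only [Set.mem_ofPred_eq] at hx ⊢
    rw [Real.cosh_le_cosh, abs_of_nonneg (by positivity), abs_of_nonneg (by positivity)]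
    exact mul_le_mul_of_nonneg_left hx hr0
  have hlow : Real.exp (r * t) / 2 ≤ Real.cosh (r * t) := by
    rw [Real.cosh_eq]
    have := Real.exp_pos (-(r * t))
    linarith
  have hmul : Real.exp (r * t) / 2 * μ.real {x | t ≤ ‖F x - ∫ y, F y ∂μ‖}
      ≤ Real.exp (r ^ 2 * L ^ 2 / 2) :=
    ((mul_le_mul hlow hsub measureReal_nonneg (Real.cosh_pos _).le).trans hmarkov).trans hcosh
  have hexp : Real.exp (-(t ^ 2 / (2 * L ^ 2))) * Real.exp (r * t)
      = Real.exp (r ^ 2 * L ^ 2 / 2) := by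
    rw [← Real.exp_add]
    congr 1
    rw [hr]
    field_simp
    ring
  have hpos := Real.exp_pos (r * t)
  rw [← hexp] at hmul
  refine le_of_mul_le_mul_left ?_ hpos
  linarith

/-- Gaussian integration by parts for bounded `C¹` functions. -/
lemma BoundedC1.integral_coord_mul {F : EuclideanSpace ℝ ι → ℂ} (hF : BoundedC1 F) (p : ι) :
    ∫ x, (x p : ℂ) * F x ∂(stdGaussian (EuclideanSpace ℝ ι))
      = ∫ x, partialDeriv p F x ∂(stdGaussian (EuclideanSpace ℝ ι)) := by
  obtain ⟨C, hC⟩ := hF.bound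
  refine integral_coord_mul_stdGaussian p (fun x => ?_) hF.continuous (hF.continuous_partialDeriv p)
    (fun x => (hC x).1) (fun x => (norm_partialDeriv_le F x p).trans (hC x).2)
  have h1 : HasDerivAt (fun s : ℝ => x + s • EuclideanSpace.single p (1 : ℝ))
      (EuclideanSpace.single p (1 : ℝ)) 0 := by
    simpa using ((hasDerivAt_id (0 : ℝ)).smul_const (EuclideanSpace.single p (1 : ℝ))).const_add x
  exact (hF.differentiable x).hasFDerivAt.comp_hasDerivAt_of_eq (0 : ℝ) h1 (by simp)

omit [DecidableEq ι] in
lemma BoundedC1.integrable_coord_mul {F : EuclideanSpace ℝ ι → ℂ} (hF : BoundedC1 F) (p : ι) :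
    Integrable (fun x : EuclideanSpace ℝ ι => (x p : ℂ) * F x)
      (stdGaussian (EuclideanSpace ℝ ι)) := by
  obtain ⟨C, hC⟩ := hF.bound
  refine Integrable.mul_bdd (c := C) ?_ hF.continuous.aestronglyMeasurable
    (Filter.Eventually.of_forall fun x => (hC x).1)
  refine Integrable.mono' integrable_norm_stdGaussian (by fun_prop)
    (Filter.Eventually.of_forall fun x => ?_)
  simpa using PiLp.norm_apply_le x p

omit [DecidableEq ι] in
/-- The Cauchy–Schwarz inequality in `L²` of the Gaussian measure. -/
lemma BoundedC1.norm_integral_mul_sq_le {F G : EuclideanSpace ℝ ι → ℂ} (hF : BoundedC1 F)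
    (hG : BoundedC1 G) :
    ‖∫ x, F x * G x ∂(stdGaussian (EuclideanSpace ℝ ι))‖ ^ 2
      ≤ (∫ x, ‖F x‖ ^ 2 ∂(stdGaussian (EuclideanSpace ℝ ι))) *
        ∫ x, ‖G x‖ ^ 2 ∂(stdGaussian (EuclideanSpace ℝ ι)) := by
  set μ := stdGaussian (EuclideanSpace ℝ ι)
  have h1 := norm_integral_le_integral_norm (μ := μ) (fun x => F x * G x)
  have hint : Integrable (fun x => ‖F x * G x‖) μ := ((hF.mul hG).integrable μ).norm
  have hF2 : Integrable (fun x => ‖F x‖ ^ 2) μ := integrable_norm_pow hF 2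
  have hG2 : Integrable (fun x => ‖G x‖ ^ 2) μ := integrable_norm_pow hG 2
  have hquad : ∀ r : ℝ, 0 ≤ (∫ x, ‖G x‖ ^ 2 ∂μ) * (r * r) + (-2 * ∫ x, ‖F x * G x‖ ∂μ) * r
      + ∫ x, ‖F x‖ ^ 2 ∂μ := by
    intro r
    have h2 : ∫ x, (‖G x‖ ^ 2 * (r * r) + -2 * ‖F x * G x‖ * r + ‖F x‖ ^ 2) ∂μ
        = (∫ x, ‖G x‖ ^ 2 ∂μ) * (r * r) + (-2 * ∫ x, ‖F x * G x‖ ∂μ) * r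
          + ∫ x, ‖F x‖ ^ 2 ∂μ := by
      have hA := hG2.mul_const (r * r)
      have hB := (hint.const_mul (-2)).mul_const r
      have hAB : Integrable (fun x => ‖G x‖ ^ 2 * (r * r) + -2 * ‖F x * G x‖ * r) μ := hA.add hB
      rw [integral_add hAB hF2, integral_add hA hB, integral_mul_const,
        integral_mul_const, integral_const_mul]
    rw [← h2]
    refine integral_nonneg fun x => ?_
    have h3 : ‖G x‖ ^ 2 * (r * r) + -2 * ‖F x * G x‖ * r + ‖F x‖ ^ 2
        = (r * ‖G x‖ - ‖F x‖) ^ 2 := by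
      rw [norm_mul]; ring
    simp only [Pi.zero_apply]
    rw [h3]
    positivity
  have h4 := discrim_le_zero hquad
  rw [discrim] at h4
  have h5 := pow_le_pow_left₀ (norm_nonneg _) h1 2
  nlinarith

end GaussianTail

/-! ### Resolvents of Hermitian matrices -/

section Resolvent

variable {n m : Type*} [Fintype n] [DecidableEq n] [Fintype m] [DecidableEq m]

omit [DecidableEq m] in
lemma sum_norm_mulVec_sq_le (A : Matrix m n ℂ) (v : n → ℂ) :
    ∑ i, ‖(A *ᵥ v) i‖ ^ 2 ≤ ‖A‖ ^ 2 * ∑ i, ‖v i‖ ^ 2 := by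
  have h := Matrix.l2_opNorm_mulVec A (WithLp.toLp 2 v)
  have h2 := pow_le_pow_left₀ (norm_nonneg _) h 2
  rw [mul_pow, EuclideanSpace.norm_sq_eq, EuclideanSpace.norm_sq_eq] at h2
  simpa using h2

omit [DecidableEq m] in
lemma l2_opNorm_le_of_sum_mulVec {A : Matrix m n ℂ} {c : ℝ} (hc : 0 ≤ c)
    (h : ∀ v : n → ℂ, ∑ i, ‖(A *ᵥ v) i‖ ^ 2 ≤ c ^ 2 * ∑ i, ‖v i‖ ^ 2) : ‖A‖ ≤ c := by
  rw [Matrix.l2_opNorm_def]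
  refine ContinuousLinearMap.opNorm_le_bound _ hc fun v => ?_
  refine le_of_sq_le_sq ?_ (by positivity)
  rw [mul_pow, EuclideanSpace.norm_sq_eq, EuclideanSpace.norm_sq_eq]
  simpa using h v.ofLp

omit [DecidableEq m] in
lemma norm_entry_le_l2_opNorm (A : Matrix m n ℂ) (i : m) (j : n) : ‖A i j‖ ≤ ‖A‖ := by
  have h := sum_norm_mulVec_sq_le A (Pi.single j 1)
  have h1 : ∑ k, ‖(Pi.single j (1 : ℂ) : n → ℂ) k‖ ^ 2 = 1 := by
    rw [Finset.sum_eq_single j] <;> simp +contextual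
  rw [h1, mul_one] at h
  refine le_of_sq_le_sq (le_trans ?_ h) (norm_nonneg _)
  have := Finset.single_le_sum (f := fun k => ‖(A *ᵥ Pi.single j 1) k‖ ^ 2)
    (fun k _ => by positivity) (Finset.mem_univ i)
  simpa using this

lemma im_dotProduct_diagonal_sub_mulVec {H : Matrix n n ℂ} (hH : H.IsHermitian) (D v : n → ℂ) :
    (star v ⬝ᵥ ((Matrix.diagonal D - H) *ᵥ v)).im = ∑ i, ‖v i‖ ^ 2 * (D i).im := by
  have h1 : (star v ⬝ᵥ (H *ᵥ v)).im = 0 := by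
    simpa using hH.im_star_dotProduct_mulVec_self v
  rw [Matrix.sub_mulVec, dotProduct_sub, Complex.sub_im, h1, sub_zero, dotProduct, Complex.im_sum]
  refine Finset.sum_congr rfl fun i _ => ?_
  have : (star v) i * (Matrix.diagonal D *ᵥ v) i = ((‖v i‖ ^ 2 : ℝ) : ℂ) * D i := by
    have := Complex.conj_mul' (v i)
    rw [Matrix.mulVec_diagonal]
    push_cast
    rw [← this]
    simp
    ring
  rw [this, Complex.im_ofReal_mul]

lemma isUnit_diagonal_sub {H : Matrix n n ℂ} (hH : H.IsHermitian) {D : n → ℂ}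
    (hD : ∀ i, 0 < (D i).im) : IsUnit (Matrix.diagonal D - H) := by
  rw [Matrix.isUnit_iff_isUnit_det, isUnit_iff_ne_zero]
  intro h0
  obtain ⟨v, hv, hMv⟩ := Matrix.exists_mulVec_eq_zero_iff.2 h0
  have h := im_dotProduct_diagonal_sub_mulVec hH D v
  rw [hMv, dotProduct_zero, Complex.zero_im] at h
  refine hv (funext fun i => ?_)
  have := (Finset.sum_eq_zero_iff_of_nonneg fun i _ =>
    mul_nonneg (sq_nonneg ‖v i‖) (hD i).le).1 h.symm i (Finset.mem_univ i)
  simpa [(hD i).ne'] using this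

lemma isUnit_det_diagonal_sub {H : Matrix n n ℂ} (hH : H.IsHermitian) {D : n → ℂ}
    (hD : ∀ i, 0 < (D i).im) : IsUnit (Matrix.diagonal D - H).det :=
  (Matrix.isUnit_iff_isUnit_det _).1 (isUnit_diagonal_sub hH hD)

lemma l2_opNorm_inv_diagonal_sub_le {H : Matrix n n ℂ} (hH : H.IsHermitian) {D : n → ℂ} {η : ℝ}
    (hη : 0 < η) (hD : ∀ i, η ≤ (D i).im) : ‖(Matrix.diagonal D - H)⁻¹‖ ≤ η⁻¹ := by
  have hdet := isUnit_det_diagonal_sub hH fun i => hη.trans_le (hD i)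
  refine l2_opNorm_le_of_sum_mulVec (by positivity) fun w => ?_
  set v := (Matrix.diagonal D - H)⁻¹ *ᵥ w with hv
  have hMv : (Matrix.diagonal D - H) *ᵥ v = w := by
    rw [hv, Matrix.mulVec_mulVec, Matrix.mul_nonsing_inv _ hdet, Matrix.one_mulVec]
  have h := im_dotProduct_diagonal_sub_mulVec hH D v
  rw [hMv] at h
  have h1 : η * ∑ i, ‖v i‖ ^ 2 ≤ (star v ⬝ᵥ w).im := by
    rw [h, Finset.mul_sum]
    exact Finset.sum_le_sum fun i _ => by
      rw [mul_comm]; exact mul_le_mul_of_nonneg_left (hD i) (sq_nonneg _)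
  have h2 : (star v ⬝ᵥ w).im ≤ ∑ i, ‖v i‖ * ‖w i‖ := by
    refine (Complex.im_le_norm _).trans ((norm_sum_le _ _).trans_eq ?_)
    simp
  have h3 := Finset.sum_mul_sq_le_sq_mul_sq Finset.univ (fun i => ‖v i‖) (fun i => ‖w i‖)
  set V := ∑ i, ‖v i‖ ^ 2
  set W := ∑ i, ‖w i‖ ^ 2
  have hV0 : 0 ≤ V := Finset.sum_nonneg fun _ _ => by positivity
  have h4 : (η * V) ^ 2 ≤ V * W :=
    (pow_le_pow_left₀ (by positivity) (h1.trans h2) 2).trans h3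
  rw [inv_pow, inv_mul_eq_div, le_div_iff₀ (by positivity)]
  rcases hV0.eq_or_lt with h0 | h0
  · rw [← h0, zero_mul]
    exact Finset.sum_nonneg fun _ _ => by positivity
  · refine le_of_mul_le_mul_left ?_ h0
    nlinarith

/-- The two forms, `A (D̄ - D) A*` and `A* (D̄ - D) A`, of `A - A*` for the resolvent `A`. -/
lemma inv_sub_conjTranspose_inv {H : Matrix n n ℂ} (hH : H.IsHermitian) {D : n → ℂ}
    (hD : ∀ i, 0 < (D i).im) :
    (Matrix.diagonal D - H)⁻¹ - ((Matrix.diagonal D - H)⁻¹)ᴴ =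
      (Matrix.diagonal D - H)⁻¹ * Matrix.diagonal (fun i => star (D i) - D i) *
        ((Matrix.diagonal D - H)⁻¹)ᴴ ∧
    (Matrix.diagonal D - H)⁻¹ - ((Matrix.diagonal D - H)⁻¹)ᴴ =
      ((Matrix.diagonal D - H)⁻¹)ᴴ * Matrix.diagonal (fun i => star (D i) - D i) *
        (Matrix.diagonal D - H)⁻¹ := by
  have hdet := isUnit_det_diagonal_sub hH hD
  set M := Matrix.diagonal D - H with hM
  have h1 : Matrix.diagonal (fun i => star (D i) - D i) = Mᴴ - M := by
    rw [hM, Matrix.conjTranspose_sub, hH.eq, Matrix.diagonal_conjTranspose,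
      sub_sub_sub_cancel_right, Matrix.diagonal_sub]
    rfl
  have h2 : M⁻¹ * M = 1 := Matrix.nonsing_inv_mul _ hdet
  have h3 : M * M⁻¹ = 1 := Matrix.mul_nonsing_inv _ hdet
  have h4 : Mᴴ * (M⁻¹)ᴴ = 1 := by rw [← Matrix.conjTranspose_mul, h2, Matrix.conjTranspose_one]
  have h5 : (M⁻¹)ᴴ * Mᴴ = 1 := by rw [← Matrix.conjTranspose_mul, h3, Matrix.conjTranspose_one]
  rw [h1]
  constructor
  · rw [Matrix.mul_sub, Matrix.sub_mul, h2, Matrix.mul_assoc, h4, Matrix.mul_one, Matrix.one_mul]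
  · rw [Matrix.mul_sub, Matrix.sub_mul, h5, Matrix.mul_assoc, h3, Matrix.mul_one, Matrix.one_mul]

/-- The Ward identity for a row of the resolvent. -/
lemma neg_im_inv_diag_eq_row {H : Matrix n n ℂ} (hH : H.IsHermitian) {D : n → ℂ}
    (hD : ∀ i, 0 < (D i).im) (i : n) :
    -((Matrix.diagonal D - H)⁻¹ i i).im
      = ∑ j, ‖(Matrix.diagonal D - H)⁻¹ i j‖ ^ 2 * (D j).im := by
  have h := congrFun₂ (inv_sub_conjTranspose_inv hH hD).1 i i
  set A := (Matrix.diagonal D - H)⁻¹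
  have h2 := congrArg Complex.im h
  rw [Matrix.mul_apply, Complex.im_sum] at h2
  have h3 : ∀ j, ((A * Matrix.diagonal fun i => star (D i) - D i) i j * Aᴴ j i).im
      = -2 * (‖A i j‖ ^ 2 * (D j).im) := by
    intro j
    have : (A * Matrix.diagonal fun i => star (D i) - D i) i j * Aᴴ j i
        = ((‖A i j‖ ^ 2 : ℝ) : ℂ) * (star (D j) - D j) := by
      have := Complex.mul_conj' (A i j)
      rw [Matrix.mul_diagonal, Matrix.conjTranspose_apply]
      push_cast
      rw [← this]
      simp
      ring
    rw [this, Complex.im_ofReal_mul]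
    simp
    ring
  simp_rw [h3, ← Finset.mul_sum] at h2
  simp at h2
  linarith

/-- The Ward identity for a column of the resolvent. -/
lemma neg_im_inv_diag_eq_col {H : Matrix n n ℂ} (hH : H.IsHermitian) {D : n → ℂ}
    (hD : ∀ i, 0 < (D i).im) (i : n) :
    -((Matrix.diagonal D - H)⁻¹ i i).im
      = ∑ j, ‖(Matrix.diagonal D - H)⁻¹ j i‖ ^ 2 * (D j).im := by
  have h := congrFun₂ (inv_sub_conjTranspose_inv hH hD).2 i i
  set A := (Matrix.diagonal D - H)⁻¹
  have h2 := congrArg Complex.im h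
  rw [Matrix.mul_apply, Complex.im_sum] at h2
  have h3 : ∀ j, ((Aᴴ * Matrix.diagonal fun i => star (D i) - D i) i j * A j i).im
      = -2 * (‖A j i‖ ^ 2 * (D j).im) := by
    intro j
    have : (Aᴴ * Matrix.diagonal fun i => star (D i) - D i) i j * A j i
        = ((‖A j i‖ ^ 2 : ℝ) : ℂ) * (star (D j) - D j) := by
      have := Complex.mul_conj' (A j i)
      rw [Matrix.mul_diagonal, Matrix.conjTranspose_apply]
      push_cast
      rw [← this]
      simp
      ring
    rw [this, Complex.im_ofReal_mul]
    simp
    ring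
  simp_rw [h3, ← Finset.mul_sum] at h2
  simp at h2
  linarith

lemma im_inv_diag_neg {H : Matrix n n ℂ} (hH : H.IsHermitian) {D : n → ℂ}
    (hD : ∀ i, 0 < (D i).im) (i : n) : ((Matrix.diagonal D - H)⁻¹ i i).im < 0 := by
  rw [← neg_pos, neg_im_inv_diag_eq_row hH hD]
  refine Finset.sum_pos' (fun j _ => mul_nonneg (sq_nonneg _) (hD j).le) ?_
  by_contra! hcon
  have h0 : ∀ j, (Matrix.diagonal D - H)⁻¹ i j = 0 := by
    intro j
    have h := hcon j (Finset.mem_univ j)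
    have h1 : ‖(Matrix.diagonal D - H)⁻¹ i j‖ ^ 2 ≤ 0 := by
      by_contra! h2
      exact absurd h (not_le.2 (mul_pos h2 (hD j)))
    simpa using le_antisymm h1 (sq_nonneg _)
  have h1 := congrFun₂ (Matrix.nonsing_inv_mul _ (isUnit_det_diagonal_sub hH hD)) i i
  rw [Matrix.mul_apply] at h1
  simp [h0] at h1

/-- The map sending a diagonal matrix `E` to the diagonal of the resolvent `(E - H)⁻¹` does not
expand the quantity `|E - E'| / √(Im E Im E')`, a function of the hyperbolic distance of the
half-plane. -/
lemma norm_inv_diag_sub_inv_diag_le {H : Matrix n n ℂ} (hH : H.IsHermitian) {E E' : n → ℂ}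
    (hE : ∀ i, 0 < (E i).im) (hE' : ∀ i, 0 < (E' i).im) {q : ℝ} (hq : 0 ≤ q)
    (h : ∀ j, ‖E j - E' j‖ ≤ q * (√(E j).im * √(E' j).im)) (i : n) :
    ‖(Matrix.diagonal E - H)⁻¹ i i - (Matrix.diagonal E' - H)⁻¹ i i‖
      ≤ q * (√(-((Matrix.diagonal E - H)⁻¹ i i).im) * √(-((Matrix.diagonal E' - H)⁻¹ i i).im)) := by
  have hdet := isUnit_det_diagonal_sub hH hE
  have hdet' := isUnit_det_diagonal_sub hH hE'
  have hA := neg_im_inv_diag_eq_row hH hE i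
  have hA' := neg_im_inv_diag_eq_col hH hE' i
  set A := (Matrix.diagonal E - H)⁻¹ with hAdef
  set A' := (Matrix.diagonal E' - H)⁻¹ with hAdef'
  have hres : A - A' = A * Matrix.diagonal (fun j => E' j - E j) * A' := by
    have h1 : Matrix.diagonal (fun j => E' j - E j)
        = (Matrix.diagonal E' - H) - (Matrix.diagonal E - H) := by
      rw [sub_sub_sub_cancel_right, Matrix.diagonal_sub]
    rw [h1, Matrix.mul_sub, Matrix.sub_mul, Matrix.nonsing_inv_mul _ hdet, Matrix.mul_assoc,
      Matrix.mul_nonsing_inv _ hdet', Matrix.mul_one, Matrix.one_mul]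
  -- Cauchy–Schwarz pairs row `i` of `A` with column `i` of `A'`, and the Ward identities apply
  have hi := congrFun₂ hres i i
  rw [Matrix.sub_apply, Matrix.mul_apply] at hi
  rw [hi, hA, hA']
  calc _ ≤ ∑ j, q * (√(‖A i j‖ ^ 2 * (E j).im) * √(‖A' j i‖ ^ 2 * (E' j).im)) := by
        refine (norm_sum_le _ _).trans (Finset.sum_le_sum fun j _ => ?_)
        rw [Matrix.mul_diagonal, norm_mul, norm_mul, Real.sqrt_mul (sq_nonneg _),
          Real.sqrt_mul (sq_nonneg _), Real.sqrt_sq (norm_nonneg _), Real.sqrt_sq (norm_nonneg _),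
          norm_sub_rev]
        calc ‖A i j‖ * ‖E j - E' j‖ * ‖A' j i‖
            ≤ ‖A i j‖ * (q * (√(E j).im * √(E' j).im)) * ‖A' j i‖ := by gcongr; exact h j
          _ = _ := by ring
    _ = q * ∑ j, √(‖A i j‖ ^ 2 * (E j).im) * √(‖A' j i‖ ^ 2 * (E' j).im) := by
        rw [Finset.mul_sum]
    _ ≤ _ := by
        refine mul_le_mul_of_nonneg_left ?_ hq
        exact Real.sum_sqrt_mul_sqrt_le _ (fun j => mul_nonneg (sq_nonneg _) (hE j).le)
          (fun j => mul_nonneg (sq_nonneg _) (hE' j).le)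

end Resolvent

/-! ### The fixed point equation -/

section Dyson

variable {n : Type*} [Fintype n] [DecidableEq n]

/-- The linear map `g ↦ S g` on vectors of diagonal entries; for `S = Γ / N` it is `mapR Γ`. -/
noncomputable def selfEnergy (S : Matrix n n ℝ) (g : n → ℂ) : n → ℂ :=
  fun i => ∑ j, (S i j : ℂ) * g j

/-- The map `g ↦ diag ((D - S g - Y)⁻¹)` whose fixed points are the values at `D` of the
deterministic equivalent, diagonal matrices being written as vectors. -/
noncomputable def dysonMap (S : Matrix n n ℝ) (Y : Matrix n n ℂ) (D g : n → ℂ) : n → ℂ :=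
  fun i => (Matrix.diagonal (D - selfEnergy S g) - Y)⁻¹ i i

/-- `g` is a fixed point of `dysonMap S Y D` in the open lower half-plane. -/
structure IsDysonSolution (S : Matrix n n ℝ) (Y : Matrix n n ℂ) (D g : n → ℂ) : Prop where
  im_neg : ∀ i, (g i).im < 0
  eq : dysonMap S Y D g = g

variable {S : Matrix n n ℝ} {Y : Matrix n n ℂ}

omit [DecidableEq n] in
lemma im_sub_selfEnergy (D g : n → ℂ) (i : n) :
    ((D - selfEnergy S g) i).im = (D i).im + ∑ j, S i j * -(g j).im := by
  simp [selfEnergy, Complex.im_sum, sub_eq_add_neg]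

omit [DecidableEq n] in
lemma selfEnergy_im_nonneg (hS : ∀ i j, 0 ≤ S i j) {g : n → ℂ} (hg : ∀ i, (g i).im ≤ 0) (i : n) :
    0 ≤ ∑ j, S i j * -(g j).im :=
  Finset.sum_nonneg fun j _ => mul_nonneg (hS i j) (neg_nonneg.2 (hg j))

omit [DecidableEq n] in
lemma le_im_sub_selfEnergy (hS : ∀ i j, 0 ≤ S i j) {D g : n → ℂ} (hg : ∀ i, (g i).im ≤ 0) (i : n) :
    (D i).im ≤ ((D - selfEnergy S g) i).im := by
  rw [im_sub_selfEnergy]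
  linarith [selfEnergy_im_nonneg hS hg i]

lemma dysonMap_im_neg (hS : ∀ i j, 0 ≤ S i j) (hY : Y.IsHermitian) {D g : n → ℂ}
    (hD : ∀ i, 0 < (D i).im) (hg : ∀ i, (g i).im ≤ 0) (i : n) : (dysonMap S Y D g i).im < 0 :=
  im_inv_diag_neg hY (fun j => (hD j).trans_le (le_im_sub_selfEnergy hS hg j)) i

lemma norm_dysonMap_le (hS : ∀ i j, 0 ≤ S i j) (hY : Y.IsHermitian) {D g : n → ℂ} {η : ℝ}
    (hη : 0 < η) (hD : ∀ i, η ≤ (D i).im) (hg : ∀ i, (g i).im ≤ 0) (i : n) :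
    ‖dysonMap S Y D g i‖ ≤ η⁻¹ :=
  (norm_entry_le_l2_opNorm _ i i).trans
    (l2_opNorm_inv_diagonal_sub_le hY hη fun j => (hD j).trans (le_im_sub_selfEnergy hS hg j))

omit [DecidableEq n] in
lemma norm_selfEnergy_sub_le (hS : ∀ i j, 0 ≤ S i j) {g g' : n → ℂ} (hg : ∀ i, (g i).im ≤ 0)
    (hg' : ∀ i, (g' i).im ≤ 0) {d : ℝ} (hd : 0 ≤ d)
    (h : ∀ j, ‖g j - g' j‖ ≤ d * (√(-(g j).im) * √(-(g' j).im))) (i : n) :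
    ‖selfEnergy S g i - selfEnergy S g' i‖
      ≤ d * (√(∑ j, S i j * -(g j).im) * √(∑ j, S i j * -(g' j).im)) := by
  have h1 : selfEnergy S g i - selfEnergy S g' i = ∑ j, (S i j : ℂ) * (g j - g' j) := by
    simp only [selfEnergy, ← Finset.sum_sub_distrib, mul_sub]
  rw [h1]
  calc _ ≤ ∑ j, d * (√(S i j * -(g j).im) * √(S i j * -(g' j).im)) := by
        refine (norm_sum_le _ _).trans (Finset.sum_le_sum fun j _ => ?_)
        rw [norm_mul, Complex.norm_real, Real.norm_of_nonneg (hS i j), Real.sqrt_mul (hS i j),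
          Real.sqrt_mul (hS i j)]
        calc S i j * ‖g j - g' j‖ ≤ S i j * (d * (√(-(g j).im) * √(-(g' j).im))) :=
              mul_le_mul_of_nonneg_left (h j) (hS i j)
          _ = (√(S i j) * √(S i j)) * (d * (√(-(g j).im) * √(-(g' j).im))) := by
              rw [Real.mul_self_sqrt (hS i j)]
          _ = _ := by ring
    _ = d * ∑ j, √(S i j * -(g j).im) * √(S i j * -(g' j).im) := by rw [Finset.mul_sum]
    _ ≤ _ := mul_le_mul_of_nonneg_left (Real.sum_sqrt_mul_sqrt_le _
          (fun j => mul_nonneg (hS i j) (neg_nonneg.2 (hg j)))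
          (fun j => mul_nonneg (hS i j) (neg_nonneg.2 (hg' j)))) hd

/-- Two-term Cauchy–Schwarz inequality with unequal weights: since `a` and `b` make up at least the
fraction `r` of `a + x` and `b + y`, the smaller weight `c` counts with that fraction. -/
lemma weighted_sqrt_mul_add_le {a b x y c d r : ℝ} (ha : 0 ≤ a) (hb : 0 ≤ b) (hx : 0 ≤ x)
    (hy : 0 ≤ y) (hc : 0 ≤ c) (hcd : c ≤ d) (hr : 0 ≤ r) (hrx : r * (a + x) ≤ a)
    (hry : r * (b + y) ≤ b) :
    c * (√a * √b) + d * (√x * √y) ≤ (d - (d - c) * r) * (√(a + x) * √(b + y)) := by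
  have h1 : √a * √b + √x * √y ≤ √(a + x) * √(b + y) := by
    have := Real.sum_sqrt_mul_sqrt_le (f := ![a, x]) (g := ![b, y]) Finset.univ
      (fun i => by fin_cases i <;> simp [ha, hx]) (fun i => by fin_cases i <;> simp [hb, hy])
    simpa [Fin.sum_univ_two] using this
  have h2 : r * (√(a + x) * √(b + y)) ≤ √a * √b := by
    have h3 := Real.sqrt_le_sqrt hrx
    have h4 := Real.sqrt_le_sqrt hry
    rw [Real.sqrt_mul hr] at h3 h4
    calc r * (√(a + x) * √(b + y)) = (√r * √r) * (√(a + x) * √(b + y)) := by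
          rw [Real.mul_self_sqrt hr]
      _ = (√r * √(a + x)) * (√r * √(b + y)) := by ring
      _ ≤ _ := mul_le_mul h3 h4 (by positivity) (by positivity)
  have hd := hc.trans hcd
  nlinarith [mul_le_mul_of_nonneg_left h1 hd, mul_le_mul_of_nonneg_left h2 (sub_nonneg.2 hcd)]

/-- One step of `dysonMap`, measured by `|g - g'| / √(Im g Im g')`: if the spectral parameters are
at relative distance `c` and the arguments at relative distance `d ≥ c`, the images are at distance
at most a convex combination of `c` and `d` with a positive weight on `c`. For `c = 0` this is a
contraction. -/
lemma norm_dysonMap_sub_dysonMap_le (hS : ∀ i j, 0 ≤ S i j) (hY : Y.IsHermitian)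
    {D D' g g' : n → ℂ} {η s c d : ℝ} (hη : 0 < η) (hs : 0 ≤ s)
    (hD : ∀ i, η ≤ (D i).im) (hD' : ∀ i, η ≤ (D' i).im)
    (hg : ∀ i, (g i).im ≤ 0) (hg' : ∀ i, (g' i).im ≤ 0)
    (hgs : ∀ i, ∑ j, S i j * -(g j).im ≤ s) (hgs' : ∀ i, ∑ j, S i j * -(g' j).im ≤ s)
    (hc : 0 ≤ c) (hcd : c ≤ d)
    (hDD : ∀ i, ‖D i - D' i‖ ≤ c * (√(D i).im * √(D' i).im))
    (hgg : ∀ i, ‖g i - g' i‖ ≤ d * (√(-(g i).im) * √(-(g' i).im))) (i : n) :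
    ‖dysonMap S Y D g i - dysonMap S Y D' g' i‖
      ≤ (d - (d - c) * (η / (η + s))) *
        (√(-(dysonMap S Y D g i).im) * √(-(dysonMap S Y D' g' i).im)) := by
  have hd := hc.trans hcd
  have hηs : 0 < η + s := by linarith
  have hr1 : η / (η + s) ≤ 1 := by rw [div_le_one hηs]; linarith
  have hr0 : 0 ≤ η / (η + s) := by positivity
  have hrx : ∀ a x : ℝ, η ≤ a → x ≤ s → η / (η + s) * (a + x) ≤ a := by
    intro a x ha hx
    rw [div_mul_eq_mul_div, div_le_iff₀ hηs]
    nlinarith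
  refine norm_inv_diag_sub_inv_diag_le hY
    (fun j => hη.trans_le ((hD j).trans (le_im_sub_selfEnergy hS hg j)))
    (fun j => hη.trans_le ((hD' j).trans (le_im_sub_selfEnergy hS hg' j)))
    (by nlinarith) (fun j => ?_) i
  rw [im_sub_selfEnergy, im_sub_selfEnergy]
  refine le_trans ?_ (weighted_sqrt_mul_add_le (hη.le.trans (hD j)) (hη.le.trans (hD' j))
    (selfEnergy_im_nonneg hS hg j) (selfEnergy_im_nonneg hS hg' j) hc hcd hr0
    (hrx _ _ (hD j) (hgs j)) (hrx _ _ (hD' j) (hgs' j)))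
  have h1 : (D - selfEnergy S g) j - (D' - selfEnergy S g') j
      = (D j - D' j) - (selfEnergy S g j - selfEnergy S g' j) := by
    simp only [Pi.sub_apply]; ring
  rw [h1]
  exact (norm_sub_le _ _).trans
    (add_le_add (hDD j) (norm_selfEnergy_sub_le hS hg hg' hd hgg j))

/-- The fixed points depend on the spectral parameter in a non-expansive way: the largest value `d`
of `|g - g'| / √(Im g Im g')` satisfies `d ≤ d - (d - c) r` with `r > 0`, hence `d ≤ c`. -/
theorem IsDysonSolution.norm_sub_le (hS : ∀ i j, 0 ≤ S i j) (hY : Y.IsHermitian)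
    {D D' g g' : n → ℂ} (h : IsDysonSolution S Y D g) (h' : IsDysonSolution S Y D' g')
    {η c : ℝ} (hη : 0 < η) (hD : ∀ i, η ≤ (D i).im) (hD' : ∀ i, η ≤ (D' i).im) (hc : 0 ≤ c)
    (hDD : ∀ i, ‖D i - D' i‖ ≤ c * (√(D i).im * √(D' i).im)) (i : n) :
    ‖g i - g' i‖ ≤ c * (√(-(g i).im) * √(-(g' i).im)) := by
  have : Nonempty n := ⟨i⟩
  have hw : ∀ j, 0 < √(-(g j).im) * √(-(g' j).im) := fun j =>
    mul_pos (Real.sqrt_pos.2 (neg_pos.2 (h.im_neg j))) (Real.sqrt_pos.2 (neg_pos.2 (h'.im_neg j)))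
  obtain ⟨k, hk⟩ := Finite.exists_max fun j => ‖g j - g' j‖ / (√(-(g j).im) * √(-(g' j).im))
  set d := ‖g k - g' k‖ / (√(-(g k).im) * √(-(g' k).im)) with hd
  have hgg : ∀ j, ‖g j - g' j‖ ≤ d * (√(-(g j).im) * √(-(g' j).im)) := fun j =>
    (div_le_iff₀ (hw j)).1 (hk j)
  rcases le_or_gt d c with hdc | hdc
  · exact (hgg i).trans (mul_le_mul_of_nonneg_right hdc (hw i).le)
  exfalso
  have hg := fun j => (h.im_neg j).le
  have hg' := fun j => (h'.im_neg j).le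
  -- any common bound on the two self-energies makes the contraction strict
  set s := ∑ i, (∑ j, S i j * -(g j).im + ∑ j, S i j * -(g' j).im) with hs
  have hnn := selfEnergy_im_nonneg hS hg
  have hnn' := selfEnergy_im_nonneg hS hg'
  have hle : ∀ i, ∑ j, S i j * -(g j).im + ∑ j, S i j * -(g' j).im ≤ s := fun i =>
    Finset.single_le_sum (f := fun i => ∑ j, S i j * -(g j).im + ∑ j, S i j * -(g' j).im)
      (fun j _ => add_nonneg (hnn j) (hnn' j)) (Finset.mem_univ i)
  have hs0 : 0 ≤ s := Finset.sum_nonneg fun j _ => add_nonneg (hnn j) (hnn' j)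
  have key := norm_dysonMap_sub_dysonMap_le hS hY hη hs0 hD hD' hg hg'
    (fun i => by linarith [hle i, hnn' i]) (fun i => by linarith [hle i, hnn i]) hc hdc.le hDD hgg k
  rw [h.eq, h'.eq, ← div_le_iff₀ (hw k)] at key
  have : 0 < (d - c) * (η / (η + s)) := mul_pos (sub_pos.2 hdc) (by positivity)
  linarith

lemma IsDysonSolution.unique (hS : ∀ i j, 0 ≤ S i j) (hY : Y.IsHermitian) {D g g' : n → ℂ}
    (hD : ∀ i, 0 < (D i).im) (h : IsDysonSolution S Y D g) (h' : IsDysonSolution S Y D g') :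
    g = g' := by
  funext i
  have : Nonempty n := ⟨i⟩
  obtain ⟨k, hk⟩ := Finite.exists_min fun j => (D j).im
  have := h.norm_sub_le hS hY h' (hD k) hk hk le_rfl (by simp) i
  rw [zero_mul] at this
  exact sub_eq_zero.1 (norm_le_zero_iff.1 this)

lemma IsDysonSolution.neg_im_le (hS : ∀ i j, 0 ≤ S i j) (hY : Y.IsHermitian) {D g : n → ℂ}
    (h : IsDysonSolution S Y D g) {η : ℝ} (hη : 0 < η) (hD : ∀ i, η ≤ (D i).im) (i : n) :
    -(g i).im ≤ η⁻¹ := by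
  have h1 := norm_dysonMap_le hS hY hη hD (fun j => (h.im_neg j).le) i
  rw [h.eq] at h1
  exact (neg_le_abs _).trans ((Complex.abs_im_le_norm _).trans h1)

/-- The fixed point is Lipschitz in the spectral parameter, as a Stieltjes transform is. -/
lemma IsDysonSolution.norm_sub_le_div (hS : ∀ i j, 0 ≤ S i j) (hY : Y.IsHermitian)
    {D D' g g' : n → ℂ} (h : IsDysonSolution S Y D g) (h' : IsDysonSolution S Y D' g')
    {η η' e : ℝ} (hη : 0 < η) (hη' : 0 < η') (hD : ∀ i, η ≤ (D i).im) (hD' : ∀ i, η' ≤ (D' i).im)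
    (he : 0 ≤ e) (hDD : ∀ i, ‖D i - D' i‖ ≤ e) (i : n) :
    ‖g i - g' i‖ ≤ e / (η * η') := by
  have hpos : 0 < √η * √η' := mul_pos (Real.sqrt_pos.2 hη) (Real.sqrt_pos.2 hη')
  have h1 := h.norm_sub_le hS hY h' (lt_min hη hη') (fun i => (min_le_left _ _).trans (hD i))
    (fun i => (min_le_right _ _).trans (hD' i)) (c := e / (√η * √η')) (by positivity)
    (fun j => by
      refine (hDD j).trans ?_
      rw [div_mul_eq_mul_div, le_div_iff₀ hpos]
      exact mul_le_mul_of_nonneg_left (mul_le_mul (Real.sqrt_le_sqrt (hD j))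
        (Real.sqrt_le_sqrt (hD' j)) (Real.sqrt_nonneg _) (Real.sqrt_nonneg _)) he) i
  refine h1.trans ?_
  have h2 := Real.sqrt_le_sqrt (h.neg_im_le hS hY hη hD i)
  have h3 := Real.sqrt_le_sqrt (h'.neg_im_le hS hY hη' hD' i)
  rw [Real.sqrt_inv] at h2 h3
  calc _ ≤ e / (√η * √η') * ((√η)⁻¹ * (√η')⁻¹) := by gcongr
    _ = e / ((√η * √η) * (√η' * √η')) := by field_simp
    _ = _ := by rw [Real.mul_self_sqrt hη.le, Real.mul_self_sqrt hη'.le]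

end Dyson

/-! ### Existence and analyticity of the fixed point -/

section MatrixCalculus

variable {n : Type*} [Fintype n] [DecidableEq n]

lemma ContDiffAt.matrix_nonsing_inv {𝕜 X : Type*} [NontriviallyNormedField 𝕜]
    [NormedAlgebra 𝕜 (Matrix n n ℂ)] [NormedAddCommGroup X] [NormedSpace 𝕜 X]
    {M : X → Matrix n n ℂ} {x : X} {k : WithTop ℕ∞} (hM : ContDiffAt 𝕜 k M x)
    (hx : IsUnit (M x)) : ContDiffAt 𝕜 k (fun y => (M y)⁻¹) x := by
  simp_rw [Matrix.nonsing_inv_eq_ringInverse]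
  obtain ⟨u, hu⟩ := hx
  have h := contDiffAt_ringInverse 𝕜 u (n := k)
  rw [hu] at h
  exact h.comp x hM

/-- `Matrix.diagonal` as a continuous linear map into matrices with the operator norm. -/
noncomputable def diagonalCLM : (n → ℂ) →L[ℂ] Matrix n n ℂ :=
  LinearMap.toContinuousLinearMap (Matrix.diagonalLinearMap n ℂ ℂ)

lemma diagonalCLM_apply (D : n → ℂ) : diagonalCLM D = Matrix.diagonal D := rfl

/-- The linear form `M ↦ M a b` on complex matrices with the operator norm. -/
noncomputable def entryCLM (a b : n) : Matrix n n ℂ →L[ℂ] ℂ :=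
  LinearMap.mkContinuous (Matrix.entryLinearMap ℂ ℂ a b) 1 fun M => by
    simpa using norm_entry_le_l2_opNorm M a b

@[simp] lemma entryCLM_apply (a b : n) (M : Matrix n n ℂ) : entryCLM a b M = M a b := rfl

end MatrixCalculus

section DysonExistence

variable {n : Type*} [Fintype n] [DecidableEq n] {S : Matrix n n ℝ} {Y : Matrix n n ℂ}

omit [DecidableEq n] in
lemma continuous_selfEnergy : Continuous (selfEnergy S) := by
  unfold selfEnergy; fun_prop

lemma continuousAt_dysonMap (hS : ∀ i j, 0 ≤ S i j) (hY : Y.IsHermitian) {D g : n → ℂ}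
    (hD : ∀ i, 0 < (D i).im) (hg : ∀ i, (g i).im ≤ 0) : ContinuousAt (dysonMap S Y D) g := by
  refine continuousAt_pi.2 fun i => ?_
  have h1 : ContDiffAt ℂ 0 (fun g : n → ℂ => Matrix.diagonal (D - selfEnergy S g) - Y) g := by
    refine ContDiff.contDiffAt ?_
    simp_rw [← diagonalCLM_apply]
    exact (contDiff_zero.2 (diagonalCLM.continuous.comp
      (continuous_const.sub continuous_selfEnergy))).sub contDiff_const
  have h2 := h1.matrix_nonsing_inv (isUnit_diagonal_sub hY fun j =>
    (hD j).trans_le (le_im_sub_selfEnergy hS hg j))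
  exact (entryCLM i i).continuous.continuousAt.comp h2.continuousAt

lemma differentiableAt_dysonMap (hS : ∀ i j, 0 ≤ S i j) (hY : Y.IsHermitian) {D g : ℂ → n → ℂ}
    {w : ℂ} (hD : ∀ i, 0 < (D w i).im) (hg : ∀ i, (g w i).im ≤ 0)
    (hDd : ∀ i, DifferentiableAt ℂ (fun w => D w i) w)
    (hgd : ∀ i, DifferentiableAt ℂ (fun w => g w i) w) (i : n) :
    DifferentiableAt ℂ (fun w => dysonMap S Y (D w) (g w) i) w := by
  have h1 : DifferentiableAt ℂ
      (fun w => Matrix.diagonal (D w - selfEnergy S (g w)) - Y) w := by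
    simp_rw [← diagonalCLM_apply]
    refine (diagonalCLM.differentiableAt.comp w ?_).sub (differentiableAt_const _)
    refine differentiableAt_pi.2 fun j => ?_
    simp only [Pi.sub_apply, selfEnergy]
    exact (hDd j).sub (DifferentiableAt.fun_sum fun l _ => (hgd l).const_mul _)
  have hu : IsUnit (Matrix.diagonal (D w - selfEnergy S (g w)) - Y) :=
    isUnit_diagonal_sub hY fun j => (hD j).trans_le (le_im_sub_selfEnergy hS hg j)
  simp only [dysonMap, Matrix.nonsing_inv_eq_ringInverse]
  obtain ⟨u, hu⟩ := hu
  have h2 := differentiableAt_inverse (𝕜 := ℂ) u.isUnit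
  rw [hu] at h2
  have h3 : DifferentiableAt ℂ
      (fun w => Ring.inverse (Matrix.diagonal (D w - selfEnergy S (g w)) - Y)) w :=
    DifferentiableAt.comp (g := Ring.inverse) w h2 h1
  exact (entryCLM i i).differentiableAt.comp w h3

/-- Geometric convergence of the iterates of `dysonMap` from a starting point `g₀` that is moved by
a relative distance at most `c`. -/
lemma exists_isDysonSolution_of_iterate (hS : ∀ i j, 0 ≤ S i j) (hY : Y.IsHermitian)
    {D g₀ : n → ℂ} {η m σ c : ℝ} (hη : 0 < η) (hD : ∀ i, η ≤ (D i).im)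
    (hσ0 : 0 ≤ σ) (hσ : ∀ i, ∑ j, S i j ≤ σ) (hm : η⁻¹ ≤ m) (hc : 0 ≤ c)
    (hg₀ : ∀ i, (g₀ i).im < 0) (hg₀m : ∀ i, -(g₀ i).im ≤ m)
    (h₀ : ∀ i, ‖dysonMap S Y D g₀ i - g₀ i‖
      ≤ c * (√(-(dysonMap S Y D g₀ i).im) * √(-(g₀ i).im))) :
    (∀ k i, ((dysonMap S Y D)^[k] g₀ i).im < 0) ∧
    ∃ g, IsDysonSolution S Y D g ∧ ∀ k i, ‖(dysonMap S Y D)^[k] g₀ i - g i‖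
      ≤ c * m * (1 - η / (η + σ * m)) ^ k / (η / (η + σ * m)) := by
  have hm0 : 0 ≤ m := (inv_pos.2 hη).le.trans hm
  have hs0 : 0 ≤ σ * m := mul_nonneg hσ0 hm0
  set r := η / (η + σ * m) with hr
  have hr0 : 0 < r := by positivity
  have hr1 : r ≤ 1 := by rw [hr, div_le_one (by positivity)]; linarith
  have hD0 : ∀ i, 0 < (D i).im := fun i => hη.trans_le (hD i)
  set G : ℕ → n → ℂ := fun k => (dysonMap S Y D)^[k] g₀ with hG
  have hGs : ∀ k, G (k + 1) = dysonMap S Y D (G k) := fun k => by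
    simp only [hG, Function.iterate_succ_apply']
  have him : ∀ k i, (G k i).im < 0 := by
    intro k
    induction k with
    | zero => exact hg₀
    | succ k ih =>
      rw [hGs]
      exact dysonMap_im_neg hS hY hD0 fun i => (ih i).le
  have hGm : ∀ k i, -(G k i).im ≤ m := by
    intro k i
    cases k with
    | zero => exact hg₀m i
    | succ k =>
      rw [hGs]
      exact ((neg_le_abs _).trans (Complex.abs_im_le_norm _)).trans
        ((norm_dysonMap_le hS hY hη hD (fun i => (him k i).le) i).trans hm)
  have hSG : ∀ k i, ∑ j, S i j * -(G k j).im ≤ σ * m := by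
    intro k i
    calc _ ≤ ∑ j, S i j * m := Finset.sum_le_sum fun j _ =>
          mul_le_mul_of_nonneg_left (hGm k j) (hS i j)
      _ = (∑ j, S i j) * m := by rw [Finset.sum_mul]
      _ ≤ _ := mul_le_mul_of_nonneg_right (hσ i) hm0
  have hstep : ∀ k i, ‖G (k + 1) i - G k i‖
      ≤ c * (1 - r) ^ k * (√(-(G (k + 1) i).im) * √(-(G k i).im)) := by
    intro k
    induction k with
    | zero =>
      intro i
      rw [hGs]
      simpa [hG] using h₀ i
    | succ k ih =>
      intro i
      have h1 : 0 ≤ c * (1 - r) ^ k := mul_nonneg hc (pow_nonneg (by linarith) _)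
      have h2 := norm_dysonMap_sub_dysonMap_le (D := D) (D' := D) hS hY hη hs0 hD hD
        (fun j => (him (k + 1) j).le) (fun j => (him k j).le) (hSG (k + 1)) (hSG k) le_rfl h1
        (fun j => by simp) ih i
      rw [hGs (k + 1), hGs k] at *
      refine h2.trans_eq ?_
      rw [← hr]
      ring
  have hdist : ∀ k, dist (G k) (G (k + 1)) ≤ c * m * (1 - r) ^ k := by
    intro k
    have h1 : 0 ≤ (1 - r) ^ k := pow_nonneg (by linarith) _
    rw [dist_pi_le_iff (by positivity)]
    intro i
    rw [dist_comm, dist_eq_norm]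
    refine (hstep k i).trans ?_
    have h2 := Real.sqrt_le_sqrt (hGm (k + 1) i)
    have h3 := Real.sqrt_le_sqrt (hGm k i)
    calc _ ≤ c * (1 - r) ^ k * (√m * √m) := by gcongr
      _ = _ := by rw [Real.mul_self_sqrt hm0]; ring
  obtain ⟨g, hg⟩ := cauchySeq_tendsto_of_complete
    (cauchySeq_of_le_geometric (1 - r) (c * m) (by linarith) hdist)
  have hgim : ∀ i, (g i).im ≤ 0 := fun i =>
    le_of_tendsto
      ((Complex.continuous_im.tendsto _).comp ((continuous_apply i).tendsto g |>.comp hg))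
      (Filter.Eventually.of_forall fun k => (him k i).le)
  have hfix : dysonMap S Y D g = g := by
    have h1 : Filter.Tendsto (fun k => G (k + 1)) Filter.atTop (nhds (dysonMap S Y D g)) := by
      simp_rw [hGs]
      exact (continuousAt_dysonMap hS hY hD0 hgim).tendsto.comp hg
    exact tendsto_nhds_unique h1 ((Filter.tendsto_add_atTop_iff_nat 1).2 hg)
  refine ⟨him, g, ⟨fun i => ?_, hfix⟩, fun k i => ?_⟩
  · rw [← hfix]
    exact dysonMap_im_neg hS hY hD0 hgim i
  · have h1 := dist_le_of_le_geometric_of_tendsto (1 - r) (c * m) (by linarith) hdist hg k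
    rw [sub_sub_cancel] at h1
    rw [← dist_eq_norm]
    exact (dist_le_pi_dist (G k) g i).trans h1

omit [DecidableEq n] in
lemma exists_pos_forall_le {f : n → ℝ} (hf : ∀ i, 0 < f i) : ∃ η, 0 < η ∧ ∀ i, η ≤ f i := by
  rcases isEmpty_or_nonempty n with h | h
  · exact ⟨1, one_pos, fun i => isEmptyElim i⟩
  · obtain ⟨k, hk⟩ := Finite.exists_min f
    exact ⟨f k, hf k, hk⟩

omit [DecidableEq n] in
lemma exists_row_sum_bound (hS : ∀ i j, 0 ≤ S i j) : ∃ σ, 0 ≤ σ ∧ ∀ i, ∑ j, S i j ≤ σ :=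
  ⟨∑ i, ∑ j, S i j, Finset.sum_nonneg fun i _ => Finset.sum_nonneg fun j _ => hS i j,
    fun i => Finset.single_le_sum (f := fun i => ∑ j, S i j)
      (fun i _ => Finset.sum_nonneg fun j _ => hS i j) (Finset.mem_univ i)⟩

lemma exists_isDysonSolution (hS : ∀ i j, 0 ≤ S i j) (hY : Y.IsHermitian) {D : n → ℂ}
    (hD : ∀ i, 0 < (D i).im) : ∃ g, IsDysonSolution S Y D g := by
  obtain ⟨η, hη, hηD⟩ := exists_pos_forall_le hD
  obtain ⟨σ, hσ0, hσ⟩ := exists_row_sum_bound hS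
  set g₀ : n → ℂ := fun _ => -Complex.I with hg₀
  have him : ∀ i, (dysonMap S Y D g₀ i).im < 0 :=
    dysonMap_im_neg hS hY hD fun i => by simp [hg₀]
  -- relative distances of the starting point `-i` to its image, all of which are finite
  set d : n → ℝ := fun i => ‖dysonMap S Y D g₀ i - g₀ i‖ / √(-(dysonMap S Y D g₀ i).im) with hd
  have hd0 : ∀ i, 0 ≤ d i := fun i => by positivity
  obtain ⟨-, g, hg, -⟩ := exists_isDysonSolution_of_iterate (g₀ := g₀) (m := max 1 η⁻¹)
    (c := ∑ i, d i) hS hY hη hηD hσ0 hσ (le_max_right _ _) (Finset.sum_nonneg fun i _ => hd0 i)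
    (fun i => by simp [hg₀]) (fun i => by simp [hg₀]) (fun i => by
      have h1 := Finset.single_le_sum (f := d) (fun i _ => hd0 i) (Finset.mem_univ i)
      rw [div_le_iff₀ (Real.sqrt_pos.2 (neg_pos.2 (him i)))] at h1
      have h2 : √(-(g₀ i).im) = 1 := by simp [hg₀]
      rwa [h2, mul_one])
  exact ⟨g, hg⟩

/-- The fixed point depends analytically on the spectral parameter: near `w₀` it is the uniform
limit of the iterates of `dysonMap` that start from the fixed point at `w₀`. -/
theorem analyticAt_of_isDysonSolution (hS : ∀ i j, 0 ≤ S i j) (hY : Y.IsHermitian)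
    {D g : ℂ → n → ℂ} {w₀ : ℂ} (hD : ∀ i, Differentiable ℂ fun w => D w i)
    (hD₀ : ∀ i, 0 < (D w₀ i).im)
    (hg : ∀ w, (∀ i, 0 < (D w i).im) → IsDysonSolution S Y (D w) (g w)) (i : n) :
    AnalyticAt ℂ (fun w => g w i) w₀ := by
  obtain ⟨θ, hθ, hθD⟩ := exists_pos_forall_le hD₀
  obtain ⟨σ, hσ0, hσ⟩ := exists_row_sum_bound hS
  set η := θ / 2 with hη
  have hη0 : 0 < η := by positivity
  -- on this neighbourhood of `w₀` the rate of convergence of the iterates does not depend on `w`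
  set V : Set ℂ := {w | ∀ i, η < (D w i).im ∧ ‖D w i - D w₀ i‖ < 1} with hV
  have hDc : ∀ i, Continuous fun w => D w i := fun i => (hD i).continuous
  have hVo : IsOpen V := by
    have : V = ⋂ i, {w | η < (D w i).im ∧ ‖D w i - D w₀ i‖ < 1} := by
      ext w; simp [hV]
    rw [this]
    refine isOpen_iInter_of_finite fun i => IsOpen.and ?_ ?_
    · exact isOpen_lt continuous_const (Complex.continuous_im.comp (hDc i))
    · exact isOpen_lt ((hDc i).sub continuous_const).norm continuous_const
  have hwV : w₀ ∈ V := fun i => ⟨by linarith [hθD i], by simp⟩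
  have hVpos : ∀ w ∈ V, ∀ i, 0 < (D w i).im := fun w hw i => hη0.trans (hw i).1
  have h₀ := hg w₀ hD₀
  set g₀ := g w₀
  have hg₀ : ∀ i, (g₀ i).im ≤ 0 := fun i => (h₀.im_neg i).le
  have hg₀m : ∀ i, -(g₀ i).im ≤ η⁻¹ :=
    h₀.neg_im_le hS hY hη0 fun i => by linarith [hθD i]
  set r := η / (η + σ * η⁻¹)
  have hr0 : 0 < r := by positivity
  have hr1 : r ≤ 1 := by
    rw [div_le_one (by positivity)]
    have : 0 ≤ σ * η⁻¹ := by positivity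
    linarith
  have hSg : ∀ i, ∑ j, S i j * -(g₀ j).im ≤ σ * η⁻¹ := by
    intro i
    calc _ ≤ ∑ j, S i j * η⁻¹ := Finset.sum_le_sum fun j _ =>
          mul_le_mul_of_nonneg_left (hg₀m j) (hS i j)
      _ = (∑ j, S i j) * η⁻¹ := by rw [Finset.sum_mul]
      _ ≤ _ := mul_le_mul_of_nonneg_right (hσ i) (by positivity)
  have hiter : ∀ w ∈ V, (∀ k i, ((dysonMap S Y (D w))^[k] g₀ i).im < 0) ∧
      ∀ k i, ‖(dysonMap S Y (D w))^[k] g₀ i - g w i‖ ≤ η⁻¹ * η⁻¹ * (1 - r) ^ k / r := by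
    intro w hw
    obtain ⟨h1, g', hg', h2⟩ := exists_isDysonSolution_of_iterate (D := D w) (g₀ := g₀)
      (c := η⁻¹) hS hY hη0 (fun i => (hw i).1.le) hσ0 hσ le_rfl (by positivity) h₀.im_neg hg₀m
      (fun i => by
        have h3 := norm_dysonMap_sub_dysonMap_le (D := D w) (D' := D w₀) (g := g₀) (g' := g₀)
          (c := η⁻¹) (d := η⁻¹) hS hY hη0 (by positivity) (fun i => (hw i).1.le)
          (fun i => (hwV i).1.le) hg₀ hg₀ hSg hSg (by positivity) le_rfl (fun j => ?_)
          (fun j => by simp; positivity) i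
        · rw [h₀.eq, sub_self, zero_mul, sub_zero] at h3
          exact h3
        · have h4 := Real.sqrt_le_sqrt (hw j).1.le
          have h5 := Real.sqrt_le_sqrt (hwV j).1.le
          calc ‖D w j - D w₀ j‖ ≤ 1 := (hw j).2.le
            _ = η⁻¹ * (√η * √η) := by
                rw [Real.mul_self_sqrt hη0.le, inv_mul_cancel₀ hη0.ne']
            _ ≤ _ := by gcongr)
    rw [hg'.unique hS hY (hVpos w hw) (hg w (hVpos w hw))] at h2
    exact ⟨h1, h2⟩
  have hdiff : ∀ k, ∀ w ∈ V, ∀ i,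
      DifferentiableAt ℂ (fun w => (dysonMap S Y (D w))^[k] g₀ i) w := by
    intro k
    induction k with
    | zero => intro w _ i; simp
    | succ k ih =>
      intro w hw i
      simp_rw [Function.iterate_succ_apply']
      exact differentiableAt_dysonMap (g := fun w => (dysonMap S Y (D w))^[k] g₀) hS hY
        (hVpos w hw) (fun i => ((hiter w hw).1 k i).le) (fun i => hD i w) (fun i => ih w hw i) i
  have hunif : TendstoUniformlyOn (fun k w => (dysonMap S Y (D w))^[k] g₀ i) (fun w => g w i)
      Filter.atTop V := by
    have hlim : Filter.Tendsto (fun k : ℕ => η⁻¹ * η⁻¹ * (1 - r) ^ k / r) Filter.atTop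
        (nhds 0) := by
      have := ((tendsto_pow_atTop_nhds_zero_of_lt_one (by linarith : (0 : ℝ) ≤ 1 - r)
        (by linarith)).const_mul (η⁻¹ * η⁻¹)).div_const r
      simpa using this
    rw [Metric.tendstoUniformlyOn_iff]
    intro ε hε
    filter_upwards [hlim.eventually_lt_const hε] with k hk w hw
    rw [dist_comm, dist_eq_norm]
    exact ((hiter w hw).2 k i).trans_lt hk
  have hd : DifferentiableOn ℂ (fun w => g w i) V :=
    hunif.tendstoLocallyUniformlyOn.differentiableOn
      (Filter.Eventually.of_forall fun k w hw => (hdiff k w hw i).differentiableWithinAt) hVo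
  exact hd.analyticAt (hVo.mem_nhds hwV)

end DysonExistence

/-! ### The deterministic equivalent -/

section DetEquiv

variable {N : ℕ} {Γ : Matrix (Fin N) (Fin N) ℝ} {Y : Matrix (Fin N) (Fin N) ℂ}

/-- The normalized variance profile `Γ / N`. -/
noncomputable def normalizedProfile (Γ : Matrix (Fin N) (Fin N) ℝ) : Matrix (Fin N) (Fin N) ℝ :=
  Matrix.of fun i j => Γ i j / N

lemma normalizedProfile_nonneg (hΓ : ∀ i j, 0 ≤ Γ i j) (i j : Fin N) :
    0 ≤ normalizedProfile Γ i j :=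
  div_nonneg (hΓ i j) (Nat.cast_nonneg N)

lemma mapR_eq (Λ : Matrix (Fin N) (Fin N) ℂ) :
    mapR Γ Λ = Matrix.diagonal (selfEnergy (normalizedProfile Γ) Λ.diag) := rfl

lemma diagonal_sub_mapR (D : Fin N → ℂ) (Λ : Matrix (Fin N) (Fin N) ℂ) :
    Matrix.diagonal D - mapR Γ Λ
      = Matrix.diagonal (D - selfEnergy (normalizedProfile Γ) Λ.diag) := by
  rw [mapR_eq, Matrix.diagonal_sub]
  rfl

lemma diagonal_mem_DPlus {D : Fin N → ℂ} (hD : ∀ i, 0 < (D i).im) :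
    Matrix.diagonal D ∈ DPlus N :=
  ⟨Matrix.isDiag_diagonal D, by simpa using hD⟩

lemma IsDetEquiv.isDysonSolution {G : Matrix (Fin N) (Fin N) ℂ → Matrix (Fin N) (Fin N) ℂ}
    (hG : IsDetEquiv Γ Y G) {D : Fin N → ℂ} (hD : ∀ i, 0 < (D i).im) :
    IsDysonSolution (normalizedProfile Γ) Y D (G (Matrix.diagonal D)).diag where
  im_neg := (hG.mapsTo (diagonal_mem_DPlus hD)).2
  eq := by
    have h := hG.fixedPoint _ (diagonal_mem_DPlus hD)
    rw [diagonal_sub_mapR] at h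
    conv_rhs => rw [h, diagPart, Matrix.diag_diagonal]
    rfl

lemma exists_isDetEquiv (hΓ : ∀ i j, 0 ≤ Γ i j) (hY : Y.IsHermitian) :
    ∃ G, IsDetEquiv Γ Y G := by
  have hS := normalizedProfile_nonneg hΓ
  set g : (Fin N → ℂ) → Fin N → ℂ := fun D =>
    Classical.epsilon (IsDysonSolution (normalizedProfile Γ) Y D)
  have hg : ∀ D : Fin N → ℂ, (∀ i, 0 < (D i).im) →
      IsDysonSolution (normalizedProfile Γ) Y D (g D) := fun D hD =>
    Classical.epsilon_spec (exists_isDysonSolution hS hY hD)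
  -- analyticity in the `i`-th variable is analyticity along the line `w ↦ Function.update z i w`
  refine ⟨fun Λ => Matrix.diagonal (g Λ.diag), ⟨fun Λ hΛ => ⟨Matrix.isDiag_diagonal _, ?_⟩,
    fun z hz i k l => ?_, fun Λ hΛ => ?_⟩⟩
  · simpa using (hg Λ.diag hΛ.2).im_neg
  · by_cases hkl : k = l
    · subst hkl
      simp only [Matrix.diagonal_apply_eq, Matrix.diag_diagonal]
      refine analyticAt_of_isDysonSolution (D := fun w => Function.update z i w) hS hY
        (fun j => ?_) (fun j => ?_) (fun w hw => hg _ hw) k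
      · by_cases hj : j = i
        · subst hj; simp
        · simp [Function.update_of_ne hj]
      · simpa using hz j
    · simp only [Matrix.diagonal_apply_ne _ hkl]
      exact analyticAt_const
  · have h1 : Λ = Matrix.diagonal Λ.diag := hΛ.1.diagonal_diag.symm
    have h2 := (hg Λ.diag hΛ.2).eq
    have h3 : Λ - mapR Γ (Matrix.diagonal (g Λ.diag))
        = Matrix.diagonal (Λ.diag - selfEnergy (normalizedProfile Γ) (g Λ.diag)) := by
      conv_lhs => rw [h1]
      rw [diagonal_sub_mapR, Matrix.diag_diagonal, Matrix.diag_diagonal]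
    rw [h3]
    conv_lhs => rw [← h2]
    rfl

lemma isDetEquiv_detEquiv (hΓ : ∀ i j, 0 ≤ Γ i j) (hY : Y.IsHermitian) :
    IsDetEquiv Γ Y (detEquiv Γ Y) :=
  Classical.epsilon_spec (exists_isDetEquiv hΓ hY)

lemma IsDetEquiv.eqOn (hΓ : ∀ i j, 0 ≤ Γ i j) (hY : Y.IsHermitian)
    {G G' : Matrix (Fin N) (Fin N) ℂ → Matrix (Fin N) (Fin N) ℂ}
    (hG : IsDetEquiv Γ Y G) (hG' : IsDetEquiv Γ Y G') : Set.EqOn G G' (DPlus N) := by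
  intro Λ hΛ
  have h1 : Matrix.diagonal Λ.diag = Λ := hΛ.1.diagonal_diag
  have h := (hG.isDysonSolution hΛ.2).unique (normalizedProfile_nonneg hΓ) hY hΛ.2
    (hG'.isDysonSolution hΛ.2)
  rw [show (fun i => Λ i i) = Λ.diag from rfl, h1] at h
  rw [← (hG.mapsTo hΛ).1.diagonal_diag, ← (hG'.mapsTo hΛ).1.diagonal_diag, h]

end DetEquiv

/-! ### Gaussian Hermitian matrices -/

section GaussianMatrix

variable {n : Type*} [Fintype n] [DecidableEq n]

/-- The entry `x_{ab} = (1 + i)/2 g_{ab} + (1 - i)/2 g_{ba}` of a GUE matrix, in terms of a standard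
Gaussian vector `g` of `ℝ^(n × n)`. This choice of coordinates needs no ordering of the indices. -/
noncomputable def gueEntry (g : EuclideanSpace ℝ (n × n)) (a b : n) : ℂ :=
  (1 + Complex.I) / 2 * g (a, b) + (1 - Complex.I) / 2 * g (b, a)

/-- The Hermitian matrix `(c a b * x_{ab})` with Gaussian entries, as a linear function of the
underlying standard Gaussian vector. -/
noncomputable def gaussMat (c : Matrix n n ℝ) : EuclideanSpace ℝ (n × n) →L[ℝ] Matrix n n ℂ :=
  LinearMap.toContinuousLinearMap
    { toFun := fun g => Matrix.of fun a b => (c a b : ℂ) * gueEntry g a b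
      map_add' := fun g h => by
        ext a b
        simp only [gueEntry, Matrix.of_apply, Matrix.add_apply, PiLp.add_apply]
        push_cast
        ring
      map_smul' := fun r g => by
        ext a b
        simp only [gueEntry, Matrix.of_apply, Matrix.smul_apply, PiLp.smul_apply, smul_eq_mul,
          RingHom.id_apply, Complex.real_smul]
        push_cast
        ring }

omit [DecidableEq n] in
lemma gaussMat_apply (c : Matrix n n ℝ) (g : EuclideanSpace ℝ (n × n)) (a b : n) :
    gaussMat c g a b = (c a b : ℂ) * gueEntry g a b := rfl

/-- The derivative of `gaussMat c` in the coordinate `p`. -/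
noncomputable def dirMat (c : Matrix n n ℝ) (p : n × n) : Matrix n n ℂ :=
  gaussMat c (EuclideanSpace.single p 1)

variable {c : Matrix n n ℝ}

omit [DecidableEq n] in
lemma gaussMat_isHermitian (hc : c.IsSymm) (g : EuclideanSpace ℝ (n × n)) :
    (gaussMat c g).IsHermitian := by
  ext a b
  rw [Matrix.conjTranspose_apply, gaussMat_apply, gaussMat_apply, hc.apply a b]
  simp [gueEntry, Complex.conj_ofReal]
  left
  ring

lemma gaussMat_eq_sum (g : EuclideanSpace ℝ (n × n)) :
    gaussMat c g = ∑ p, (g p : ℂ) • dirMat c p := by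
  conv_lhs => rw [← (EuclideanSpace.basisFun (n × n) ℝ).sum_repr g]
  rw [map_sum]
  refine Finset.sum_congr rfl fun p _ => ?_
  rw [map_smul]
  simp [dirMat]

lemma dirMat_apply (p : n × n) (a b : n) :
    dirMat c p a b = (c a b : ℂ) * ((1 + Complex.I) / 2 * (if (a, b) = p then 1 else 0)
      + (1 - Complex.I) / 2 * (if (b, a) = p then 1 else 0)) := by
  simp only [dirMat, gaussMat_apply, gueEntry, PiLp.single_apply]
  split_ifs <;> simp

/-- The covariance `E x_{ab} x_{de} = δ_{ae} δ_{bd}` of the GUE entries. -/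
lemma sum_dirMat_mul_dirMat (a b d e : n) :
    ∑ p, dirMat c p a b * dirMat c p d e
      = if a = e ∧ b = d then (c a b : ℂ) * c d e else 0 := by
  have hexp : ∀ p, dirMat c p a b * dirMat c p d e = (c a b : ℂ) * c d e *
      (((1 + Complex.I) / 2) ^ 2 * ((if (a, b) = p then 1 else 0) * (if (d, e) = p then 1 else 0))
      + ((1 + Complex.I) / 2 * ((1 - Complex.I) / 2)) *
        ((if (a, b) = p then 1 else 0) * (if (e, d) = p then 1 else 0))
      + ((1 + Complex.I) / 2 * ((1 - Complex.I) / 2)) *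
        ((if (b, a) = p then 1 else 0) * (if (d, e) = p then 1 else 0))
      + ((1 - Complex.I) / 2) ^ 2 *
        ((if (b, a) = p then 1 else 0) * (if (e, d) = p then 1 else 0))) := by
    intro p
    rw [dirMat_apply, dirMat_apply]
    ring
  simp_rw [hexp, ← Finset.mul_sum, Finset.sum_add_distrib, ← Finset.mul_sum, ite_mul, one_mul,
    zero_mul, Finset.sum_ite_eq, Finset.mem_univ, if_true, Prod.mk.injEq]
  have h1 : ((1 + Complex.I) / 2) ^ 2 = Complex.I / 2 := by
    ring_nf; rw [Complex.I_sq]; ring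
  have h2 : ((1 - Complex.I) / 2) ^ 2 = -(Complex.I / 2) := by
    ring_nf; rw [Complex.I_sq]; ring
  have h3 : (1 + Complex.I) / 2 * ((1 - Complex.I) / 2) = 1 / 2 := by
    ring_nf; rw [Complex.I_sq]; ring
  rw [h1, h2, h3]
  simp only [@eq_comm _ d, @eq_comm _ e]
  by_cases h : a = e <;> by_cases h' : b = d <;> by_cases h'' : a = d <;> by_cases h''' : b = e <;>
    grind

/-- `E[X Q X] = diag_a (∑_b c_{ab}² Q_{bb})` for the Gaussian matrix `X`. -/
lemma sum_dirMat_mul_mul_dirMat (hc : c.IsSymm) (Q : Matrix n n ℂ) :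
    ∑ p, dirMat c p * Q * dirMat c p
      = Matrix.diagonal (selfEnergy (Matrix.of fun a b => c a b ^ 2) Q.diag) := by
  ext a e
  rw [Matrix.sum_apply]
  have h1 : ∀ p, (dirMat c p * Q * dirMat c p) a e
      = ∑ d, ∑ b, Q b d * (dirMat c p a b * dirMat c p d e) := by
    intro p
    rw [Matrix.mul_apply]
    refine Finset.sum_congr rfl fun d _ => ?_
    rw [Matrix.mul_apply, Finset.sum_mul]
    exact Finset.sum_congr rfl fun b _ => by ring
  simp_rw [h1]
  rw [Finset.sum_comm]
  simp_rw [Finset.sum_comm (s := (Finset.univ : Finset (n × n))), ← Finset.mul_sum,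
    sum_dirMat_mul_dirMat]
  by_cases hae : a = e
  · subst hae
    simp only [true_and, mul_ite, mul_zero, Finset.sum_ite_eq', Finset.mem_univ, if_true,
      Matrix.diagonal_apply_eq, selfEnergy, Matrix.of_apply, Matrix.diag]
    refine Finset.sum_congr rfl fun b _ => ?_
    rw [hc.apply a b]
    push_cast
    ring
  · simp [hae]

lemma trace_dirMat_mul (hc : c.IsSymm) (Q : Matrix n n ℂ) (k l : n) :
    (dirMat c (k, l) * Q).trace
      = c k l * ((1 + Complex.I) / 2 * Q l k + (1 - Complex.I) / 2 * Q k l) := by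
  have h1 : (dirMat c (k, l) * Q).trace = ∑ a, ∑ b,
      ((if a = k then (if b = l then (c a b : ℂ) * ((1 + Complex.I) / 2) * Q b a else 0) else 0) +
      (if a = l then (if b = k then (c a b : ℂ) * ((1 - Complex.I) / 2) * Q b a else 0)
        else 0)) := by
    rw [Matrix.trace]
    refine Finset.sum_congr rfl fun a _ => ?_
    rw [Matrix.diag_apply, Matrix.mul_apply]
    refine Finset.sum_congr rfl fun b _ => ?_
    rw [dirMat_apply]
    simp only [Prod.mk.injEq, ite_and]
    split_ifs <;> ring
  rw [h1]
  simp only [Finset.sum_add_distrib, Finset.sum_ite_irrel, Finset.sum_const_zero,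
    Finset.sum_ite_eq', Finset.mem_univ, if_true]
  rw [hc.apply k l]
  ring

/-- The pair of coefficients `(1 ± i) / 2` of `gueEntry` is a unitary transformation. -/
lemma norm_sq_add_norm_sq_rotate (x y : ℂ) :
    ‖(1 + Complex.I) / 2 * x + (1 - Complex.I) / 2 * y‖ ^ 2
      + ‖(1 + Complex.I) / 2 * y + (1 - Complex.I) / 2 * x‖ ^ 2 = ‖x‖ ^ 2 + ‖y‖ ^ 2 := by
  simp only [← Complex.normSq_eq_norm_sq, Complex.normSq_apply]
  simp
  ring

/-- The gradient of `g ↦ tr (X Q)`, for `X = gaussMat c g`, is controlled by the Hilbert–Schmidt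
norm of `Q`. -/
lemma sum_norm_trace_dirMat_mul_sq_le (hc : c.IsSymm) {κ : ℝ} (hκ : ∀ a b, c a b ^ 2 ≤ κ)
    (Q : Matrix n n ℂ) :
    ∑ p, ‖(dirMat c p * Q).trace‖ ^ 2 ≤ κ * ∑ a, ∑ b, ‖Q a b‖ ^ 2 := by
  set f : n → n → ℝ := fun k l =>
    ‖(1 + Complex.I) / 2 * Q l k + (1 - Complex.I) / 2 * Q k l‖ ^ 2 with hf
  have h1 : ∑ k, ∑ l, f k l = ∑ a, ∑ b, ‖Q a b‖ ^ 2 := by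
    have h2 : ∑ k, ∑ l, f k l = ∑ k, ∑ l, f l k := Finset.sum_comm
    have h3 : ∑ k, ∑ l, (f k l + f l k) = ∑ k, ∑ l, (‖Q l k‖ ^ 2 + ‖Q k l‖ ^ 2) :=
      Finset.sum_congr rfl fun k _ => Finset.sum_congr rfl fun l _ =>
        norm_sq_add_norm_sq_rotate _ _
    have h4 : ∑ k, ∑ l, ‖Q l k‖ ^ 2 = ∑ k, ∑ l, ‖Q k l‖ ^ 2 := Finset.sum_comm
    simp only [Finset.sum_add_distrib] at h3
    linarith
  rw [← h1, Fintype.sum_prod_type, Finset.mul_sum]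
  refine Finset.sum_le_sum fun k _ => ?_
  rw [Finset.mul_sum]
  refine Finset.sum_le_sum fun l _ => ?_
  rw [trace_dirMat_mul hc, norm_mul, mul_pow, Complex.norm_real, Real.norm_eq_abs, sq_abs]
  exact mul_le_mul_of_nonneg_right (hκ k l) (sq_nonneg _)

lemma sum_norm_mul_sq_le (A B : Matrix n n ℂ) :
    ∑ a, ∑ b, ‖(A * B) a b‖ ^ 2 ≤ ‖A‖ ^ 2 * ∑ a, ∑ b, ‖B a b‖ ^ 2 := by
  rw [Finset.sum_comm, Finset.sum_comm (f := fun a b => ‖B a b‖ ^ 2), Finset.mul_sum]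
  exact Finset.sum_le_sum fun b _ => sum_norm_mulVec_sq_le A (fun j => B j b)

lemma sum_norm_mul_sq_le' (A B : Matrix n n ℂ) :
    ∑ a, ∑ b, ‖(A * B) a b‖ ^ 2 ≤ (∑ a, ∑ b, ‖A a b‖ ^ 2) * ‖B‖ ^ 2 := by
  have h := sum_norm_mul_sq_le Bᴴ Aᴴ
  rw [← Matrix.conjTranspose_mul, Matrix.l2_opNorm_conjTranspose, Finset.sum_comm,
    Finset.sum_comm (f := fun a b => ‖Aᴴ a b‖ ^ 2)] at h
  simpa [mul_comm] using h

end GaussianMatrix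

/-! ### The resolvent of a Gaussian matrix -/

section GaussianResolvent

variable {n : Type*} [Fintype n] [DecidableEq n]

/-- The resolvent `(D - X - Y)⁻¹` of the Gaussian matrix `X = gaussMat c g`. -/
noncomputable def gaussResolvent (c : Matrix n n ℝ) (Y : Matrix n n ℂ) (D : n → ℂ)
    (g : EuclideanSpace ℝ (n × n)) : Matrix n n ℂ :=
  (Matrix.diagonal D - (gaussMat c g + Y))⁻¹

/-- The linear form `M ↦ tr (W M)`. -/
noncomputable def traceCLM (W : Matrix n n ℂ) : Matrix n n ℂ →L[ℂ] ℂ :=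
  LinearMap.toContinuousLinearMap ((Matrix.traceLinearMap n ℂ ℂ).comp (LinearMap.mulLeft ℂ W))

lemma traceCLM_apply (W M : Matrix n n ℂ) : traceCLM W M = (W * M).trace := rfl

variable {c : Matrix n n ℝ} {Y : Matrix n n ℂ} {D : n → ℂ}

lemma gaussResolvent_isUnit (hc : c.IsSymm) (hY : Y.IsHermitian) (hD : ∀ i, 0 < (D i).im)
    (g : EuclideanSpace ℝ (n × n)) : IsUnit (Matrix.diagonal D - (gaussMat c g + Y)) :=
  isUnit_diagonal_sub ((gaussMat_isHermitian hc g).add hY) hD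

lemma norm_gaussResolvent_le (hc : c.IsSymm) (hY : Y.IsHermitian) {η : ℝ} (hη : 0 < η)
    (hD : ∀ i, η ≤ (D i).im) (g : EuclideanSpace ℝ (n × n)) : ‖gaussResolvent c Y D g‖ ≤ η⁻¹ :=
  l2_opNorm_inv_diagonal_sub_le ((gaussMat_isHermitian hc g).add hY) hη hD

lemma hasFDerivAt_gaussResolvent (hc : c.IsSymm) (hY : Y.IsHermitian) (hD : ∀ i, 0 < (D i).im)
    (g : EuclideanSpace ℝ (n × n)) :
    HasFDerivAt (gaussResolvent c Y D)
      ((ContinuousLinearMap.mulLeftRight ℝ (Matrix n n ℂ) (gaussResolvent c Y D g)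
        (gaussResolvent c Y D g)).comp (gaussMat c)) g := by
  have hM : HasFDerivAt (fun g => Matrix.diagonal D - (gaussMat c g + Y)) (-(gaussMat c)) g :=
    ((gaussMat c).hasFDerivAt.add_const Y).const_sub _
  obtain ⟨u, hu⟩ := gaussResolvent_isUnit hc hY hD g
  have hinv : gaussResolvent c Y D g = ↑u⁻¹ := by
    rw [gaussResolvent, ← hu, Matrix.nonsing_inv_eq_ringInverse, Ring.inverse_unit]
  have h := hasFDerivAt_ringInverse (𝕜 := ℝ) u
  rw [hu] at h
  have h2 := HasFDerivAt.comp (g := Ring.inverse) g h hM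
  have h3 : gaussResolvent c Y D
      = Ring.inverse ∘ fun g => Matrix.diagonal D - (gaussMat c g + Y) := by
    funext g
    simp [gaussResolvent, Matrix.nonsing_inv_eq_ringInverse]
  rw [hinv, h3]
  refine h2.congr_fderiv ?_
  ext w : 1
  simp

lemma contDiff_gaussResolvent (hc : c.IsSymm) (hY : Y.IsHermitian) (hD : ∀ i, 0 < (D i).im) :
    ContDiff ℝ 1 (gaussResolvent c Y D) := by
  refine contDiff_iff_contDiffAt.2 fun g => ?_
  refine ContDiffAt.matrix_nonsing_inv ?_ (gaussResolvent_isUnit hc hY hD g)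
  exact (contDiff_const.sub ((gaussMat c).contDiff.add contDiff_const)).contDiffAt

lemma fderiv_clm_gaussResolvent (hc : c.IsSymm) (hY : Y.IsHermitian) (hD : ∀ i, 0 < (D i).im)
    (ℓ : Matrix n n ℂ →L[ℂ] ℂ) (g w : EuclideanSpace ℝ (n × n)) :
    fderiv ℝ (fun g => ℓ (gaussResolvent c Y D g)) g w
      = ℓ (gaussResolvent c Y D g * gaussMat c w * gaussResolvent c Y D g) := by
  have h := ((ℓ.restrictScalars ℝ).hasFDerivAt).comp g (hasFDerivAt_gaussResolvent hc hY hD g)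
  rw [show (fun g => ℓ (gaussResolvent c Y D g))
    = (ℓ.restrictScalars ℝ) ∘ gaussResolvent c Y D from rfl, h.fderiv]
  simp

lemma partialDeriv_clm_gaussResolvent (hc : c.IsSymm) (hY : Y.IsHermitian)
    (hD : ∀ i, 0 < (D i).im) (ℓ : Matrix n n ℂ →L[ℂ] ℂ) (p : n × n)
    (g : EuclideanSpace ℝ (n × n)) :
    partialDeriv p (fun g => ℓ (gaussResolvent c Y D g)) g
      = ℓ (gaussResolvent c Y D g * dirMat c p * gaussResolvent c Y D g) :=
  fderiv_clm_gaussResolvent hc hY hD ℓ g _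

lemma boundedC1_clm_gaussResolvent (hc : c.IsSymm) (hY : Y.IsHermitian)
    (hD : ∀ i, 0 < (D i).im) (ℓ : Matrix n n ℂ →L[ℂ] ℂ) :
    BoundedC1 fun g => ℓ (gaussResolvent c Y D g) := by
  obtain ⟨η, hη, hηD⟩ := exists_pos_forall_le hD
  have hR := norm_gaussResolvent_le hc hY hη hηD
  refine ⟨(ℓ.restrictScalars ℝ).contDiff.comp (contDiff_gaussResolvent hc hY hD),
    max (‖ℓ‖ * η⁻¹) (‖ℓ‖ * (η⁻¹ * ‖gaussMat c‖ * η⁻¹)), fun g => ⟨?_, ?_⟩⟩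
  · exact le_max_of_le_left ((ℓ.le_opNorm _).trans
      (mul_le_mul_of_nonneg_left (hR g) (norm_nonneg _)))
  · refine le_max_of_le_right (ContinuousLinearMap.opNorm_le_bound _ (by positivity) fun w => ?_)
    rw [fderiv_clm_gaussResolvent hc hY hD, mul_assoc ‖ℓ‖]
    refine (ℓ.le_opNorm _).trans (mul_le_mul_of_nonneg_left ?_ (norm_nonneg _))
    calc _ ≤ ‖gaussResolvent c Y D g‖ * ‖gaussMat c w‖ * ‖gaussResolvent c Y D g‖ :=
          norm_mul₃_le
      _ ≤ η⁻¹ * (‖gaussMat c‖ * ‖w‖) * η⁻¹ := by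
          gcongr
          · exact hR g
          · exact (gaussMat c).le_opNorm w
          · exact hR g
      _ = _ := by ring

/-- The gradient of `tr (W R)` for the resolvent `R` is controlled by the Hilbert–Schmidt norm
of `R W R`. -/
lemma gradNormSq_trace_gaussResolvent_le (hc : c.IsSymm) (hY : Y.IsHermitian) {η κ : ℝ}
    (hη : 0 < η) (hD : ∀ i, η ≤ (D i).im) (hκ0 : 0 ≤ κ) (hκ : ∀ a b, c a b ^ 2 ≤ κ)
    (W : Matrix n n ℂ) (g : EuclideanSpace ℝ (n × n)) :
    gradNormSq (fun g => traceCLM W (gaussResolvent c Y D g)) g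
      ≤ κ * (η⁻¹ ^ 4 * ∑ a, ∑ b, ‖W a b‖ ^ 2) := by
  have hR := norm_gaussResolvent_le hc hY hη hD g
  set R := gaussResolvent c Y D g with hRdef
  have h1 : gradNormSq (fun g => traceCLM W (gaussResolvent c Y D g)) g
      = ∑ p, ‖(dirMat c p * (R * W * R)).trace‖ ^ 2 := by
    refine Finset.sum_congr rfl fun p _ => ?_
    rw [partialDeriv_clm_gaussResolvent hc hY (fun i => hη.trans_le (hD i)), traceCLM_apply,
      ← hRdef]
    congr 2
    rw [mul_assoc R, ← mul_assoc W, Matrix.trace_mul_comm]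
    simp only [mul_assoc]
  rw [h1]
  refine (sum_norm_trace_dirMat_mul_sq_le hc hκ _).trans (mul_le_mul_of_nonneg_left ?_ hκ0)
  have hW : 0 ≤ ∑ a, ∑ b, ‖W a b‖ ^ 2 :=
    Finset.sum_nonneg fun _ _ => Finset.sum_nonneg fun _ _ => by positivity
  calc _ ≤ (∑ a, ∑ b, ‖(R * W) a b‖ ^ 2) * ‖R‖ ^ 2 := sum_norm_mul_sq_le' _ _
    _ ≤ (‖R‖ ^ 2 * ∑ a, ∑ b, ‖W a b‖ ^ 2) * ‖R‖ ^ 2 := by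
        gcongr
        exact sum_norm_mul_sq_le _ _
    _ ≤ (η⁻¹ ^ 2 * ∑ a, ∑ b, ‖W a b‖ ^ 2) * η⁻¹ ^ 2 := by gcongr
    _ = _ := by ring

end GaussianResolvent

/-! ### The equation for the mean resolvent -/

section MasterEquation

variable {n : Type*} [Fintype n] [DecidableEq n]

/-- The expected resolvent `E (D - X - Y)⁻¹`. -/
noncomputable def meanResolvent (c : Matrix n n ℝ) (Y : Matrix n n ℂ) (D : n → ℂ) : Matrix n n ℂ :=
  Matrix.of fun a b => ∫ g, gaussResolvent c Y D g a b ∂(stdGaussian (EuclideanSpace ℝ (n × n)))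

/-- The entrywise square of a real matrix: the variance profile of `gaussMat c`. -/
def entrySq (c : Matrix n n ℝ) : Matrix n n ℝ := Matrix.of fun a b => c a b ^ 2

variable {c : Matrix n n ℝ} {Y : Matrix n n ℂ} {D : n → ℂ}

lemma boundedC1_gaussResolvent_apply (hc : c.IsSymm) (hY : Y.IsHermitian)
    (hD : ∀ i, 0 < (D i).im) (a b : n) : BoundedC1 fun g => gaussResolvent c Y D g a b :=
  boundedC1_clm_gaussResolvent hc hY hD (entryCLM a b)

lemma selfEnergy_diag_eq_trace (S : Matrix n n ℝ) (Q : Matrix n n ℂ) (i : n) :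
    selfEnergy S Q.diag i = traceCLM (Matrix.diagonal fun j => (S i j : ℂ)) Q := by
  simp [traceCLM_apply, selfEnergy, Matrix.trace, Matrix.diagonal_mul]

lemma boundedC1_selfEnergy_gaussResolvent (hc : c.IsSymm) (hY : Y.IsHermitian)
    (hD : ∀ i, 0 < (D i).im) (S : Matrix n n ℝ) (i : n) :
    BoundedC1 fun g => selfEnergy S (gaussResolvent c Y D g).diag i := by
  simp_rw [selfEnergy_diag_eq_trace]
  exact boundedC1_clm_gaussResolvent hc hY hD _

lemma integral_selfEnergy_gaussResolvent (hc : c.IsSymm) (hY : Y.IsHermitian)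
    (hD : ∀ i, 0 < (D i).im) (S : Matrix n n ℝ) (i : n) :
    ∫ g, selfEnergy S (gaussResolvent c Y D g).diag i
        ∂(stdGaussian (EuclideanSpace ℝ (n × n)))
      = selfEnergy S (meanResolvent c Y D).diag i := by
  simp only [selfEnergy, Matrix.diag_apply]
  rw [integral_finsetSum _ fun j _ =>
    ((boundedC1_gaussResolvent_apply hc hY hD j j).integrable _).const_mul _]
  simp_rw [integral_const_mul]
  rfl

/-- `E[X R] = E[S(R) R]` by Gaussian integration by parts, where `S` is the self-energy given by the
variances of the entries of `X`. -/
lemma integral_gaussMat_mul_gaussResolvent (hc : c.IsSymm) (hY : Y.IsHermitian)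
    (hD : ∀ i, 0 < (D i).im) (i k : n) :
    Integrable (fun g => (gaussMat c g * gaussResolvent c Y D g) i k)
      (stdGaussian (EuclideanSpace ℝ (n × n))) ∧
    ∫ g, (gaussMat c g * gaussResolvent c Y D g) i k ∂(stdGaussian (EuclideanSpace ℝ (n × n)))
      = ∫ g, selfEnergy (entrySq c) (gaussResolvent c Y D g).diag i * gaussResolvent c Y D g i k
          ∂(stdGaussian (EuclideanSpace ℝ (n × n))) := by
  set ℓ : n × n → Matrix n n ℂ →L[ℂ] ℂ := fun p =>
    (entryCLM i k).comp (ContinuousLinearMap.mul ℂ (Matrix n n ℂ) (dirMat c p)) with hℓ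
  have hℓa : ∀ p M, ℓ p M = (dirMat c p * M) i k := fun p M => rfl
  have hb := fun p => boundedC1_clm_gaussResolvent hc hY hD (ℓ p)
  have h1 : ∀ g, (gaussMat c g * gaussResolvent c Y D g) i k
      = ∑ p, (g p : ℂ) * ℓ p (gaussResolvent c Y D g) := by
    intro g
    rw [gaussMat_eq_sum, Finset.sum_mul, Matrix.sum_apply]
    simp [hℓa]
  have hint : ∀ p, Integrable (fun g : EuclideanSpace ℝ (n × n) =>
      (g p : ℂ) * ℓ p (gaussResolvent c Y D g)) (stdGaussian (EuclideanSpace ℝ (n × n))) :=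
    fun p => (hb p).integrable_coord_mul p
  have hint' : ∀ p, Integrable (fun g =>
      partialDeriv p (fun g => ℓ p (gaussResolvent c Y D g)) g)
      (stdGaussian (EuclideanSpace ℝ (n × n))) := by
    intro p
    obtain ⟨C, hC⟩ := (hb p).bound
    exact (integrable_const C).mono' ((hb p).continuous_partialDeriv p).aestronglyMeasurable
      (Filter.Eventually.of_forall fun g => (norm_partialDeriv_le _ g p).trans (hC g).2)
  simp_rw [h1]
  refine ⟨integrable_finsetSum _ fun p _ => hint p, ?_⟩
  rw [integral_finsetSum _ fun p _ => hint p]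
  simp_rw [fun p => (hb p).integral_coord_mul p]
  rw [← integral_finsetSum _ fun p _ => hint' p]
  refine integral_congr_ae (Filter.Eventually.of_forall fun g => ?_)
  simp only [fun p => partialDeriv_clm_gaussResolvent hc hY hD (ℓ p) p g]
  simp only [hℓa]
  rw [← Matrix.sum_apply]
  simp_rw [← Matrix.mul_assoc]
  rw [← Finset.sum_mul, sum_dirMat_mul_mul_dirMat hc, Matrix.diagonal_mul]
  rfl

/-- The mean resolvent solves the matrix Dyson equation up to the covariance of the resolvent with
its own self-energy. -/
lemma dyson_mul_meanResolvent_apply (hc : c.IsSymm) (hY : Y.IsHermitian)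
    (hD : ∀ i, 0 < (D i).im) (i k : n) :
    ((Matrix.diagonal (D - selfEnergy (entrySq c) (meanResolvent c Y D).diag) - Y) *
      meanResolvent c Y D) i k = (1 : Matrix n n ℂ) i k +
      ∫ g, (selfEnergy (entrySq c) (gaussResolvent c Y D g).diag i
        - selfEnergy (entrySq c) (meanResolvent c Y D).diag i) * gaussResolvent c Y D g i k
        ∂(stdGaussian (EuclideanSpace ℝ (n × n))) := by
  set μ := stdGaussian (EuclideanSpace ℝ (n × n))
  set s := selfEnergy (entrySq c) (meanResolvent c Y D).diag
  have hR := fun a b => (boundedC1_gaussResolvent_apply hc hY hD a b).integrable μ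
  have hres : ∀ g, ((Matrix.diagonal D - Y) * gaussResolvent c Y D g) i k
      = (1 : Matrix n n ℂ) i k + (gaussMat c g * gaussResolvent c Y D g) i k := by
    intro g
    have h := Matrix.mul_nonsing_inv _
      ((Matrix.isUnit_iff_isUnit_det _).1 (gaussResolvent_isUnit hc hY hD g))
    change (Matrix.diagonal D - (gaussMat c g + Y)) * gaussResolvent c Y D g = 1 at h
    rw [← Matrix.add_apply, ← h]
    have h2 : (Matrix.diagonal D - Y) * gaussResolvent c Y D g
        = (Matrix.diagonal D - (gaussMat c g + Y)) * gaussResolvent c Y D g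
          + gaussMat c g * gaussResolvent c Y D g := by
      simp only [sub_mul, add_mul]
      abel
    rw [h2]
  have hlin : ∀ M : Matrix n n ℂ, (M * meanResolvent c Y D) i k
      = ∫ g, (M * gaussResolvent c Y D g) i k ∂μ := by
    intro M
    simp only [Matrix.mul_apply]
    rw [integral_finsetSum _ fun j _ => (hR j k).const_mul _]
    simp_rw [integral_const_mul]
    rfl
  obtain ⟨hXint, hX⟩ := integral_gaussMat_mul_gaussResolvent hc hY hD i k
  have h1 : Matrix.diagonal (D - s) - Y = (Matrix.diagonal D - Y) - Matrix.diagonal s := by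
    rw [sub_right_comm, Matrix.diagonal_sub]
    rfl
  rw [h1, Matrix.sub_mul, Matrix.sub_apply, hlin, Matrix.diagonal_mul]
  simp_rw [hres]
  rw [integral_add (integrable_const _) hXint, hX]
  have hs := boundedC1_selfEnergy_gaussResolvent hc hY hD (entrySq c) i
  simp_rw [sub_mul]
  rw [integral_sub ((hs.mul (boundedC1_gaussResolvent_apply hc hY hD i k)).integrable μ)
    ((hR i k).const_mul _), integral_const_mul]
  simp only [integral_const, probReal_univ, one_smul]
  have : meanResolvent c Y D i k = ∫ g, gaussResolvent c Y D g i k ∂μ := rfl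
  rw [this]
  ring

lemma meanResolvent_diag_im_nonpos (hc : c.IsSymm) (hY : Y.IsHermitian)
    (hD : ∀ i, 0 < (D i).im) (i : n) : ((meanResolvent c Y D).diag i).im ≤ 0 := by
  have hint := (boundedC1_gaussResolvent_apply hc hY hD i i).integrable
    (stdGaussian (EuclideanSpace ℝ (n × n)))
  change (∫ g, gaussResolvent c Y D g i i ∂(stdGaussian (EuclideanSpace ℝ (n × n)))).im ≤ 0
  rw [← RCLike.im_eq_complex_im, ← integral_im hint]
  exact integral_nonpos fun g =>
    (im_inv_diag_neg ((gaussMat_isHermitian hc g).add hY) hD i).le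

/-- The mean resolvent is close to the resolvent at its own self-energy: the error term is bounded
by the Cauchy–Schwarz inequality and the Poincaré inequality for the self-energy. -/
theorem norm_meanResolvent_sub_le (hc : c.IsSymm) (hY : Y.IsHermitian) {η κ T τ : ℝ}
    (hη : 0 < η) (hD : ∀ i, η ≤ (D i).im) (hκ0 : 0 ≤ κ) (hκ : ∀ a b, c a b ^ 2 ≤ κ)
    (hT : ∀ i, ∑ j, (c i j ^ 2) ^ 2 ≤ T) (hτ0 : 0 ≤ τ) (hτ : κ * (η⁻¹ ^ 4 * T) ≤ τ ^ 2) :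
    ‖meanResolvent c Y D -
      (Matrix.diagonal (D - selfEnergy (entrySq c) (meanResolvent c Y D).diag) - Y)⁻¹‖
      ≤ η⁻¹ * (τ * η⁻¹) := by
  have hD0 : ∀ i, 0 < (D i).im := fun i => hη.trans_le (hD i)
  set μ := stdGaussian (EuclideanSpace ℝ (n × n))
  set R := gaussResolvent c Y D with hR
  set s := selfEnergy (entrySq c) (meanResolvent c Y D).diag with hs
  set M := Matrix.diagonal (D - s) - Y with hM
  have hDs : ∀ i, (D i).im ≤ ((D - s) i).im := fun i =>
    le_im_sub_selfEnergy (fun a b => sq_nonneg (c a b)) (meanResolvent_diag_im_nonpos hc hY hD0) i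
  have hdet : IsUnit M.det := isUnit_det_diagonal_sub hY fun i => (hD0 i).trans_le (hDs i)
  have hMinv : ‖M⁻¹‖ ≤ η⁻¹ := l2_opNorm_inv_diagonal_sub_le hY hη fun i => (hD i).trans (hDs i)
  set σ : n → EuclideanSpace ℝ (n × n) → ℂ := fun i g =>
    selfEnergy (entrySq c) (R g).diag i - s i with hσ
  have hσb : ∀ i, BoundedC1 (σ i) := fun i =>
    (boundedC1_selfEnergy_gaussResolvent hc hY hD0 (entrySq c) i).sub_const _
  have hσvar : ∀ i, ∫ g, ‖σ i g‖ ^ 2 ∂μ ≤ τ ^ 2 := by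
    intro i
    have h1 := integral_norm_sub_integral_sq_le
      (boundedC1_selfEnergy_gaussResolvent hc hY hD0 (entrySq c) i) hτ0 (fun g => by
        simp_rw [selfEnergy_diag_eq_trace]
        refine (gradNormSq_trace_gaussResolvent_le hc hY hη hD hκ0 hκ _ g).trans
          (le_trans ?_ hτ)
        gcongr
        refine le_trans (le_of_eq ?_) (hT i)
        refine Finset.sum_congr rfl fun a _ => ?_
        rw [Finset.sum_eq_single a (fun b _ hb => by simp [Matrix.diagonal_apply_ne' _ hb])
          (by simp)]
        simp [entrySq])
    rw [integral_selfEnergy_gaussResolvent hc hY hD0] at h1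
    exact h1
  set Err : Matrix n n ℂ := Matrix.of fun i k => ∫ g, σ i g * R g i k ∂μ with hErr
  have hmaster : M * meanResolvent c Y D = 1 + Err := by
    ext i k
    rw [Matrix.add_apply]
    exact dyson_mul_meanResolvent_apply hc hY hD0 i k
  have hErrnorm : ‖Err‖ ≤ τ * η⁻¹ := by
    refine l2_opNorm_le_of_sum_mulVec (by positivity) fun v => ?_
    have hRv : ∀ i, BoundedC1 fun g => (R g *ᵥ v) i := by
      intro i
      have h1 : (fun g => (R g *ᵥ v) i)
          = fun g => (∑ k, v k • entryCLM i k) (gaussResolvent c Y D g) := by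
        funext g
        simp [Matrix.mulVec, dotProduct, hR, mul_comm]
      rw [h1]
      exact boundedC1_clm_gaussResolvent hc hY hD0 _
    have hEv : ∀ i, (Err *ᵥ v) i = ∫ g, σ i g * (R g *ᵥ v) i ∂μ := by
      intro i
      simp only [Matrix.mulVec, dotProduct, hErr, Matrix.of_apply, Finset.mul_sum, ← mul_assoc]
      rw [integral_finsetSum _ fun k _ => (((hσb i).mul
        (boundedC1_gaussResolvent_apply hc hY hD0 i k)).integrable μ).mul_const _]
      simp_rw [integral_mul_const]
      rfl
    have hsq : ∀ i, Integrable (fun g => ‖(R g *ᵥ v) i‖ ^ 2) μ := fun i =>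
      integrable_norm_pow (hRv i) 2
    calc ∑ i, ‖(Err *ᵥ v) i‖ ^ 2
        ≤ ∑ i, τ ^ 2 * ∫ g, ‖(R g *ᵥ v) i‖ ^ 2 ∂μ := by
          refine Finset.sum_le_sum fun i _ => ?_
          rw [hEv]
          exact ((hσb i).norm_integral_mul_sq_le (hRv i)).trans (mul_le_mul_of_nonneg_right
            (hσvar i) (integral_nonneg fun g => by positivity))
      _ = τ ^ 2 * ∫ g, ∑ i, ‖(R g *ᵥ v) i‖ ^ 2 ∂μ := by
          rw [← Finset.mul_sum, integral_finsetSum _ fun i _ => hsq i]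
      _ ≤ τ ^ 2 * (η⁻¹ ^ 2 * ∑ i, ‖v i‖ ^ 2) := by
          gcongr
          have h2 : ∀ g, ∑ i, ‖(R g *ᵥ v) i‖ ^ 2 ≤ η⁻¹ ^ 2 * ∑ i, ‖v i‖ ^ 2 := by
            intro g
            refine (sum_norm_mulVec_sq_le (R g) v).trans ?_
            gcongr
            exact norm_gaussResolvent_le hc hY hη hD g
          refine (integral_mono (integrable_finsetSum _ fun i _ => hsq i)
            (integrable_const _) h2).trans_eq (by simp)
      _ = _ := by ring
  have hfinal : meanResolvent c Y D - M⁻¹ = M⁻¹ * Err := by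
    have h1 : meanResolvent c Y D = M⁻¹ * (M * meanResolvent c Y D) := by
      rw [← Matrix.mul_assoc, Matrix.nonsing_inv_mul _ hdet, Matrix.one_mul]
    rw [h1, hmaster, Matrix.mul_add, Matrix.mul_one, add_sub_cancel_left]
  rw [hfinal]
  exact (norm_mul_le _ _).trans (mul_le_mul hMinv hErrnorm (norm_nonneg _) (by positivity))

end MasterEquation

/-! ### Stability of the fixed point equation -/

section Stability

variable {n : Type*} [Fintype n] [DecidableEq n] {S : Matrix n n ℝ} {Y : Matrix n n ℂ}

omit [DecidableEq n] in
lemma norm_selfEnergy_sub_le_mul (hS : ∀ i j, 0 ≤ S i j) {σ e : ℝ} (hσ : ∀ i, ∑ j, S i j ≤ σ)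
    (he : 0 ≤ e) {g g' : n → ℂ} (h : ∀ j, ‖g j - g' j‖ ≤ e) (i : n) :
    ‖selfEnergy S g i - selfEnergy S g' i‖ ≤ σ * e := by
  have h1 : selfEnergy S g i - selfEnergy S g' i = ∑ j, (S i j : ℂ) * (g j - g' j) := by
    simp only [selfEnergy, ← Finset.sum_sub_distrib, mul_sub]
  rw [h1]
  calc _ ≤ ∑ j, S i j * e := by
        refine (norm_sum_le _ _).trans (Finset.sum_le_sum fun j _ => ?_)
        rw [norm_mul, Complex.norm_real, Real.norm_of_nonneg (hS i j)]
        exact mul_le_mul_of_nonneg_left (h j) (hS i j)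
    _ = (∑ j, S i j) * e := by rw [Finset.sum_mul]
    _ ≤ _ := mul_le_mul_of_nonneg_right (hσ i) he

/-- Stability of the fixed point problem: an approximate fixed point `h` at the spectral parameter
`D` has diagonal resolvent `g'` which is an exact fixed point at the nearby spectral parameter
`D - S h + S g'`, so that the Lipschitz estimate for fixed points applies. -/
theorem norm_inv_sub_inv_le_of_approx_isDysonSolution (hS : ∀ i j, 0 ≤ S i j)
    (hY : Y.IsHermitian) {D h g : n → ℂ} {η σ ε δ : ℝ} (hη : 0 < η) (hD : ∀ i, η ≤ (D i).im)
    (hσ0 : 0 ≤ σ) (hσ : ∀ i, ∑ j, S i j ≤ σ) (hε : 0 ≤ ε) (hδ : 0 < δ)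
    (hεδ : σ * ε ≤ (1 - δ) * η) (hh : ∀ i, (h i).im ≤ 0)
    (happrox : ∀ i, ‖h i - dysonMap S Y D h i‖ ≤ ε) (hg : IsDysonSolution S Y D g) :
    ‖(Matrix.diagonal (D - selfEnergy S h) - Y)⁻¹
        - (Matrix.diagonal (D - selfEnergy S g) - Y)⁻¹‖
      ≤ η⁻¹ * (σ * (ε + σ * ε / (δ * η * η))) * η⁻¹ := by
  have hD0 : ∀ i, 0 < (D i).im := fun i => hη.trans_le (hD i)
  set g' := dysonMap S Y D h with hg'
  set D' : n → ℂ := D - selfEnergy S h + selfEnergy S g' with hD'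
  have hDD : ∀ i, ‖D' i - D i‖ ≤ σ * ε := by
    intro i
    have h1 : D' i - D i = selfEnergy S g' i - selfEnergy S h i := by
      simp only [hD', Pi.add_apply, Pi.sub_apply]; ring
    rw [h1]
    exact norm_selfEnergy_sub_le_mul hS hσ hε (fun j => by rw [norm_sub_rev]; exact happrox j) i
  have hD'im : ∀ i, δ * η ≤ (D' i).im := by
    intro i
    have h1 := (Complex.abs_im_le_norm _).trans (hDD i)
    rw [Complex.sub_im] at h1
    linarith [(abs_le.1 h1).1, hD i]
  have hsol : IsDysonSolution S Y D' g' := by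
    refine ⟨dysonMap_im_neg hS hY hD0 hh, ?_⟩
    have h1 : D' - selfEnergy S g' = D - selfEnergy S h := by
      rw [hD', add_sub_cancel_right]
    funext i
    rw [dysonMap, h1]
    rfl
  have hgg : ∀ i, ‖h i - g i‖ ≤ ε + σ * ε / (δ * η * η) := by
    intro i
    calc ‖h i - g i‖ = ‖(h i - g' i) + (g' i - g i)‖ := by congr 1; ring
      _ ≤ _ := (norm_add_le _ _).trans (add_le_add (happrox i)
          (hsol.norm_sub_le_div hS hY hg (by positivity) hη hD'im hD (by positivity) hDD i))
  have him : ∀ i, (D i).im ≤ ((D - selfEnergy S h) i).im := le_im_sub_selfEnergy hS hh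
  have him' : ∀ i, (D i).im ≤ ((D - selfEnergy S g) i).im :=
    le_im_sub_selfEnergy hS fun i => (hg.im_neg i).le
  have hdet := isUnit_det_diagonal_sub hY fun i => (hD0 i).trans_le (him i)
  have hdet' := isUnit_det_diagonal_sub hY fun i => (hD0 i).trans_le (him' i)
  have hQ := l2_opNorm_inv_diagonal_sub_le hY hη fun i => (hD i).trans (him i)
  have hQ' := l2_opNorm_inv_diagonal_sub_le hY hη fun i => (hD i).trans (him' i)
  set M := Matrix.diagonal (D - selfEnergy S h) - Y with hM
  set M' := Matrix.diagonal (D - selfEnergy S g) - Y with hM'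
  have hres : M⁻¹ - M'⁻¹
      = M⁻¹ * Matrix.diagonal (fun i => selfEnergy S h i - selfEnergy S g i) * M'⁻¹ := by
    have h1 : Matrix.diagonal (fun i => selfEnergy S h i - selfEnergy S g i) = M' - M := by
      rw [hM, hM', sub_sub_sub_cancel_right, Matrix.diagonal_sub]
      congr 1
      funext i
      simp
    rw [h1, Matrix.mul_sub, Matrix.sub_mul, Matrix.nonsing_inv_mul _ hdet, Matrix.mul_assoc,
      Matrix.mul_nonsing_inv _ hdet', Matrix.mul_one, Matrix.one_mul]
  have hdiag : ‖Matrix.diagonal (fun i => selfEnergy S h i - selfEnergy S g i)‖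
      ≤ σ * (ε + σ * ε / (δ * η * η)) := by
    rw [Matrix.l2_opNorm_diagonal, pi_norm_le_iff_of_nonneg (by positivity)]
    exact norm_selfEnergy_sub_le_mul hS hσ (by positivity) hgg
  rw [hres]
  refine norm_mul₃_le.trans ?_
  gcongr

end Stability

/-! ### The law of the GUE entries -/

section GUELaw

variable {Ω : Type*} [MeasurableSpace Ω] {P : Measure Ω} {N : ℕ} {x : Fin N → Fin N → Ω → ℂ}

/-- The standard Gaussian vector underlying a family of GUE entries; it inverts `gueEntry`. -/
noncomputable def gueCoords (x : Fin N → Fin N → Ω → ℂ) (ω : Ω) :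
    EuclideanSpace ℝ (Fin N × Fin N) :=
  WithLp.toLp 2 fun p => (x p.1 p.2 ω).re + (x p.1 p.2 ω).im

lemma gueEntry_gueCoords (hx : IsGUEEntries P x) (ω : Ω) (a b : Fin N) :
    gueEntry (gueCoords x ω) a b = x a b ω := by
  simp only [gueEntry, gueCoords]
  rw [hx.hermitian a b ω]
  apply Complex.ext <;> simp <;> ring

lemma measurable_gueCoords (hx : IsGUEEntries P x) : Measurable (gueCoords x) := by
  have := hx.measurable
  unfold gueCoords
  fun_prop

lemma sum_prod_eq_sum_lower {M : Type*} [AddCommMonoid M] (f : Fin N × Fin N → M) :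
    ∑ p, f p = ∑ p : {p : Fin N × Fin N // p.2 ≤ p.1},
      if p.1.2 = p.1.1 then f p.1 else f p.1 + f p.1.swap := by
  have h1 : ∀ p : Fin N × Fin N,
      f p = (if p.2 ≤ p.1 then f p else 0) + (if p.1 < p.2 then f p else 0) := by
    intro p
    by_cases h : p.2 ≤ p.1
    · simp [h, not_lt.2 h]
    · simp [h, not_le.1 h]
  have h2 : ∑ p : Fin N × Fin N, (if p.1 < p.2 then f p else 0)
      = ∑ p : Fin N × Fin N, if p.2 < p.1 then f p.swap else 0 :=
    (Fintype.sum_equiv (Equiv.prodComm _ _) _ _ fun p => by simp)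
  have h3 : ∑ p : {p : Fin N × Fin N // p.2 ≤ p.1},
      (if p.1.2 = p.1.1 then f p.1 else f p.1 + f p.1.swap)
      = ∑ p : Fin N × Fin N, if p.2 ≤ p.1 then
          (if p.2 = p.1 then f p else f p + f p.swap) else 0 := by
    rw [← Finset.sum_filter]
    exact (Finset.sum_subtype (Finset.univ.filter fun p : Fin N × Fin N => p.2 ≤ p.1)
      (by simp) (fun p => if p.2 = p.1 then f p else f p + f p.swap)).symm
  rw [h3, Finset.sum_congr rfl fun p _ => h1 p, Finset.sum_add_distrib, h2,
    ← Finset.sum_add_distrib]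
  refine Finset.sum_congr rfl fun p _ => ?_
  rcases lt_trichotomy p.2 p.1 with h | h | h
  · simp [h, h.le, h.ne]
  · simp [h]
  · simp [not_le.2 h, not_lt.2 h.le]

/-- The linear form on a single entry that collects the contribution of `x_{ab}` and of its
conjugate `x_{ba}` to the scalar product of `gueCoords x` with `t`. -/
noncomputable def pairForm (t : Fin N × Fin N → ℝ) (p : Fin N × Fin N) (w : ℂ) : ℝ :=
  if p.2 = p.1 then t p * w.re else (t p + t p.swap) * w.re + (t p - t p.swap) * w.im

lemma inner_gueCoords (hx : IsGUEEntries P x) (t : EuclideanSpace ℝ (Fin N × Fin N)) (ω : Ω) :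
    inner ℝ (gueCoords x ω) t
      = ∑ p : {p : Fin N × Fin N // p.2 ≤ p.1}, pairForm t p.1 (x p.1.1 p.1.2 ω) := by
  rw [PiLp.inner_apply, sum_prod_eq_sum_lower]
  refine Finset.sum_congr rfl fun p _ => ?_
  obtain ⟨⟨a, b⟩, hab⟩ := p
  simp only [pairForm, gueCoords, Prod.swap_prod_mk]
  have h1 := hx.hermitian a b ω
  by_cases h : b = a
  · subst h
    have h2 : (x b b ω).im = 0 := Complex.conj_eq_iff_im.1 h1.symm
    simp [h2, mul_comm]
  · simp [h, h1]
    ring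

/-- The characteristic function of the coordinates carried by one entry on or below the diagonal. -/
lemma integral_exp_pairForm [IsProbabilityMeasure P] (hx : IsGUEEntries P x)
    (t : Fin N × Fin N → ℝ) (p : {p : Fin N × Fin N // p.2 ≤ p.1}) :
    ∫ ω, Complex.exp (pairForm t p.1 (x p.1.1 p.1.2 ω) * Complex.I) ∂P
      = Complex.exp (-(((if p.1.2 = p.1.1 then t p.1 ^ 2 else t p.1 ^ 2 + t p.1.swap ^ 2 : ℝ) : ℂ))
          / 2) := by
  obtain ⟨⟨a, b⟩, hab⟩ := p
  have hm := hx.measurable a b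
  have hchar : ∀ {Z : Ω → ℝ} {v : NNReal}, Measurable Z → P.map Z = gaussianReal 0 v →
      ∀ s : ℝ, ∫ ω, Complex.exp (s * Z ω * Complex.I) ∂P = Complex.exp (-(v * s ^ 2 / 2)) := by
    intro Z v hZ hlaw s
    have h1 := charFun_gaussianReal (μ := 0) (v := v) s
    rw [← hlaw, charFun_apply_real, integral_map hZ.aemeasurable
      (Continuous.aestronglyMeasurable (by fun_prop))] at h1
    rw [h1]
    congr 1
    simp
  simp only [pairForm]
  by_cases h : b = a
  · subst h
    have h1 := hchar (Complex.measurable_re.comp (hx.measurable b b)) (hx.law_diag b) (t (b, b))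
    simp only [if_true, Complex.ofReal_mul, Complex.ofReal_pow]
    simp only [Function.comp_apply] at h1
    rw [h1]
    congr 1
    simp
    ring
  · have hlt : b < a := lt_of_le_of_ne hab h
    simp only [if_neg h, Prod.swap_prod_mk]
    have h1 := hchar (Complex.measurable_re.comp (hx.measurable a b)) (hx.law_re a b hlt)
      (t (a, b) + t (b, a))
    have h2 := hchar (Complex.measurable_im.comp (hx.measurable a b)) (hx.law_im a b hlt)
      (t (a, b) - t (b, a))
    simp only [Function.comp_apply] at h1 h2
    have h3 := (hx.indep_re_im a b hlt).integral_fun_comp_mul_comp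
      (f := fun r : ℝ => Complex.exp ((t (a, b) + t (b, a) : ℝ) * r * Complex.I))
      (g := fun r : ℝ => Complex.exp ((t (a, b) - t (b, a) : ℝ) * r * Complex.I))
      (by fun_prop) (by fun_prop) (Continuous.aestronglyMeasurable (by fun_prop))
      (Continuous.aestronglyMeasurable (by fun_prop))
    rw [h1, h2, ← Complex.exp_add] at h3
    have h4 : ∀ ω, Complex.exp (((t (a, b) + t (b, a)) * (x a b ω).re
        + (t (a, b) - t (b, a)) * (x a b ω).im : ℝ) * Complex.I)
        = Complex.exp ((t (a, b) + t (b, a) : ℝ) * (x a b ω).re * Complex.I)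
          * Complex.exp ((t (a, b) - t (b, a) : ℝ) * (x a b ω).im * Complex.I) := by
      intro ω
      rw [← Complex.exp_add]
      congr 1
      push_cast
      ring
    simp_rw [h4]
    rw [h3]
    congr 1
    push_cast
    ring

/-- The coordinates of a family of GUE entries form a standard Gaussian vector. -/
theorem map_gueCoords [IsProbabilityMeasure P] (hx : IsGUEEntries P x) :
    P.map (gueCoords x) = stdGaussian (EuclideanSpace ℝ (Fin N × Fin N)) := by
  have hmeas := measurable_gueCoords hx
  have : IsProbabilityMeasure (P.map (gueCoords x)) :=
    Measure.isProbabilityMeasure_map hmeas.aemeasurable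
  refine Measure.ext_of_charFun ?_
  ext t
  rw [charFun_stdGaussian, charFun_apply, integral_map hmeas.aemeasurable
    (Continuous.aestronglyMeasurable (by fun_prop))]
  have hpt : ∀ ω, Complex.exp (inner ℝ (gueCoords x ω) t * Complex.I)
      = ∏ p : {p : Fin N × Fin N // p.2 ≤ p.1},
        Complex.exp (pairForm t p.1 (x p.1.1 p.1.2 ω) * Complex.I) := by
    intro ω
    rw [inner_gueCoords hx, ← Complex.exp_sum, ← Finset.sum_mul, Complex.ofReal_sum]
  simp_rw [hpt]
  have hform : ∀ p : Fin N × Fin N, Continuous (pairForm t p) := by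
    intro p
    unfold pairForm
    split_ifs <;> fun_prop
  rw [hx.indep.integral_fun_prod_comp (f := fun p w => Complex.exp (pairForm t p.1 w * Complex.I))
    (fun p => (hx.measurable _ _).aemeasurable)
    (fun p => Continuous.aestronglyMeasurable (by have := hform p.1; fun_prop))]
  rw [Finset.prod_congr rfl fun p _ => integral_exp_pairForm hx t p, ← Complex.exp_sum]
  congr 1
  rw [← Finset.sum_div, Finset.sum_neg_distrib, ← Complex.ofReal_sum,
    ← sum_prod_eq_sum_lower (fun p => t p ^ 2), ← Complex.ofReal_pow, EuclideanSpace.norm_sq_eq]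
  simp

end GUELaw

/-! ### The bias of the resolvent -/

section Profile

variable {N : ℕ} {Γ : Matrix (Fin N) (Fin N) ℝ} {Y : Matrix (Fin N) (Fin N) ℂ}

/-- The standard deviations `γ(i,j) / √N` of the entries of `profileMatrix Γ`. -/
noncomputable def profileScale (Γ : Matrix (Fin N) (Fin N) ℝ) : Matrix (Fin N) (Fin N) ℝ :=
  Matrix.of fun i j => √(Γ i j) / √(N : ℝ)

lemma profileScale_isSymm (hΓ : Γ.IsSymm) : (profileScale Γ).IsSymm := by
  ext i j
  simp [profileScale, hΓ.apply i j]

lemma profileScale_sq (hΓ : ∀ i j, 0 ≤ Γ i j) (i j : Fin N) :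
    profileScale Γ i j ^ 2 = Γ i j / N := by
  simp [profileScale, div_pow, Real.sq_sqrt (hΓ i j)]

lemma entrySq_profileScale (hΓ : ∀ i j, 0 ≤ Γ i j) :
    entrySq (profileScale Γ) = normalizedProfile Γ := by
  ext i j
  exact profileScale_sq hΓ i j

lemma profileMatrix_gueEntry (g : EuclideanSpace ℝ (Fin N × Fin N)) :
    profileMatrix Γ (gueEntry g) = gaussMat (profileScale Γ) g := by
  ext i j
  simp only [profileMatrix, gaussMat_apply, profileScale, Matrix.of_apply]
  push_cast
  ring

lemma gammaMax_nonneg (Γ : Matrix (Fin N) (Fin N) ℝ) : 0 ≤ gammaMax Γ := Real.sqrt_nonneg _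

lemma le_gammaMax_sq (hΓ : ∀ i j, 0 ≤ Γ i j) (i j : Fin N) : Γ i j ≤ gammaMax Γ ^ 2 := by
  have h1 : Γ i j ≤ ⨆ p : Fin N × Fin N, Γ p.1 p.2 :=
    le_ciSup (f := fun p : Fin N × Fin N => Γ p.1 p.2) (Set.finite_range _).bddAbove (i, j)
  rw [gammaMax, Real.sq_sqrt ((hΓ i j).trans h1)]
  exact h1

lemma profileScale_sq_le (hΓ : ∀ i j, 0 ≤ Γ i j) (i j : Fin N) :
    profileScale Γ i j ^ 2 ≤ gammaMax Γ ^ 2 / N := by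
  rw [profileScale_sq hΓ]
  exact div_le_div_of_nonneg_right (le_gammaMax_sq hΓ i j) (Nat.cast_nonneg N)

/-- The bias of the resolvent: the expected resolvent is close to the deterministic equivalent. -/
theorem norm_meanResolvent_sub_detEquiv_le (hN : 0 < N) (hΓs : Γ.IsSymm)
    (hΓ : ∀ i j, 0 ≤ Γ i j) (hY : Y.IsHermitian) {z : ℂ} (hz : 0 < z.im) {δ : ℝ} (hδ0 : 0 < δ)
    (hδ1 : δ < 1) (hzδ : gammaMax Γ * (2 / (N * (1 - δ))) ^ (1 / 5 : ℝ) ≤ z.im) :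
    ‖meanResolvent (profileScale Γ) Y (fun _ => z)
        - (omegaSq Γ Y (z • (1 : Matrix (Fin N) (Fin N) ℂ)) - Y)⁻¹‖
      ≤ 2 * gammaMax Γ ^ 3 / (N * z.im ^ 4)
        + (1 + gammaMax Γ ^ 2 / (δ * z.im ^ 2)) * (2 * gammaMax Γ ^ 5 / (N * z.im ^ 6)) := by
  have hN' : (0 : ℝ) < N := Nat.cast_pos.2 hN
  have hN0 : (N : ℝ) ≠ 0 := hN'.ne'
  have hγ0 := gammaMax_nonneg Γ
  have hS := normalizedProfile_nonneg hΓ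
  set η := z.im with hη
  set γ := gammaMax Γ with hγ
  set D : Fin N → ℂ := fun _ => z with hD
  have hDη : ∀ i, η ≤ (D i).im := fun _ => le_rfl
  have hD0 : ∀ i, 0 < (D i).im := fun _ => hz
  have hc := profileScale_isSymm hΓs
  set ε := η⁻¹ * (γ ^ 3 / (N * η ^ 2) * η⁻¹) with hε
  have hε0 : 0 ≤ ε := by positivity
  have hε' : ε = γ ^ 3 / (N * η ^ 4) := by rw [hε]; field_simp
  have hmean : ‖meanResolvent (profileScale Γ) Y D -
      (Matrix.diagonal (D - selfEnergy (normalizedProfile Γ)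
        (meanResolvent (profileScale Γ) Y D).diag) - Y)⁻¹‖ ≤ ε := by
    rw [← entrySq_profileScale hΓ]
    -- `κ` bounds the variances, `T` the sums of their squares over a row
    refine norm_meanResolvent_sub_le (κ := γ ^ 2 / N) (T := N * (γ ^ 2 / N) ^ 2) hc hY hz hDη
      (by positivity) (profileScale_sq_le hΓ) (fun i => ?_) (by positivity) (le_of_eq ?_)
    · calc _ ≤ ∑ _j : Fin N, (γ ^ 2 / N) ^ 2 := Finset.sum_le_sum fun j _ =>
            pow_le_pow_left₀ (sq_nonneg _) (profileScale_sq_le hΓ i j) 2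
        _ = _ := by simp
    · field_simp
  have hσ : ∀ i, ∑ j, normalizedProfile Γ i j ≤ γ ^ 2 := by
    intro i
    calc _ ≤ ∑ _j : Fin N, γ ^ 2 / N := Finset.sum_le_sum fun j _ =>
          div_le_div_of_nonneg_right (le_gammaMax_sq hΓ i j) hN'.le
      _ = γ ^ 2 := by simp; field_simp
  have hδ' : 0 < 1 - δ := by linarith
  have hεδ : γ ^ 2 * ε ≤ (1 - δ) * η := by
    -- the fifth power of the lower bound on `Im z`, with a factor 2 to spare
    have h1 := pow_le_pow_left₀ (by positivity) hzδ 5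
    rw [mul_pow, ← Real.rpow_natCast ((2 / (N * (1 - δ))) ^ (1 / 5 : ℝ)) 5,
      ← Real.rpow_mul (by positivity)] at h1
    norm_num at h1
    rw [← mul_div_assoc, div_le_iff₀ (by positivity)] at h1
    rw [hε', ← mul_div_assoc, div_le_iff₀ (by positivity)]
    have h2 : 0 ≤ γ ^ 5 := by positivity
    nlinarith
  have hsol := (isDetEquiv_detEquiv hΓ hY).isDysonSolution hD0
  have hz1 : z • (1 : Matrix (Fin N) (Fin N) ℂ) = Matrix.diagonal D := by
    rw [hD, Matrix.smul_one_eq_diagonal]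
  have hstab := norm_inv_sub_inv_le_of_approx_isDysonSolution hS hY hz hDη (sq_nonneg γ) hσ hε0
    hδ0 hεδ (meanResolvent_diag_im_nonpos hc hY hD0)
    (fun i => (norm_entry_le_l2_opNorm _ i i).trans hmean) hsol
  rw [← diagonal_sub_mapR D (detEquiv Γ Y (Matrix.diagonal D))] at hstab
  rw [hz1, omegaSq]
  have htri := norm_sub_le_norm_sub_add_norm_sub (meanResolvent (profileScale Γ) Y D)
    (Matrix.diagonal (D - selfEnergy (normalizedProfile Γ)
        (meanResolvent (profileScale Γ) Y D).diag) - Y)⁻¹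
    (Matrix.diagonal D - mapR Γ (detEquiv Γ Y (Matrix.diagonal D)) - Y)⁻¹
  refine htri.trans ((add_le_add hmean hstab).trans ?_)
  have h1 : η⁻¹ * (γ ^ 2 * (ε + γ ^ 2 * ε / (δ * η * η))) * η⁻¹
      = (1 + γ ^ 2 / (δ * η ^ 2)) * (γ ^ 5 / (N * η ^ 6)) := by
    rw [hε']; field_simp
  rw [h1, hε']
  refine add_le_add ?_ (mul_le_mul_of_nonneg_left ?_ (by positivity))
  · rw [mul_div_assoc]
    linarith [show 0 ≤ γ ^ 3 / (N * η ^ 4) by positivity]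
  · rw [mul_div_assoc]
    linarith [show 0 ≤ γ ^ 5 / (N * η ^ 6) by positivity]

end Profile

/-! ### Concentration and conclusion -/

section Concentration

variable {N k : ℕ} {Γ : Matrix (Fin N) (Fin N) ℝ} {Y : Matrix (Fin N) (Fin N) ℂ}
  {U : Matrix (Fin N) (Fin k) ℂ}

lemma l2_opNorm_le_card_mul {M : Matrix (Fin k) (Fin k) ℂ} {t : ℝ} (ht : 0 ≤ t)
    (h : ∀ i j, ‖M i j‖ ≤ t) : ‖M‖ ≤ k * t := by
  refine l2_opNorm_le_of_sum_mulVec (by positivity) fun v => ?_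
  have h1 : ∀ i, ‖(M *ᵥ v) i‖ ^ 2 ≤ t ^ 2 * (k * ∑ j, ‖v j‖ ^ 2) := by
    intro i
    have h2 : ‖(M *ᵥ v) i‖ ≤ t * ∑ j, ‖v j‖ := by
      have h0 : (M *ᵥ v) i = ∑ j, M i j * v j := rfl
      rw [h0, Finset.mul_sum]
      refine (norm_sum_le _ _).trans ?_
      refine Finset.sum_le_sum fun j _ => ?_
      rw [norm_mul]
      exact mul_le_mul_of_nonneg_right (h i j) (norm_nonneg _)
    have h3 := sq_sum_le_card_mul_sum_sq (s := Finset.univ) (f := fun j => ‖v j‖)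
    rw [Finset.card_univ, Fintype.card_fin] at h3
    calc _ ≤ (t * ∑ j, ‖v j‖) ^ 2 := pow_le_pow_left₀ (norm_nonneg _) h2 2
      _ = t ^ 2 * (∑ j, ‖v j‖) ^ 2 := mul_pow _ _ _
      _ ≤ _ := mul_le_mul_of_nonneg_left h3 (sq_nonneg t)
  refine (Finset.sum_le_sum fun i _ => h1 i).trans_eq ?_
  simp
  ring

lemma exists_le_norm_entry_of_le_l2_opNorm {M : Matrix (Fin k) (Fin k) ℂ} {t : ℝ} (hk : 1 ≤ k)
    (h : k * t ≤ ‖M‖) : ∃ p : Fin k × Fin k, t ≤ ‖M p.1 p.2‖ := by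
  have : Nonempty (Fin k) := ⟨⟨0, hk⟩⟩
  obtain ⟨p, hp⟩ := Finite.exists_max fun p : Fin k × Fin k => ‖M p.1 p.2‖
  refine ⟨p, le_of_mul_le_mul_left (h.trans ?_) (Nat.cast_pos.2 hk : (0 : ℝ) < k)⟩
  exact l2_opNorm_le_card_mul (norm_nonneg _) fun i j => hp (i, j)

lemma l2_opNorm_le_one_of_conjTranspose_mul_self (hU : Uᴴ * U = 1) : ‖U‖ ≤ 1 := by
  have h1 := Matrix.l2_opNorm_conjTranspose_mul_self U
  have h2 : ‖(1 : Matrix (Fin k) (Fin k) ℂ)‖ ≤ 1 := by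
    rw [← Matrix.diagonal_one, Matrix.l2_opNorm_diagonal,
      pi_norm_le_iff_of_nonneg zero_le_one]
    simp
  rw [hU] at h1
  nlinarith [norm_nonneg U]

lemma sum_norm_col_sq_of_conjTranspose_mul_self (hU : Uᴴ * U = 1) (i : Fin k) :
    ∑ a, ‖U a i‖ ^ 2 = 1 := by
  have h := congrFun₂ hU i i
  rw [Matrix.mul_apply, Matrix.one_apply_eq] at h
  have h1 : ∀ a, Uᴴ i a * U a i = ((‖U a i‖ ^ 2 : ℝ) : ℂ) := by
    intro a
    push_cast
    exact Complex.conj_mul' (U a i)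
  simp_rw [h1, ← Complex.ofReal_sum] at h
  exact_mod_cast h

lemma conjTranspose_mul_mul_apply_eq_trace (Q : Matrix (Fin N) (Fin N) ℂ) (i j : Fin k) :
    (Uᴴ * Q * U) i j = traceCLM (Matrix.of fun a b => U a j * star (U b i)) Q := by
  rw [traceCLM_apply, Matrix.trace]
  simp only [Matrix.mul_apply, Matrix.diag_apply, Matrix.of_apply, Matrix.conjTranspose_apply,
    Finset.sum_mul]
  refine Finset.sum_congr rfl fun a _ => Finset.sum_congr rfl fun b _ => ?_
  ring

/-- Concentration of one entry of `U* R U` for the resolvent `R`. -/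
lemma measureReal_le_norm_entry_sub (hN : 0 < N) (hΓs : Γ.IsSymm) (hΓ : ∀ i j, 0 ≤ Γ i j)
    (hY : Y.IsHermitian) (hU : Uᴴ * U = 1) {z : ℂ} (hz : 0 < z.im) (hγ : 0 < gammaMax Γ) {d : ℝ}
    (hd : 0 < d) (i j : Fin k) :
    (stdGaussian (EuclideanSpace ℝ (Fin N × Fin N))).real
      {g | √2 * gammaMax Γ * (√(d * Real.log N) / z.im ^ 2) * (N : ℝ) ^ (-(1 / 2) : ℝ) ≤
        ‖(Uᴴ * gaussResolvent (profileScale Γ) Y (fun _ => z) g * U) i j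
          - (Uᴴ * meanResolvent (profileScale Γ) Y (fun _ => z) * U) i j‖}
      ≤ 2 * (N : ℝ) ^ (-d) := by
  have hN' : (0 : ℝ) < N := Nat.cast_pos.2 hN
  have hlog : 0 ≤ Real.log N := Real.log_nonneg (by exact_mod_cast hN)
  have hc := profileScale_isSymm hΓs
  have hD0 : ∀ _i : Fin N, 0 < z.im := fun _ => hz
  set W : Matrix (Fin N) (Fin N) ℂ := Matrix.of fun a b => U a j * star (U b i) with hW
  set L := gammaMax Γ / (√N * z.im ^ 2) with hL
  have hL0 : 0 < L := by positivity
  set t := √2 * gammaMax Γ * (√(d * Real.log N) / z.im ^ 2) * (N : ℝ) ^ (-(1 / 2) : ℝ) with ht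
  have hF : BoundedC1 fun g => traceCLM W (gaussResolvent (profileScale Γ) Y (fun _ => z) g) :=
    boundedC1_clm_gaussResolvent hc hY hD0 _
  have hfrob : ∑ a, ∑ b, ‖W a b‖ ^ 2 = 1 := by
    simp only [hW, Matrix.of_apply, norm_mul, norm_star, mul_pow]
    rw [← Finset.sum_mul_sum, sum_norm_col_sq_of_conjTranspose_mul_self hU,
      sum_norm_col_sq_of_conjTranspose_mul_self hU, one_mul]
  have hgrad : ∀ g, gradNormSq (fun g => traceCLM W
      (gaussResolvent (profileScale Γ) Y (fun _ => z) g)) g ≤ L ^ 2 := by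
    intro g
    refine (gradNormSq_trace_gaussResolvent_le hc hY hz (fun _ => le_rfl)
      (by positivity : 0 ≤ gammaMax Γ ^ 2 / N) (profileScale_sq_le hΓ) W g).trans_eq ?_
    rw [hfrob, hL, div_pow, mul_pow, Real.sq_sqrt hN'.le]
    field_simp
  have hmean : ∫ g, traceCLM W (gaussResolvent (profileScale Γ) Y (fun _ => z) g)
        ∂(stdGaussian (EuclideanSpace ℝ (Fin N × Fin N)))
      = traceCLM W (meanResolvent (profileScale Γ) Y (fun _ => z)) := by
    have hR := fun a b => (boundedC1_gaussResolvent_apply (D := fun _ => z) hc hY hD0 a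
      b).integrable (stdGaussian (EuclideanSpace ℝ (Fin N × Fin N)))
    have hW' : ∀ Q, traceCLM W Q = ∑ a, ∑ b, W a b * Q b a := fun _ => rfl
    rw [hW', integral_congr_ae (ae_of_all _ fun g => hW' _)]
    refine (integral_finsetSum _ fun a _ =>
      integrable_finsetSum _ fun b _ => (hR b a).const_mul (W a b)).trans ?_
    refine Finset.sum_congr rfl fun a _ => ?_
    refine (integral_finsetSum _ fun b _ => (hR b a).const_mul (W a b)).trans ?_
    exact Finset.sum_congr rfl fun b _ => integral_const_mul _ _
  -- `t / L = √(2 d log N)`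
  have hexp : 2 * Real.exp (-(t ^ 2 / (2 * L ^ 2))) = 2 * (N : ℝ) ^ (-d) := by
    have h1 : ((N : ℝ) ^ (-(1 / 2) : ℝ)) ^ 2 = (N : ℝ)⁻¹ := by
      rw [← Real.rpow_natCast, ← Real.rpow_mul hN'.le]
      norm_num
      exact Real.rpow_neg_one _
    have h2 : t ^ 2 = 2 * gammaMax Γ ^ 2 * (d * Real.log N / z.im ^ 4) * (N : ℝ)⁻¹ := by
      rw [ht, mul_pow, mul_pow, mul_pow, div_pow, h1, Real.sq_sqrt (mul_nonneg hd.le hlog),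
        Real.sq_sqrt (by norm_num)]
      ring
    have h3 : L ^ 2 = gammaMax Γ ^ 2 / (N * z.im ^ 4) := by
      rw [hL, div_pow, mul_pow, Real.sq_sqrt hN'.le]
      ring
    rw [Real.rpow_def_of_pos hN', h2, h3]
    congr 2
    field_simp
  have key := measureReal_le_norm_sub_integral hF hL0 hgrad (t := t) (by positivity)
  rw [hexp, hmean] at key
  simpa only [conjTranspose_mul_mul_apply_eq_trace] using key

end Concentration

theorem corollary1p4 {Ω : Type*} [MeasurableSpace Ω] (P : Measure Ω) [IsProbabilityMeasure P]
    (N k : ℕ) (hk : 1 ≤ k)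
    (x : Fin N → Fin N → Ω → ℂ) (hx : IsGUEEntries P x)
    (Γ : Matrix (Fin N) (Fin N) ℝ) (hΓsymm : Γ.IsSymm) (hΓnonneg : ∀ i j, 0 ≤ Γ i j)
    (Y : Matrix (Fin N) (Fin N) ℂ) (hY : Y.IsHermitian)
    (U : Matrix (Fin N) (Fin k) ℂ) (hU : Uᴴ * U = 1)
    (θ : Fin k → ℝ) (hθ : ∀ i, θ i ≠ 0)
    (Θ : Matrix (Fin k) (Fin k) ℂ) (hΘ : Θ = Matrix.diagonal fun i => (θ i : ℂ)) :
    -- the deterministic equivalent entering `betaTilde` is well defined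
    IsDetEquiv Γ Y (detEquiv Γ Y) ∧
    (∀ G, IsDetEquiv Γ Y G → Set.EqOn G (detEquiv Γ Y) (DPlus N)) ∧
    ∀ (δ : ℝ), 0 < δ → δ < 1 → ∀ (d : ℝ), 0 < d → ∀ (z : ℂ), 0 < z.im →
      gammaMax Γ * (2 / (N * (1 - δ))) ^ (1 / 5 : ℝ) ≤ z.im →
      P.real {ω | ‖Θ‖ * epsBar N k (gammaMax Γ) δ d z.im <
          ‖betaMat (profileMatrix Γ fun i j => x i j ω) Y U Θ z - betaTilde Γ Y U Θ z‖}
        ≤ 4 * (k : ℝ) ^ 2 * (N : ℝ) ^ (-d) ∧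
      -- without noise both sides vanish, so the large inequality needs a nonzero profile
      (0 < gammaMax Γ →
        P.real {ω | ‖Θ‖ * epsBar N k (gammaMax Γ) δ d z.im ≤
            ‖betaMat (profileMatrix Γ fun i j => x i j ω) Y U Θ z - betaTilde Γ Y U Θ z‖}
          ≤ 4 * (k : ℝ) ^ 2 * (N : ℝ) ^ (-d)) := by
  have hdet := isDetEquiv_detEquiv hΓnonneg hY
  refine ⟨hdet, fun G hG => hG.eqOn hΓnonneg hY hdet, fun δ hδ0 hδ1 d hd z hz hzδ => ?_⟩
  -- `ℂ⁰` contains no `k ≥ 1` orthonormal vectors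
  have hN : 0 < N := by
    rcases Nat.eq_zero_or_pos N with h | h
    · subst h
      have := congrFun₂ hU ⟨0, hk⟩ ⟨0, hk⟩
      simp [Matrix.mul_apply] at this
    · exact h
  have hN' : (0 : ℝ) < N := Nat.cast_pos.2 hN
  have hk' : (0 : ℝ) < k := Nat.cast_pos.2 hk
  have hΘpos : 0 < ‖Θ‖ := by
    rw [norm_pos_iff]
    intro h0
    have := congrFun₂ h0 ⟨0, hk⟩ ⟨0, hk⟩
    rw [hΘ, Matrix.diagonal_apply_eq] at this
    exact hθ ⟨0, hk⟩ (by simpa using this)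
  have hlarge : 0 < gammaMax Γ →
      P.real {ω | ‖Θ‖ * epsBar N k (gammaMax Γ) δ d z.im ≤
          ‖betaMat (profileMatrix Γ fun i j => x i j ω) Y U Θ z - betaTilde Γ Y U Θ z‖}
        ≤ 4 * (k : ℝ) ^ 2 * (N : ℝ) ^ (-d) := by
    intro hγ
    set c := profileScale Γ with hc
    set D : Fin N → ℂ := fun _ => z with hD
    set R := gaussResolvent c Y D with hR
    set t := √2 * gammaMax Γ * (√(d * Real.log N) / z.im ^ 2) * (N : ℝ) ^ (-(1 / 2) : ℝ) with ht
    set Q := (omegaSq Γ Y (z • (1 : Matrix (Fin N) (Fin N) ℂ)) - Y)⁻¹ with hQ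
    have hbias := norm_meanResolvent_sub_detEquiv_le hN hΓsymm hΓnonneg hY hz hδ0 hδ1 hzδ
    set b := 2 * gammaMax Γ ^ 3 / (N * z.im ^ 4)
        + (1 + gammaMax Γ ^ 2 / (δ * z.im ^ 2)) * (2 * gammaMax Γ ^ 5 / (N * z.im ^ 6)) with hb
    have heps : epsBar N k (gammaMax Γ) δ d z.im = k * t + b := by
      rw [epsBar, ht, hb]
      ring
    -- the event that the entry `p` of `U* R U` is far from its mean
    set A : Fin k × Fin k → Set (EuclideanSpace ℝ (Fin N × Fin N)) := fun p =>
      {g | t ≤ ‖(Uᴴ * R g * U) p.1 p.2 - (Uᴴ * meanResolvent c Y D * U) p.1 p.2‖} with hA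
    have hAmeas : ∀ p, MeasurableSet (A p) := by
      intro p
      refine measurableSet_le measurable_const (Continuous.measurable ?_)
      have h1 := boundedC1_clm_gaussResolvent (D := D) (profileScale_isSymm hΓsymm) hY
        (fun _ => hz) (traceCLM (Matrix.of fun a b => U a p.2 * star (U b p.1)))
      simp_rw [conjTranspose_mul_mul_apply_eq_trace]
      exact (h1.continuous.sub continuous_const).norm
    have hUn := l2_opNorm_le_one_of_conjTranspose_mul_self hU
    have hsub : {ω | ‖Θ‖ * epsBar N k (gammaMax Γ) δ d z.im ≤
          ‖betaMat (profileMatrix Γ fun i j => x i j ω) Y U Θ z - betaTilde Γ Y U Θ z‖}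
        ⊆ ⋃ p, gueCoords x ⁻¹' A p := by
      intro ω hω
      rw [Set.mem_ofPred_eq] at hω
      set g := gueCoords x ω with hg
      have hX : (z • (1 : Matrix (Fin N) (Fin N) ℂ)
          - profileMatrix Γ (fun i j => x i j ω) - Y)⁻¹ = R g := by
        have h1 : (fun i j => x i j ω) = gueEntry g := by
          funext i j
          exact (gueEntry_gueCoords hx ω i j).symm
        rw [h1, profileMatrix_gueEntry, hR, gaussResolvent, Matrix.smul_one_eq_diagonal, sub_sub]
      set M := Uᴴ * R g * U - Uᴴ * meanResolvent c Y D * U with hM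
      have hdiff : betaMat (profileMatrix Γ fun i j => x i j ω) Y U Θ z - betaTilde Γ Y U Θ z
          = -((M + Uᴴ * (meanResolvent c Y D - Q) * U) * Θ) := by
        rw [betaMat, betaTilde, hX, ← hQ, hM]
        simp only [Matrix.mul_sub, Matrix.sub_mul, Matrix.add_mul]
        abel
      rw [hdiff, norm_neg, heps] at hω
      have hbias' : ‖Uᴴ * (meanResolvent c Y D - Q) * U‖ ≤ b := by
        refine (Matrix.l2_opNorm_mul _ _).trans ?_
        refine (mul_le_of_le_one_right (norm_nonneg _) hUn).trans ?_
        refine (Matrix.l2_opNorm_mul _ _).trans ?_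
        rw [Matrix.l2_opNorm_conjTranspose]
        exact (mul_le_of_le_one_left (norm_nonneg _) hUn).trans hbias
      have h1 : k * t + b ≤ ‖M + Uᴴ * (meanResolvent c Y D - Q) * U‖ := by
        refine le_of_mul_le_mul_left (hω.trans ?_) hΘpos
        rw [mul_comm ‖Θ‖]
        exact norm_mul_le _ _
      have h2 : k * t ≤ ‖M‖ := by
        have := norm_add_le M (Uᴴ * (meanResolvent c Y D - Q) * U)
        linarith
      obtain ⟨p, hp⟩ := exists_le_norm_entry_of_le_l2_opNorm hk h2
      exact Set.mem_iUnion.2 ⟨p, hp⟩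
    have hmeas := measurable_gueCoords hx
    have hp : ∀ p, P.real (gueCoords x ⁻¹' A p) ≤ 2 * (N : ℝ) ^ (-d) := by
      intro p
      rw [← map_measureReal_apply hmeas (hAmeas p), map_gueCoords hx]
      exact measureReal_le_norm_entry_sub hN hΓsymm hΓnonneg hY hU hz hγ hd p.1 p.2
    calc _ ≤ P.real (⋃ p, gueCoords x ⁻¹' A p) := measureReal_mono hsub
      _ ≤ ∑ p, P.real (gueCoords x ⁻¹' A p) := measureReal_iUnion_fintype_le _
      _ ≤ ∑ _p : Fin k × Fin k, 2 * (N : ℝ) ^ (-d) := Finset.sum_le_sum fun p _ => hp p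
      _ = 2 * (k : ℝ) ^ 2 * (N : ℝ) ^ (-d) := by simp; ring
      _ ≤ _ := by
          have : 0 ≤ (k : ℝ) ^ 2 * (N : ℝ) ^ (-d) := by positivity
          linarith
  refine ⟨?_, hlarge⟩
  rcases (gammaMax_nonneg Γ).eq_or_lt with h0 | hγ
  · -- without noise the two matrices coincide
    have hΓ0 : Γ = 0 := by
      ext i j
      have h1 := le_gammaMax_sq hΓnonneg i j
      rw [← h0] at h1
      exact le_antisymm (by simpa using h1) (hΓnonneg i j)
    have hempty : {ω | ‖Θ‖ * epsBar N k (gammaMax Γ) δ d z.im <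
        ‖betaMat (profileMatrix Γ fun i j => x i j ω) Y U Θ z - betaTilde Γ Y U Θ z‖} = ∅ := by
      refine Set.eq_empty_of_forall_notMem fun ω hω => ?_
      have h1 : profileMatrix Γ (fun i j => x i j ω) = 0 := by
        ext i j
        simp [profileMatrix, hΓ0]
      have h2 : omegaSq Γ Y (z • (1 : Matrix (Fin N) (Fin N) ℂ)) = z • 1 := by
        have : mapR Γ (detEquiv Γ Y (z • 1)) = 0 := by
          simp [mapR, hΓ0]
        rw [omegaSq, this, sub_zero]
      rw [Set.mem_ofPred_eq, betaMat, betaTilde, h1, h2, ← h0] at hω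
      simp [epsBar] at hω
    rw [hempty, measureReal_empty]
    positivity
  · refine (measureReal_mono fun ω hω => ?_).trans (hlarge hγ)
    rw [Set.mem_ofPred_eq] at hω ⊢
    exact hω.le
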